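/- Let $N\ge 1$ and $d$ be natural numbers, $1/2\le H<1$, $0<\beta<N$, and assume $N-2H-1<\beta<N-2H+1$. Put $\alpha=\tfrac12(2H+1-N+\beta)\in(0,1)$ and $\mathscr F\varphi(\xi)=\int_{\mathbb R^N}e^{-ix\cdot\xi}\varphi(x)\,dx$. *Noise.* Let $f:\mathbb R^N\to\mathbb R$ be the Fourier transform of a measure $h(\xi)\,d\xi$, in the sense that $\int f\varphi\,dx=\int \mathscr F\varphi(\xi)h(\xi)\,d\xi$ for all Schwartz functions $\varphi$, where $C_1|\xi|^{-\beta}\le h(\xi)\le C_2|\xi|^{-\beta}$ for almost every $\xi$, with constants $C_1,C_2\in(0,\infty)$. Let $\rho_H(r)=|r|^{2H-2}$ if $H>1/2$ and $\rho_{1/2}=\delta_0$. Let $W_1,\dots,W_d$ be i.i.d. centred Gaussian processes indexed by $C_c^\infty(\mathbb R_+\times\mathbb R^N)$, with $$\mathbb E[W_j(\varphi)W_j(\psi)]=\langle\varphi,\psi\rangle:=\int_{\mathbb R_+}\!dt\int_{\mathbb R_+}\!ds\int_{\mathbb R^N}\!dx\int_{\mathbb R^N}\!dy\;\varphi(t,x)\,\rho_H(t-s)\,f(x-y)\,\psi(s,y).$$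 Extend $\varphi\mapsto W_j(\varphi)\in L^2(\mathbb P)$ isometrically to the completion of $C_c^\infty(\mathbb R_+\times\mathbb R^N)$, whose norm is expressed through spatial Fourier transforms by $$\|S\|^2=\int_{\mathbb R^N}d\xi\,h(\xi)\int_{\mathbb R_+}dt\int_{\mathbb R_+}ds\,\rho_H(t-s)\,\mathscr FS(t)(\xi)\,\overline{\mathscr FS(s)(\xi)}.$$ *Solution.* Let $u=(u_1,\dots,u_d)$ be a jointly measurable version of the random field solution of $\partial_t^2u_j=\Delta u_j+\dot W_j$ on $\mathbb R_+\times\mathbb R^N$ with zero initial data. That is, $u_j(t,x)=W_j(g_{t,x})$ with $g_{t,x}(s,y)=G(t-s,x-y)\mathbf 1_{[0,t]}(s)$, where $G$ is the fundamental solution of the wave equation, $\mathscr FG(t,\cdot)(\xi)=\sin(t|\xi|)/|\xi|$. *Local times.* An $\mathbb R^d$-valued random field $X$ indexed by a compact interval $T=\prod_{i=1}^k[a_i,b_i]\subset\mathbb R^k$ is said to have a jointly continuous local time on $T$ if there are random variables $L(v,Q_z)\ge 0$, where $v\in\mathbb R^d$, $z\in T$ and $Q_z=T\cap\prod_{i=1}^k(-\infty,z_i]$,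 with the following properties. For each $z$, $L(v,Q_z)$ is jointly measurable in $(v,\omega)$. Almost surely, $\lambda_k\{w\in Q_z:X(w)\in B\}=\int_BL(v,Q_z)\,dv$ for all $z\in T$ and all Borel sets $B\subset\mathbb R^d$. Almost surely, $(v,z)\mapsto L(v,Q_z)$ is continuous on $\mathbb R^d\times T$. Then: (i) If $\alpha d<1$, then for every $x_0\in\mathbb R^N$, $\{u(t,x_0):t\in T_1\}$ has a jointly continuous local time on every compact interval $T_1\subset(0,\infty)$. (ii) If $\alpha d<N$, then for every $t_0>0$, $\{u(t_0,x):x\in T_2\}$ has a jointly continuous local time on every compact interval $T_2\subset\mathbb R^N$. (iii) If $\alpha d<1+N$, then $\{u(t,x):(t,x)\in T\}$ has a jointly continuous local time on every compact interval $T\subset(0,\infty)\times\mathbb R^N$. -/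

import Mathlib

open MeasureTheory ProbabilityTheory Filter Topology
open scoped ENNReal NNReal Distributions SchwartzMap

namespace StochasticWave

noncomputable section

/-- Fourier transform `ℱφ(ξ) = ∫ e^{-i x·ξ} φ(x) dx` on `ℝ^N` (angular frequency convention). -/
def spatialFourier {N : ℕ} (φ : EuclideanSpace ℝ (Fin N) → ℂ) (ξ : EuclideanSpace ℝ (Fin N)) : ℂ :=
  ∫ x, Complex.exp (-Complex.I * ((inner ℝ x ξ : ℝ) : ℂ)) * φ x

/-- The real function `f` on `ℝ^N` is the Fourier transform of the measure `h(ξ) dξ`: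
`∫ f φ = ∫ ℱφ(ξ) h(ξ) dξ` for all Schwartz functions `φ`, and the density `h` is comparable to
`|ξ|^{-β}`. -/
structure IsSpatialCovariance {N : ℕ} (β : ℝ) (f h : EuclideanSpace ℝ (Fin N) → ℝ) : Prop where
  measurable_density : Measurable h
  comparable : ∃ C₁ C₂ : ℝ, 0 < C₁ ∧ 0 < C₂ ∧
    ∀ᵐ ξ : EuclideanSpace ℝ (Fin N), C₁ * ‖ξ‖ ^ (-β) ≤ h ξ ∧ h ξ ≤ C₂ * ‖ξ‖ ^ (-β)
  integrable_mul : ∀ φ : 𝓢(EuclideanSpace ℝ (Fin N), ℂ), Integrable (fun x => (f x : ℂ) * φ x)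
  integral_mul : ∀ φ : 𝓢(EuclideanSpace ℝ (Fin N), ℂ),
    ∫ x, (f x : ℂ) * φ x = ∫ ξ, spatialFourier (fun x => φ x) ξ * (h ξ : ℂ)

/-- `∫_{ℝ₊} dt ∫_{ℝ₊} ds ρ_H(t - s) k(t, s)`, where `ρ_H(r) = |r|^{2H-2}` for `H ≠ 1/2` and
`ρ_{1/2}` is the Dirac mass at `0`. -/
def timePairing {F : Type*} [NormedAddCommGroup F] [NormedSpace ℝ F] (H : ℝ) (k : ℝ → ℝ → F) : F :=
  if H = 1 / 2 then ∫ t in Set.Ici (0 : ℝ), k t t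
  else ∫ t in Set.Ici (0 : ℝ), ∫ s in Set.Ici (0 : ℝ), (|t - s| ^ (2 * H - 2)) • k t s

/-- Smooth compactly supported real functions of `(t, x) ∈ ℝ × ℝ^N`. Everything below depends only
on their restrictions to `ℝ₊ × ℝ^N`. -/
abbrev Test (N : ℕ) : Type := 𝓓((⊤ : TopologicalSpace.Opens (ℝ × EuclideanSpace ℝ (Fin N))), ℝ)

/-- `⟨φ, ψ⟩ = ∫_{ℝ₊} dt ∫_{ℝ₊} ds ∫ dx ∫ dy φ(t, x) ρ_H(t - s) f(x - y) ψ(s, y)`. -/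
def noiseCovariance {N : ℕ} (H : ℝ) (f : EuclideanSpace ℝ (Fin N) → ℝ) (φ ψ : Test N) : ℝ :=
  timePairing H fun t s => ∫ x, ∫ y, φ (t, x) * f (x - y) * ψ (s, y)

/-- `W = (W_1, …, W_d)` is a vector of i.i.d. centred generalized Gaussian processes, indexed by
test functions, each with covariance `E[W_j(φ) W_j(ψ)] = ⟨φ, ψ⟩`. -/
structure IsFractionalColoredNoise {N d : ℕ} {Ω : Type*} [MeasurableSpace Ω] (P : Measure Ω)
    (H : ℝ) (f : EuclideanSpace ℝ (Fin N) → ℝ) (W : Fin d → Test N → Ω → ℝ) : Prop where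
  measurable : ∀ j φ, Measurable (W j φ)
  gaussian : ∀ j, IsGaussianProcess (W j) P
  mean_zero : ∀ j φ, ∫ ω, W j φ ω ∂P = 0
  covariance : ∀ j φ ψ, ∫ ω, W j φ ω * W j ψ ω ∂P = noiseCovariance H f φ ψ
  independent : iIndepFun (fun j ω φ => W j φ ω) P

/-- Squared norm, in the Hilbert space of the noise, of a distribution-valued function `S` of time
that is given through its spatial Fourier transforms `S t ξ = ℱS(t)(ξ)`:
`∫ dξ h(ξ) ∫_{ℝ₊} dt ∫_{ℝ₊} ds ρ_H(t - s) ℱS(t)(ξ) conj(ℱS(s)(ξ))`.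
The inner double time integral is a nonnegative real number. -/
def spectralNormSq {N : ℕ} (H : ℝ) (h : EuclideanSpace ℝ (Fin N) → ℝ)
    (S : ℝ → EuclideanSpace ℝ (Fin N) → ℂ) : ℝ≥0∞ :=
  ∫⁻ ξ, ENNReal.ofReal
    (h ξ * (timePairing H fun t s => S t ξ * (starRingEnd ℂ) (S s ξ)).re)

/-- Spatial Fourier transform `ℱφ(t, ·)(ξ)` of a test function. -/
def testFourier {N : ℕ} (φ : Test N) (t : ℝ) (ξ : EuclideanSpace ℝ (Fin N)) : ℂ :=
  spatialFourier (fun x => (φ (t, x) : ℂ)) ξ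

/-- Spatial Fourier transform of the fundamental solution of the wave equation in dimension `N`:
`ℱG(t, ·)(ξ) = sin(t|ξ|) / |ξ|`. -/
def waveKernelFourier {N : ℕ} (t : ℝ) (ξ : EuclideanSpace ℝ (Fin N)) : ℝ :=
  Real.sin (t * ‖ξ‖) / ‖ξ‖

/-- Spatial Fourier transform at time `s` of `g_{t,x}(s, y) = G(t - s, x - y) 1_{[0,t]}(s)`. -/
def greenFourier {N : ℕ} (t : ℝ) (x : EuclideanSpace ℝ (Fin N)) (s : ℝ)
    (ξ : EuclideanSpace ℝ (Fin N)) : ℂ :=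
  (Set.Icc 0 t).indicator (fun s => Complex.exp (-Complex.I * ((inner ℝ x ξ : ℝ) : ℂ)) *
    (waveKernelFourier (t - s) ξ : ℂ)) s

/-- `X = W(S)`, the Wiener integral of `S` (given by its spatial Fourier transforms) against the
scalar noise `W`: the image of `S` under the isometric extension of `φ ↦ W(φ)` to the completion of
the test functions, that is, the `L²(P)` limit of `W(φ_n)` for test functions `φ_n → S`. -/
def IsWienerIntegral {N : ℕ} {Ω : Type*} [MeasurableSpace Ω] (P : Measure Ω) (H : ℝ)
    (h : EuclideanSpace ℝ (Fin N) → ℝ) (W : Test N → Ω → ℝ)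
    (S : ℝ → EuclideanSpace ℝ (Fin N) → ℂ) (X : Ω → ℝ) : Prop :=
  ∃ φ : ℕ → Test N,
    Tendsto (fun n => spectralNormSq H h fun s ξ => testFourier (φ n) s ξ - S s ξ) atTop (𝓝 0) ∧
    Tendsto (fun n => eLpNorm (fun ω => W (φ n) ω - X ω) 2 P) atTop (𝓝 0)

/-- `u` is (a jointly measurable version of) the random field solution `u_j(t, x) = W_j(g_{t,x})`,
`t ≥ 0`, of the stochastic wave equation `∂_t² u_j = Δ u_j + Ẇ_j` with zero initial data. -/
structure IsWaveSolution {N d : ℕ} {Ω : Type*} [MeasurableSpace Ω] (P : Measure Ω) (H : ℝ)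
    (h : EuclideanSpace ℝ (Fin N) → ℝ) (W : Fin d → Test N → Ω → ℝ)
    (u : ℝ → EuclideanSpace ℝ (Fin N) → Ω → EuclideanSpace ℝ (Fin d)) : Prop where
  measurable : Measurable
    fun p : (ℝ × EuclideanSpace ℝ (Fin N)) × Ω => u p.1.1 p.1.2 p.2
  mild : ∀ t, 0 ≤ t → ∀ x j,
    IsWienerIntegral P H h (W j) (greenFourier t x) (fun ω => u t x ω j)

/-- `L` is a version of the local time of the random field `X` on each member of the family
`Q_z`, `z ∈ T`: almost surely, for all `z ∈ T`, `L(·, z)` is a density with respect to Lebesgue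
measure of the occupation measure `B ↦ λ{w ∈ Q_z : X(w) ∈ B}`. -/
structure IsLocalTime {Z Ω V : Type*} [MeasureSpace Z] [MeasurableSpace Ω] [MeasureSpace V]
    (P : Measure Ω) (X : Z → Ω → V) (T : Set Z) (Q : Z → Set Z) (L : V → Z → Ω → ℝ≥0) : Prop where
  measurable : ∀ z ∈ T, Measurable fun p : V × Ω => L p.1 z p.2
  density : ∀ᵐ ω ∂P, ∀ z ∈ T, ∀ B : Set V, MeasurableSet B →
    volume {w | w ∈ Q z ∧ X w ω ∈ B} = ∫⁻ v in B, (L v z ω : ℝ≥0∞)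

/-- `X` has a jointly continuous local time on the compact interval `T = [a, b]`: there is a version
`L(v, Q_z)` of the local time on the intervals `Q_z = (-∞, z] ∩ T` such that, almost surely,
`(v, z) ↦ L(v, Q_z)` is continuous on `ℝ^d × T`. The order on `Z` is the coordinatewise one. -/
def HasJointlyContinuousLocalTime {Z Ω V : Type*} [MeasureSpace Z] [TopologicalSpace Z] [Preorder Z]
    [MeasurableSpace Ω] [MeasureSpace V] [TopologicalSpace V]
    (P : Measure Ω) (X : Z → Ω → V) (a b : Z) : Prop :=
  ∃ L : V → Z → Ω → ℝ≥0,
    IsLocalTime P X (Set.Icc a b) (fun z => Set.Iic z ∩ Set.Icc a b) L ∧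
    ∀ᵐ ω ∂P, ContinuousOn (fun p : V × Z => L p.1 p.2 ω) (Set.univ ×ˢ Set.Icc a b)

/-- The index `α = (2H + 1 - N + β) / 2`. -/
def holderIndex (N : ℕ) (H β : ℝ) : ℝ := (2 * H + 1 - N + β) / 2

end

end StochasticWave

open scoped FourierTransform

namespace StochasticWave

noncomputable section

/-- Exchanging the two indices of a finite array preserves Lebesgue measure. -/
theorem measurePreserving_swap (ι κ : Type*) [Fintype ι] [Fintype κ] :
    MeasurePreserving (fun (y : ι → κ → ℝ) (k : κ) (i : ι) => y i k) volume volume := by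
  have hm : Measurable (fun (y : ι → κ → ℝ) (k : κ) (i : ι) => y i k) := by fun_prop
  refine ⟨hm, ?_⟩
  symm
  have hspan : ∀ _ : κ, (volume : Measure (ι → ℝ)).FiniteSpanningSetsIn
      (Set.pi Set.univ '' Set.pi Set.univ fun _ : ι => {s : Set ℝ | MeasurableSet s}) := fun _ =>
    { set := fun n => Set.pi Set.univ fun _ => Set.Icc (-(n : ℝ)) n
      set_mem := fun n => ⟨fun _ => Set.Icc (-(n : ℝ)) n, by simp, rfl⟩
      finite := fun n => by
        rw [volume_pi_pi]
        exact ENNReal.prod_lt_top fun i _ => by simp [Real.volume_Icc]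
      spanning := by
        refine Set.eq_univ_of_forall fun x => ?_
        obtain ⟨n, hn⟩ := exists_nat_ge (∑ i, |x i|)
        refine Set.mem_iUnion.2 ⟨n, fun i _ => ?_⟩
        have h1 : |x i| ≤ ∑ i, |x i| :=
          Finset.single_le_sum (f := fun i => |x i|) (fun i _ => abs_nonneg _) (Finset.mem_univ i)
        exact abs_le.1 (h1.trans hn) }
  refine Measure.pi_eq_generateFrom (fun _ => generateFrom_pi) (fun _ => isPiSystem_pi) hspan ?_
  intro s hs
  choose t ht hst using hs
  have hs' : s = fun k => Set.pi Set.univ (t k) := funext fun k => (hst k).symm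
  subst hs'
  rw [Measure.map_apply hm]
  · have : (fun (y : ι → κ → ℝ) (k : κ) (i : ι) => y i k) ⁻¹'
        (Set.univ.pi fun k => Set.univ.pi (t k)) =
        Set.univ.pi fun i => Set.univ.pi fun k => t k i := by
      ext y
      simp only [Set.mem_preimage, Set.mem_pi, Set.mem_univ, true_implies]
      exact forall_comm
    rw [this, volume_pi_pi]
    simp_rw [volume_pi_pi]
    exact Finset.prod_comm
  · exact MeasurableSet.univ_pi fun k => MeasurableSet.univ_pi fun i => ht k i (Set.mem_univ _)

/-- Tonelli for a product of functions of the single coordinates. -/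
theorem lintegral_fin_prod_eq_prod {E : Type*} [MeasureSpace E] [SigmaFinite (volume : Measure E)]
    {n : ℕ} {f : Fin n → E → ℝ≥0∞} (hf : ∀ k, Measurable (f k)) :
    ∫⁻ x : Fin n → E, ∏ k, f k (x k) = ∏ k, ∫⁻ y, f k y := by
  induction n with
  | zero => simp [volume_pi]
  | succ n ih =>
    have hmp := volume_preserving_piFinSuccAbove (fun _ : Fin (n + 1) => E) 0
    have hm : Measurable fun x : Fin (n + 1) → E => ∏ k, f k (x k) := by fun_prop
    rw [← (hmp.symm _).lintegral_comp hm, Measure.volume_eq_prod]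
    simp only [MeasurableEquiv.piFinSuccAbove_symm_apply, Fin.prod_univ_succ,
      Fin.insertNthEquiv_zero, Fin.consEquiv_apply, Fin.cons_zero, Fin.cons_succ]
    rw [lintegral_prod_mul (hf 0).aemeasurable (g := fun y : Fin n → E => ∏ k, f k.succ (y k))
      (Measurable.aemeasurable (by fun_prop)), ih fun k => hf _]

/-- Tonelli for a product over one index of an array. -/
theorem lintegral_swap_prod {ι : Type*} [Fintype ι] {n : ℕ}
    {f : Fin n → (ι → ℝ) → ℝ≥0∞} (hf : ∀ k, Measurable (f k)) :
    ∫⁻ y : ι → Fin n → ℝ, ∏ k, f k (fun i => y i k) = ∏ k, ∫⁻ c, f k c := by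
  rw [(measurePreserving_swap ι (Fin n)).lintegral_comp
    (f := fun x : Fin n → ι → ℝ => ∏ k, f k (x k)) (by fun_prop), lintegral_fin_prod_eq_prod hf]

/-- If each vector `e j` is at distance at least `D j` from the span of the preceding ones, then
`∫ exp (-‖∑ c j e j‖²) dc ≤ ∏ √π / D j`. -/
theorem lintegral_exp_neg_norm_sum_sq_le {E : Type*} [NormedAddCommGroup E] [InnerProductSpace ℝ E]
    (n : ℕ) (e : Fin n → E) (D : Fin n → ℝ) (hD : ∀ j, 0 < D j)
    (he : ∀ (j : Fin n) (c : Fin n → ℝ), (∀ i, j < i → c i = 0) →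
      |c j| * D j ≤ ‖∑ i, c i • e i‖) :
    ∫⁻ c : Fin n → ℝ, ENNReal.ofReal (Real.exp (-‖∑ i, c i • e i‖ ^ 2)) ≤
      ∏ j, ENNReal.ofReal (√Real.pi / D j) := by
  induction n with
  | zero => simp [volume_pi]
  | succ n ih =>
    have ih' := ih (fun i => e i.castSucc) (fun i => D i.castSucc) (fun i => hD _) (by
      intro j c hc
      have := he j.castSucc (Fin.snoc c 0) (by
        intro i
        refine Fin.lastCases ?_ (fun i => ?_) i
        · simp
        · intro hi; simpa using hc i (by simpa using hi))
      simpa [Fin.sum_univ_castSucc] using this)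
    set f0 := ∫⁻ c : Fin n → ℝ, ENNReal.ofReal (Real.exp (-‖∑ i, c i • e i.castSucc‖ ^ 2)) with hf0
    have key : ∀ x : ℝ, ∫⁻ c : Fin n → ℝ, ENNReal.ofReal
        (Real.exp (-‖∑ i, c i • e i.castSucc + x • e (Fin.last n)‖ ^ 2)) ≤
        ENNReal.ofReal (Real.exp (-(D (Fin.last n)) ^ 2 * x ^ 2)) * f0 := by
      intro x
      set S := Submodule.span ℝ (Set.range fun i : Fin n => e i.castSucc) with hS
      have : FiniteDimensional ℝ S := FiniteDimensional.span_of_finite ℝ (Set.finite_range _)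
      obtain ⟨b, hb⟩ : ∃ b : Fin n → ℝ, ∑ i, b i • e i.castSucc =
          (S.orthogonalProjectionOnto (x • e (Fin.last n)) : E) := by
        have h1 : (S.orthogonalProjectionOnto (x • e (Fin.last n)) : E) ∈ S := Subtype.coe_prop _
        exact (Submodule.mem_span_range_iff_exists_fun ℝ).1 h1
      set v := x • e (Fin.last n) - ∑ i, b i • e i.castSucc with hv
      have hvS : ∀ c : Fin n → ℝ, inner ℝ (∑ i, c i • e i.castSucc) v = 0 := by
        intro c
        have h1 : ∑ i, c i • e i.castSucc ∈ S :=
          (Submodule.mem_span_range_iff_exists_fun ℝ).2 ⟨c, rfl⟩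
        rw [hv, hb]
        exact S.sub_starProjection_mem_orthogonal (x • e (Fin.last n)) _ h1
      have hvD : |x| * D (Fin.last n) ≤ ‖v‖ := by
        have := he (Fin.last n) (Fin.snoc (-b) x) (by
          intro i hi; exact absurd (Fin.le_last i) (not_le.2 hi))
        simp only [Fin.snoc_last, Fin.sum_univ_castSucc, Fin.snoc_castSucc] at this
        convert this using 2
        rw [hv]; simp [Finset.sum_neg_distrib]; abel
      have htr := lintegral_add_right_eq_self (μ := (volume : Measure (Fin n → ℝ)))
        (fun c : Fin n → ℝ => ENNReal.ofReal
        (Real.exp (-‖∑ i, c i • e i.castSucc + v‖ ^ 2))) b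
      have h2 : ∀ c : Fin n → ℝ, ∑ i, (c + b) i • e i.castSucc + v =
          ∑ i, c i • e i.castSucc + x • e (Fin.last n) := by
        intro c; simp only [Pi.add_apply, add_smul, Finset.sum_add_distrib, hv]; abel
      simp only [h2] at htr
      rw [htr, hf0, ← lintegral_const_mul _ (Measurable.ennreal_ofReal (Continuous.measurable (by fun_prop)))]
      refine lintegral_mono fun c => ?_
      rw [← ENNReal.ofReal_mul (Real.exp_nonneg _), ← Real.exp_add]
      refine ENNReal.ofReal_le_ofReal (Real.exp_le_exp.2 ?_)
      have h3 := norm_add_sq_real (∑ i, c i • e i.castSucc) v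
      rw [hvS c] at h3
      have h4 : (|x| * D (Fin.last n)) ^ 2 ≤ ‖v‖ ^ 2 := by
        have := hD (Fin.last n); gcongr
      rw [mul_pow, sq_abs] at h4
      nlinarith
    have hmp := volume_preserving_piFinSuccAbove (fun _ : Fin (n + 1) => ℝ) (Fin.last n)
    have hmeas : Measurable fun c : Fin (n + 1) → ℝ =>
        ENNReal.ofReal (Real.exp (-‖∑ i, c i • e i‖ ^ 2)) :=
      ENNReal.measurable_ofReal.comp (Continuous.measurable (by fun_prop))
    rw [← (hmp.symm _).lintegral_comp hmeas, Measure.volume_eq_prod,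
      lintegral_prod (fun a : ℝ × (Fin n → ℝ) => ENNReal.ofReal (Real.exp (-‖∑ i,
        (MeasurableEquiv.piFinSuccAbove (fun _ => ℝ) (Fin.last n)).symm a i • e i‖ ^ 2)))
        (hmeas.comp (MeasurableEquiv.measurable _)).aemeasurable, Fin.prod_univ_castSucc, mul_comm]
    calc _ ≤ ∫⁻ x : ℝ, ENNReal.ofReal (Real.exp (-(D (Fin.last n)) ^ 2 * x ^ 2)) * f0 := by
          refine lintegral_mono fun x => le_trans (le_of_eq ?_) (key x)
          refine lintegral_congr fun c => ?_
          simp [MeasurableEquiv.piFinSuccAbove, Fin.sum_univ_castSucc, Fin.insertNthEquiv]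
      _ = ENNReal.ofReal (√Real.pi / D (Fin.last n)) * f0 := by
          rw [lintegral_mul_const _ (by fun_prop)]
          congr 1
          have hpos : 0 < D (Fin.last n) ^ 2 := by have := hD (Fin.last n); positivity
          rw [← ofReal_integral_eq_lintegral_ofReal (integrable_exp_neg_mul_sq hpos)
            (ae_of_all _ fun x => Real.exp_nonneg _), integral_gaussian, Real.sqrt_div
            Real.pi_pos.le, Real.sqrt_sq (hD _).le]
      _ ≤ _ := by gcongr

/-- Cauchy–Schwarz for the lower Lebesgue integral. -/
theorem sq_lintegral_mul_le {X : Type*} [MeasurableSpace X] {μ : Measure X} {f g : X → ℝ≥0∞}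
    (hf : AEMeasurable f μ) (hg : AEMeasurable g μ) :
    (∫⁻ x, f x * g x ∂μ) ^ 2 ≤ (∫⁻ x, f x ^ 2 ∂μ) * ∫⁻ x, g x ^ 2 ∂μ := by
  have h := ENNReal.lintegral_mul_le_Lp_mul_Lq μ Real.HolderConjugate.two_two hf hg
  simp only [Pi.mul_apply, ENNReal.rpow_two] at h
  calc _ ≤ ((∫⁻ x, f x ^ 2 ∂μ) ^ (1 / 2 : ℝ) * (∫⁻ x, g x ^ 2 ∂μ) ^ (1 / 2 : ℝ)) ^ 2 := by gcongr
    _ = _ := by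
      rw [mul_pow, ← ENNReal.rpow_two, ← ENNReal.rpow_two, ← ENNReal.rpow_mul, ← ENNReal.rpow_mul]
      norm_num

theorem integrableOn_rpow_mul_one_add_rpow {A B : ℝ} (hA : -1 < A) (hAB : A + 1 < B) :
    IntegrableOn (fun ρ : ℝ => ρ ^ A * (1 + ρ) ^ (-B)) (Set.Ioi 0) := by
  have hm : Measurable fun ρ : ℝ => ρ ^ A * (1 + ρ) ^ (-B) := by fun_prop
  rw [← Set.Ioc_union_Ioi_eq_Ioi (zero_le_one' ℝ)]
  refine IntegrableOn.union ?_ ?_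
  · have h1 : IntegrableOn (fun ρ : ℝ => ρ ^ A) (Set.Ioc 0 1) :=
      (intervalIntegrable_iff_integrableOn_Ioc_of_le zero_le_one).1
        (intervalIntegral.intervalIntegrable_rpow' hA)
    refine Integrable.mono' h1 hm.aestronglyMeasurable ?_
    filter_upwards [ae_restrict_mem measurableSet_Ioc] with ρ hρ
    have h0 : (0 : ℝ) ≤ ρ ^ A := Real.rpow_nonneg hρ.1.le _
    rw [Real.norm_of_nonneg (mul_nonneg h0 (Real.rpow_nonneg (by linarith [hρ.1]) _))]
    refine mul_le_of_le_one_right h0 (Real.rpow_le_one_of_one_le_of_nonpos (by linarith [hρ.1]) ?_)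
    linarith
  · have h1 : IntegrableOn (fun ρ : ℝ => ρ ^ (A - B)) (Set.Ioi 1) :=
      integrableOn_Ioi_rpow_of_lt (by linarith) one_pos
    refine Integrable.mono' h1 hm.aestronglyMeasurable ?_
    filter_upwards [ae_restrict_mem measurableSet_Ioi] with ρ hρ
    have hρ0 : (0 : ℝ) < ρ := lt_trans one_pos hρ
    have h0 : (0 : ℝ) ≤ ρ ^ A := Real.rpow_nonneg hρ0.le _
    rw [Real.norm_of_nonneg (mul_nonneg h0 (Real.rpow_nonneg (by linarith) _)), sub_eq_add_neg,
      Real.rpow_add hρ0]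
    exact mul_le_mul_of_nonneg_left
      (Real.rpow_le_rpow_of_nonpos hρ0 (by linarith) (by linarith)) h0

/-- A band-unlimited test function: a rapidly decreasing `ψ`, vanishing at the origin, whose inverse
Fourier transform is `1` at the origin and vanishes outside `(-1, 1)`. -/
theorem exists_fourier_bump (k : ℕ) : ∃ (ψ η : ℝ → ℂ) (C : ℝ), Continuous ψ ∧ Integrable ψ ∧ 0 ≤ C ∧
    (∀ s, ‖ψ s‖ ≤ C * |s| * (1 + |s|) ^ (-(k : ℝ))) ∧
    (∀ x, ∫ s, Complex.exp (((2 * Real.pi * (s * x) : ℝ) : ℂ) * Complex.I) * ψ s = η x) ∧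
    η 0 = 1 ∧ ∀ x, 1 ≤ |x| → η x = 0 := by
  let b : ContDiffBump (0 : ℝ) := ⟨1 / 4, 1 / 2, by norm_num, by norm_num⟩
  let χ : ℝ → ℂ := fun x => ((x * b x : ℝ) : ℂ)
  have hχs : ContDiff ℝ (⊤ : ℕ∞) χ := Complex.ofRealCLM.contDiff.comp (contDiff_id.mul b.contDiff)
  have hχc : HasCompactSupport χ := by
    have : HasCompactSupport fun x => x * b x := b.hasCompactSupport.mul_left
    exact this.comp_left (g := fun x : ℝ => (x : ℂ)) (by simp)
  let χS : 𝓢(ℝ, ℂ) := hχc.toSchwartzMap hχs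
  have hηs : ContDiff ℝ (⊤ : ℕ∞) (deriv χ) := by
    have := (contDiff_infty_iff_deriv (f := χ)).1 hχs
    exact this.2
  let ηS : 𝓢(ℝ, ℂ) := hχc.deriv.toSchwartzMap hηs
  let ψS : 𝓢(ℝ, ℂ) := 𝓕 ηS
  have hψ : ∀ s, ψS s = (2 * Real.pi * Complex.I * s) • (𝓕 χS) s := by
    intro s
    have := Real.fourier_deriv (f := χ) χS.integrable (hχs.differentiable (by simp)) ηS.integrable
    exact congrFun this s
  obtain ⟨C, hC⟩ : ∃ C, ∀ s : ℝ, (1 + ‖s‖) ^ k * ‖(𝓕 χS) s‖ ≤ C := by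
    refine ⟨2 ^ k * (Finset.Iic (k, 0)).sup (fun m => SchwartzMap.seminorm ℝ m.1 m.2) (𝓕 χS),
      fun s => ?_⟩
    have := SchwartzMap.one_add_le_sup_seminorm_apply (𝕜 := ℝ) (m := (k, 0)) le_rfl le_rfl (𝓕 χS) s
    rw [norm_iteratedFDeriv_zero] at this
    exact this
  have hC0 : 0 ≤ C := le_trans (by positivity) (hC 0)
  refine ⟨ψS, ηS, 2 * Real.pi * C, ψS.continuous, ψS.integrable, by positivity, ?_, ?_, ?_, ?_⟩
  · intro s
    have h1 : ‖(𝓕 χS) s‖ ≤ C * (1 + |s|) ^ (-(k : ℝ)) := by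
      have h2 : (0 : ℝ) < (1 + |s|) ^ k := by positivity
      rw [Real.rpow_neg (by positivity), Real.rpow_natCast, ← div_eq_mul_inv, le_div_iff₀ h2, mul_comm]
      exact hC s
    rw [hψ, norm_smul]
    simp only [norm_mul, Complex.norm_ofNat, Complex.norm_I, Complex.norm_real, Real.norm_eq_abs,
      mul_one, abs_of_pos Real.pi_pos]
    calc _ ≤ 2 * Real.pi * |s| * (C * (1 + |s|) ^ (-(k : ℝ))) := by gcongr
      _ = _ := by ring
  · intro x
    have h1 : (𝓕⁻ (𝓕 ηS)) x = ηS x := by rw [FourierTransform.fourierInv_fourier_eq]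
    rw [← h1, SchwartzMap.fourierInv_coe, Real.fourierInv_eq']
    simp [ψS, mul_comm]
  · have h1 : χ =ᶠ[𝓝 0] fun x => (x : ℂ) := by
      filter_upwards [b.eventuallyEq_one] with x hx
      simp [χ, hx]
    change deriv χ 0 = 1
    rw [h1.deriv_eq]
    exact (Complex.ofRealCLM.hasDerivAt (x := 0)).deriv.trans (by simp)
  · intro x hx
    have h1 : χ =ᶠ[𝓝 x] fun _ => 0 := by
      have h2 : {y : ℝ | 1 / 2 < |y|} ∈ 𝓝 x :=
        (isOpen_lt continuous_const continuous_abs).mem_nhds (by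
          change (1 / 2 : ℝ) < |x|; linarith)
      filter_upwards [h2] with y hy
      have : b y = 0 := b.zero_of_le_dist (by simpa [b] using (le_of_lt hy))
      simp [χ, this]
    change deriv χ x = 0
    rw [h1.deriv_eq]; simp

/-- The measure `ρ^A (1 + ρ)^{-B} dρ` on the half-line. -/
def radialMeasure (A B : ℝ) : Measure ℝ :=
  (volume.restrict (Set.Ioi 0)).withDensity fun ρ => ENNReal.ofReal (ρ ^ A * (1 + ρ) ^ (-B))

theorem isFiniteMeasure_radialMeasure {A B : ℝ} (hA : -1 < A) (hAB : A + 1 < B) :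
    IsFiniteMeasure (radialMeasure A B) :=
  isFiniteMeasure_withDensity_ofReal (integrableOn_rpow_mul_one_add_rpow hA hAB).2

/-- The trigonometric sum `∑ c_j e^{i ρ p_j}`. -/
def trigSum {n : ℕ} (p c : Fin n → ℝ) (ρ : ℝ) : ℂ :=
  ∑ j, (c j : ℂ) * Complex.exp (((ρ * p j : ℝ) : ℂ) * Complex.I)

theorem continuous_trigSum {n : ℕ} :
    Continuous fun x : ((Fin n → ℝ) × (Fin n → ℝ)) × ℝ => trigSum x.1.1 x.1.2 x.2 := by
  unfold trigSum; fun_prop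

theorem norm_trigSum_le {n : ℕ} (p c : Fin n → ℝ) (ρ : ℝ) : ‖trigSum p c ρ‖ ≤ ∑ j, |c j| := by
  refine (norm_sum_le _ _).trans (Finset.sum_le_sum fun j _ => ?_)
  rw [norm_mul, Complex.norm_exp_ofReal_mul_I, mul_one, Complex.norm_real, Real.norm_eq_abs]

theorem norm_trigSum_neg {n : ℕ} (p c : Fin n → ℝ) (ρ : ℝ) :
    ‖trigSum p c (-ρ)‖ = ‖trigSum p c ρ‖ := by
  have : trigSum p c (-ρ) = (starRingEnd ℂ) (trigSum p c ρ) := by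
    simp [trigSum, map_sum, ← Complex.exp_conj]
  rw [this, RCLike.norm_conj]

/-- The quadratic form `∫ |∑ c_j e^{i ρ p_j}|² μ(dρ)`. -/
def trigForm {n : ℕ} (μ : Measure ℝ) (p c : Fin n → ℝ) : ℝ := ∫ ρ, ‖trigSum p c ρ‖ ^ 2 ∂μ

/-- Pairing a trigonometric sum with a dilated test function isolates one coefficient. -/
theorem integral_trigSum_mul_bump {n : ℕ} {ψ η : ℝ → ℂ} (hψi : Integrable ψ)
    (hη : ∀ x, ∫ s, Complex.exp (((2 * Real.pi * (s * x) : ℝ) : ℂ) * Complex.I) * ψ s = η x)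
    (hη0 : η 0 = 1) (hη1 : ∀ x, 1 ≤ |x| → η x = 0) (p c : Fin n → ℝ) (j : Fin n) {δ : ℝ}
    (hδ : 0 < δ) (hsep : ∀ i, i ≠ j → c i = 0 ∨ δ ≤ |p i - p j|) :
    ∫ ρ, trigSum p c ρ * (Complex.exp (((-ρ * p j : ℝ) : ℂ) * Complex.I) *
      ψ (δ / (2 * Real.pi) * ρ)) = ((c j * (2 * Real.pi / δ) : ℝ) : ℂ) := by
  set a := δ / (2 * Real.pi) with ha
  have ha0 : 0 < a := by positivity
  have hint : ∀ x : ℝ, Integrable fun ρ : ℝ =>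
      Complex.exp (((ρ * x : ℝ) : ℂ) * Complex.I) * ψ (a * ρ) := by
    intro x
    refine (hψi.comp_mul_left' ha0.ne').bdd_mul (c := 1) (Continuous.aestronglyMeasurable (by fun_prop)) ?_
    exact ae_of_all _ fun ρ => by rw [Complex.norm_exp_ofReal_mul_I]
  have hval : ∀ x : ℝ, ∫ ρ : ℝ, Complex.exp (((ρ * x : ℝ) : ℂ) * Complex.I) * ψ (a * ρ) =
      ((a⁻¹ : ℝ) : ℂ) * η (x / δ) := by
    intro x
    have h1 := Measure.integral_comp_mul_left (fun s : ℝ =>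
      Complex.exp (((2 * Real.pi * (s * (x / δ)) : ℝ) : ℂ) * Complex.I) * ψ s) a
    rw [hη, abs_of_pos (inv_pos.2 ha0)] at h1
    rw [Complex.real_smul] at h1
    rw [← h1]
    refine integral_congr_ae (ae_of_all _ fun ρ => ?_)
    simp only
    congr 4
    rw [ha]; field_simp
  have hsum : ∀ ρ : ℝ, trigSum p c ρ * (Complex.exp (((-ρ * p j : ℝ) : ℂ) * Complex.I) *
      ψ (a * ρ)) = ∑ i, (c i : ℂ) *
        (Complex.exp (((ρ * (p i - p j) : ℝ) : ℂ) * Complex.I) * ψ (a * ρ)) := by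
    intro ρ
    rw [trigSum, Finset.sum_mul]
    refine Finset.sum_congr rfl fun i _ => ?_
    have : Complex.exp (((ρ * (p i - p j) : ℝ) : ℂ) * Complex.I) =
        Complex.exp (((ρ * p i : ℝ) : ℂ) * Complex.I) *
        Complex.exp (((-ρ * p j : ℝ) : ℂ) * Complex.I) := by
      rw [← Complex.exp_add]; congr 1; push_cast; ring
    rw [this]; ring
  simp_rw [hsum]
  rw [integral_finsetSum _ fun i _ => (hint _).const_mul _]
  simp_rw [integral_const_mul, hval]
  rw [Finset.sum_eq_single j]
  · rw [sub_self, zero_div, hη0, mul_one, ← Complex.ofReal_mul]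
    congr 2
    rw [ha, inv_div]
  · intro i _ hij
    rcases hsep i hij with h | h
    · simp [h]
    · rw [hη1 _ (by rw [abs_div, abs_of_pos hδ, le_div_iff₀ hδ]; simpa using h)]; simp
  · simp

theorem integrable_norm_trigSum_sq {n : ℕ} (μ : Measure ℝ) [IsFiniteMeasure μ] (p c : Fin n → ℝ) :
    Integrable (fun ρ => ‖trigSum p c ρ‖ ^ 2) μ := by
  refine Integrable.of_bound (C := (∑ j, |c j|) ^ 2) (Continuous.aestronglyMeasurable ?_) ?_
  · unfold trigSum; fun_prop
  · refine ae_of_all _ fun ρ => ?_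
    rw [Real.norm_of_nonneg (by positivity)]
    exact pow_le_pow_left₀ (norm_nonneg _) (norm_trigSum_le p c ρ) 2

theorem ofReal_trigForm_radialMeasure {A B : ℝ} (hA : -1 < A) (hAB : A + 1 < B) {n : ℕ}
    (p c : Fin n → ℝ) : ENNReal.ofReal (trigForm (radialMeasure A B) p c) =
      ∫⁻ ρ in Set.Ioi 0, ENNReal.ofReal (ρ ^ A * (1 + ρ) ^ (-B) * ‖trigSum p c ρ‖ ^ 2) := by
  have := isFiniteMeasure_radialMeasure hA hAB
  have hc : Continuous (trigSum p c) := by unfold trigSum; fun_prop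
  rw [trigForm, ofReal_integral_eq_lintegral_ofReal (integrable_norm_trigSum_sq _ p c)
    (ae_of_all _ fun ρ => by positivity), radialMeasure,
    lintegral_withDensity_eq_lintegral_mul _ (by fun_prop)
    (Measurable.ennreal_ofReal (Continuous.measurable (by fun_prop)))]
  refine setLIntegral_congr_fun measurableSet_Ioi fun ρ hρ => ?_
  have hρ0 : (0 : ℝ) < ρ := hρ
  simp only [Pi.mul_apply]
  rw [← ENNReal.ofReal_mul (by positivity)]

theorem lintegral_even {F : ℝ → ℝ≥0∞} (hF : ∀ x, F (-x) = F x) :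
    ∫⁻ x, F x = 2 * ∫⁻ x in Set.Ioi 0, F x := by
  have h1 : ∫⁻ x in Set.Iio 0, F x = ∫⁻ x in Set.Ioi 0, F x := by
    have := (Measure.measurePreserving_neg (volume : Measure ℝ)).setLIntegral_comp_preimage_emb
      (MeasurableEquiv.neg ℝ).measurableEmbedding F (Set.Iio 0)
    rw [← this]
    simp [hF]
  rw [← lintegral_add_compl F measurableSet_Ioi (A := Set.Ioi (0 : ℝ)), Set.compl_Ioi,
    ← restrict_Iio_eq_restrict_Iic, h1, two_mul]

/-- Strong local nondeterminism in dimension one: the form `trigForm` controls the coefficient at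
any point that is `δ`-separated from the others. -/
theorem exists_trigForm_ge {A B : ℝ} (hA : -1 < A) (hA2 : A < 2) (hAB : A + 1 < B) :
    ∃ κ : ℝ, 0 < κ ∧ ∀ (n : ℕ) (p c : Fin n → ℝ) (j : Fin n) (δ : ℝ), 0 < δ → δ ≤ 1 →
      (∀ i, i ≠ j → c i = 0 ∨ δ ≤ |p i - p j|) →
      κ * c j ^ 2 * δ ^ (B - A - 1) ≤ trigForm (radialMeasure A B) p c := by
  obtain ⟨k, hk⟩ := exists_nat_gt ((3 - A + B) / 2)
  obtain ⟨ψ, η, C, hψc, hψi, hC0, hψ, hη, hη0, hη1⟩ := exists_fourier_bump k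
  have hTi := integrableOn_rpow_mul_one_add_rpow (A := 2 - A) (B := 2 * k - B) (by linarith)
    (by linarith)
  set G : ℝ → ℝ := fun s => s ^ (2 - A) * (1 + s) ^ (-(2 * k - B)) with hG
  set T := ∫ s in Set.Ioi 0, G s with hT
  have hG0 : ∀ s, 0 < s → 0 ≤ G s := fun s hs => by simp only [hG]; positivity
  have hT0 : 0 ≤ T := setIntegral_nonneg measurableSet_Ioi fun s hs => hG0 s hs
  have hπ : (0 : ℝ) < 2 * Real.pi := by positivity
  refine ⟨(2 * Real.pi) ^ (-(B - A - 1)) / (4 * C ^ 2 * T + 1), by positivity, ?_⟩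
  intro n p c j δ hδ hδ1 hsep
  set a := δ / (2 * Real.pi) with ha
  have ha0 : 0 < a := by positivity
  have ha1 : a ≤ 1 := by
    rw [ha, div_le_one hπ]; linarith [Real.pi_gt_three]
  have hgc : Continuous (trigSum p c) := by unfold trigSum; fun_prop
  set K : ℝ → ℝ := fun ρ => C * |a * ρ| * (1 + |a * ρ|) ^ (-(k : ℝ)) with hK
  have hK0 : ∀ ρ, 0 ≤ K ρ := fun ρ => by simp only [hK]; positivity
  have hKm : Measurable K := by simp only [hK]; fun_prop
  set Q := trigForm (radialMeasure A B) p c with hQ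
  have hQ0 : 0 ≤ Q := integral_nonneg fun ρ => by positivity
  set w : ℝ → ℝ := fun ρ => ρ ^ A * (1 + ρ) ^ (-B) with hw
  have hwm : Measurable w := by simp only [hw]; fun_prop
  have hw0 : ∀ ρ, 0 < ρ → 0 < w ρ := fun ρ hρ => by simp only [hw]; positivity
  have h1 : ENNReal.ofReal (|c j| / a) ≤
      2 * ∫⁻ ρ in Set.Ioi 0, ENNReal.ofReal (‖trigSum p c ρ‖ * √(w ρ)) *
        ENNReal.ofReal (K ρ / √(w ρ)) := by
    have h2 := integral_trigSum_mul_bump hψi hη hη0 hη1 p c j hδ hsep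
    have h3 : ENNReal.ofReal (|c j| / a) = ‖((c j * (2 * Real.pi / δ) : ℝ) : ℂ)‖ₑ := by
      rw [← ofReal_norm, Complex.norm_real, Real.norm_eq_abs, abs_mul,
        abs_of_pos (a := 2 * Real.pi / δ) (by positivity), ha]
      congr 1; field_simp
    rw [h3, ← h2]
    refine (enorm_integral_le_lintegral_enorm _).trans ?_
    have h4 : ∀ ρ, ‖trigSum p c ρ * (Complex.exp (((-ρ * p j : ℝ) : ℂ) * Complex.I) *
        ψ (a * ρ))‖ₑ ≤ ENNReal.ofReal (‖trigSum p c ρ‖ * K ρ) := by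
      intro ρ
      rw [← ofReal_norm, norm_mul, norm_mul, Complex.norm_exp_ofReal_mul_I, one_mul]
      exact ENNReal.ofReal_le_ofReal (mul_le_mul_of_nonneg_left (hψ _) (norm_nonneg _))
    refine (lintegral_mono h4).trans ?_
    rw [lintegral_even (fun x => by simp only [norm_trigSum_neg, hK, mul_neg, abs_neg])]
    gcongr 2 * ?_
    refine le_of_eq (setLIntegral_congr_fun measurableSet_Ioi fun ρ hρ => ?_)
    have := Real.sqrt_pos.2 (hw0 ρ hρ)
    rw [← ENNReal.ofReal_mul (by positivity)]
    congr 1; field_simp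
  have hcs := sq_lintegral_mul_le (μ := volume.restrict (Set.Ioi (0 : ℝ)))
    (f := fun ρ => ENNReal.ofReal (‖trigSum p c ρ‖ * √(w ρ)))
    (g := fun ρ => ENNReal.ofReal (K ρ / √(w ρ)))
    (Measurable.aemeasurable (by fun_prop)) (Measurable.aemeasurable (by fun_prop))
  have h5 : ∫⁻ ρ in Set.Ioi 0, ENNReal.ofReal (‖trigSum p c ρ‖ * √(w ρ)) ^ 2 =
      ENNReal.ofReal Q := by
    rw [hQ, ofReal_trigForm_radialMeasure hA hAB]
    refine setLIntegral_congr_fun measurableSet_Ioi fun ρ hρ => ?_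
    rw [← ENNReal.ofReal_pow (by positivity), mul_pow, Real.sq_sqrt (hw0 ρ hρ).le, mul_comm]
  have h6 : ∫⁻ ρ in Set.Ioi 0, ENNReal.ofReal (K ρ / √(w ρ)) ^ 2 ≤
      ENNReal.ofReal (C ^ 2 * a ^ (A - B) * (a⁻¹ * T)) := by
    have hi : IntegrableOn (fun ρ => G (a * ρ)) (Set.Ioi 0) := by
      have := (integrableOn_Ioi_comp_mul_left_iff G 0 ha0).2 (by simpa using hTi)
      simpa using this
    have h7 : a⁻¹ * T = ∫ ρ in Set.Ioi 0, G (a * ρ) := by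
      rw [integral_comp_mul_left_Ioi _ _ ha0, mul_zero, smul_eq_mul]
    rw [h7, ← integral_const_mul, ofReal_integral_eq_lintegral_ofReal (hi.const_mul _)
      ((ae_restrict_iff' measurableSet_Ioi).2 (ae_of_all _ fun ρ hρ => by
        have hρ0 : (0 : ℝ) < ρ := hρ
        have := hG0 (a * ρ) (by positivity)
        positivity))]
    refine setLIntegral_mono' measurableSet_Ioi fun ρ hρ => ?_
    have hρ0 : (0 : ℝ) < ρ := hρ
    have hs : 0 < a * ρ := by positivity
    rw [← ENNReal.ofReal_pow (div_nonneg (hK0 ρ) (Real.sqrt_nonneg _)), div_pow,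
      Real.sq_sqrt (hw0 ρ hρ0).le]
    refine ENNReal.ofReal_le_ofReal ?_
    rw [div_le_iff₀ (hw0 ρ hρ0)]
    simp only [hK, hG, hw, abs_of_pos hs]
    have e1 : ρ ^ A = (a * ρ) ^ A * a ^ (-A) := by
      rw [Real.mul_rpow ha0.le hρ0.le, mul_comm, ← mul_assoc, ← Real.rpow_add ha0]; simp
    have e2 : a ^ B * (1 + a * ρ) ^ (-B) ≤ (1 + ρ) ^ (-B) := by
      have hB : 0 ≤ B := by linarith
      rw [Real.rpow_neg (by positivity), Real.rpow_neg (by positivity), ← div_eq_mul_inv,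
        ← Real.div_rpow ha0.le (by positivity), ← Real.inv_rpow (by positivity)]
      refine Real.rpow_le_rpow (by positivity) ?_ hB
      rw [div_le_iff₀ (by positivity), inv_mul_eq_div, le_div_iff₀ (by positivity)]
      nlinarith
    have e3 : (a * ρ) ^ (2 - A) * (a * ρ) ^ A = (a * ρ) ^ 2 := by
      rw [← Real.rpow_add hs]; simp
    have e4 : (1 + a * ρ) ^ (-(2 * (k : ℝ) - B)) * (1 + a * ρ) ^ (-B) =
        ((1 + a * ρ) ^ (-(k : ℝ))) ^ 2 := by
      rw [← Real.rpow_add (by positivity), ← Real.rpow_mul_natCast (by positivity)]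
      congr 1; push_cast; ring
    have e5 : a ^ (A - B) * a ^ (-A) * a ^ B = 1 := by
      rw [← Real.rpow_add ha0, ← Real.rpow_add ha0, show A - B + -A + B = 0 by ring, Real.rpow_zero]
    rw [e1]
    calc (C * (a * ρ) * (1 + a * ρ) ^ (-(k : ℝ))) ^ 2
        = C ^ 2 * (a * ρ) ^ 2 * ((1 + a * ρ) ^ (-(k : ℝ))) ^ 2 *
            (a ^ (A - B) * a ^ (-A) * a ^ B) := by rw [e5]; ring
      _ = C ^ 2 * a ^ (A - B) * ((a * ρ) ^ (2 - A) * (1 + a * ρ) ^ (-(2 * (k : ℝ) - B))) *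
            ((a * ρ) ^ A * a ^ (-A) * (a ^ B * (1 + a * ρ) ^ (-B))) := by
          rw [← e3, ← e4]; ring
      _ ≤ _ := by gcongr
  have h8 : ENNReal.ofReal (|c j| / a) ^ 2 ≤
      ENNReal.ofReal (4 * (Q * (C ^ 2 * a ^ (A - B) * (a⁻¹ * T)))) := by
    calc _ ≤ (2 * ∫⁻ ρ in Set.Ioi 0, ENNReal.ofReal (‖trigSum p c ρ‖ * √(w ρ)) *
        ENNReal.ofReal (K ρ / √(w ρ))) ^ 2 := by gcongr
      _ = 4 * (∫⁻ ρ in Set.Ioi 0, ENNReal.ofReal (‖trigSum p c ρ‖ * √(w ρ)) *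
        ENNReal.ofReal (K ρ / √(w ρ))) ^ 2 := by rw [mul_pow]; norm_num
      _ ≤ 4 * (ENNReal.ofReal Q * ENNReal.ofReal (C ^ 2 * a ^ (A - B) * (a⁻¹ * T))) := by
        gcongr
        exact hcs.trans (by rw [h5]; gcongr)
      _ = _ := by
        rw [← ENNReal.ofReal_mul hQ0, ENNReal.ofReal_mul (by norm_num : (0 : ℝ) ≤ 4)]
        norm_num
  rw [← ENNReal.ofReal_pow (by positivity), ENNReal.ofReal_le_ofReal_iff (by positivity), div_pow,
    sq_abs, div_le_iff₀ (by positivity)] at h8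
  have h9 : c j ^ 2 ≤ 4 * C ^ 2 * T * Q * a ^ (-(B - A - 1)) := by
    refine h8.trans (le_of_eq ?_)
    have : a ^ (-(B - A - 1)) = a ^ (A - B) * a⁻¹ * a ^ 2 := by
      rw [show -(B - A - 1) = (A - B) + 1 by ring, Real.rpow_add ha0, Real.rpow_one]
      field_simp
    rw [this]; ring
  have h10 : δ ^ (B - A - 1) = a ^ (B - A - 1) * (2 * Real.pi) ^ (B - A - 1) := by
    rw [← Real.mul_rpow ha0.le hπ.le, ha]; congr 1; field_simp
  have h11 : a ^ (-(B - A - 1)) * a ^ (B - A - 1) = 1 := by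
    rw [← Real.rpow_add ha0]; simp
  have h12 : (2 * Real.pi) ^ (-(B - A - 1)) * (2 * Real.pi) ^ (B - A - 1) = 1 := by
    rw [← Real.rpow_add hπ]; simp
  rw [div_mul_eq_mul_div, div_mul_eq_mul_div, div_le_iff₀ (by positivity), h10]
  calc _ = c j ^ 2 * a ^ (B - A - 1) *
        ((2 * Real.pi) ^ (-(B - A - 1)) * (2 * Real.pi) ^ (B - A - 1)) := by ring
    _ ≤ 4 * C ^ 2 * T * Q * a ^ (-(B - A - 1)) * a ^ (B - A - 1) * 1 := by rw [h12]; gcongr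
    _ = 4 * C ^ 2 * T * Q := by rw [mul_assoc (4 * C ^ 2 * T * Q), h11]; ring
    _ ≤ _ := by nlinarith

theorem measurable_trigForm {n : ℕ} (μ : Measure ℝ) [IsFiniteMeasure μ] :
    Measurable fun x : (Fin n → ℝ) × (Fin n → ℝ) => trigForm μ x.1 x.2 := by
  have h : StronglyMeasurable fun x : ((Fin n → ℝ) × (Fin n → ℝ)) × ℝ =>
      ‖trigSum x.1.1 x.1.2 x.2‖ ^ 2 :=
    (continuous_trigSum.norm.pow 2).stronglyMeasurable
  exact h.integral_prod_right.measurable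

theorem measurable_trigForm_right {n : ℕ} (μ : Measure ℝ) [IsFiniteMeasure μ] (p : Fin n → ℝ) :
    Measurable (trigForm μ p) := by
  have h := (measurable_trigForm (n := n) μ).comp (measurable_prodMk_left (x := p))
  simpa only [Function.comp_def] using h

theorem trigForm_nonneg {n : ℕ} (μ : Measure ℝ) (p c : Fin n → ℝ) : 0 ≤ trigForm μ p c :=
  integral_nonneg fun _ => by positivity

theorem trigForm_comp_perm {n : ℕ} (μ : Measure ℝ) (p c : Fin n → ℝ) (σ : Equiv.Perm (Fin n)) :
    trigForm μ (p ∘ σ) (c ∘ σ) = trigForm μ p c := by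
  unfold trigForm trigSum
  simp only [Function.comp_apply]
  congr 1; ext ρ
  rw [Equiv.sum_comp σ fun j => (c j : ℂ) * Complex.exp (((ρ * p j : ℝ) : ℂ) * Complex.I)]

/-- `trigForm` is the squared norm of a linear combination of fixed vectors of a Hilbert space. -/
theorem exists_norm_sum_sq_eq_trigForm {n : ℕ} (μ : Measure ℝ) [IsFiniteMeasure μ]
    (p : Fin n → ℝ) :
    ∃ e : Fin n → Lp ℂ 2 μ, ∀ c : Fin n → ℝ, ‖∑ j, c j • e j‖ ^ 2 = trigForm μ p c := by
  have hmem : ∀ j, MemLp (fun ρ : ℝ => Complex.exp (((ρ * p j : ℝ) : ℂ) * Complex.I)) 2 μ := by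
    intro j
    refine MemLp.of_bound (Continuous.aestronglyMeasurable (by fun_prop)) 1
      (ae_of_all _ fun ρ => ?_)
    rw [Complex.norm_exp_ofReal_mul_I]
  refine ⟨fun j => (hmem j).toLp _, fun c => ?_⟩
  have hs : ((∑ j, c j • (hmem j).toLp _ : Lp ℂ 2 μ) : ℝ → ℂ) =ᵐ[μ] trigSum p c := by
    have h1 : ∀ᵐ ρ ∂μ, ∀ j : Fin n, ((c j • (hmem j).toLp _ : Lp ℂ 2 μ) : ℝ → ℂ) ρ =
        (c j : ℂ) * Complex.exp (((ρ * p j : ℝ) : ℂ) * Complex.I) := by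
      rw [ae_all_iff]
      intro j
      filter_upwards [Lp.coeFn_smul (c j) ((hmem j).toLp _), (hmem j).coeFn_toLp] with ρ h2 h3
      rw [h2, Pi.smul_apply, h3, Complex.real_smul]
    filter_upwards [h1, Lp.coeFn_finsetSum Finset.univ (fun j => c j • (hmem j).toLp _)]
      with ρ h2 h3
    rw [h3, Finset.sum_apply]
    exact Finset.sum_congr rfl fun j _ => h2 j
  rw [← inner_self_eq_norm_sq (𝕜 := ℂ), L2.inner_def, trigForm]
  have : (fun ρ => inner ℂ ((∑ j, c j • (hmem j).toLp _ : Lp ℂ 2 μ) ρ)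
      ((∑ j, c j • (hmem j).toLp _ : Lp ℂ 2 μ) ρ)) =ᵐ[μ]
      fun ρ => ((‖trigSum p c ρ‖ ^ 2 : ℝ) : ℂ) := by
    filter_upwards [hs] with ρ hρ
    rw [hρ, inner_self_eq_norm_sq_to_K]; norm_cast
  rw [integral_congr_ae this, integral_complex_ofReal]
  exact Complex.ofReal_re _

/-- The moment integral `∫ ∏ (1 + |c_j|)^γ exp (-l Q(p; c)) dc`. -/
def gaussMoment {n : ℕ} (μ : Measure ℝ) (γ l : ℝ) (p : Fin n → ℝ) : ℝ≥0∞ :=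
  ∫⁻ c : Fin n → ℝ, (∏ j, ENNReal.ofReal ((1 + |c j|) ^ γ)) *
    ENNReal.ofReal (Real.exp (-(l * trigForm μ p c)))

theorem measurable_gaussMoment {n : ℕ} (μ : Measure ℝ) [IsFiniteMeasure μ] (γ l : ℝ) :
    Measurable fun p : Fin n → ℝ => gaussMoment μ γ l p := by
  unfold gaussMoment
  refine Measurable.lintegral_prod_right' (f := fun x : (Fin n → ℝ) × (Fin n → ℝ) =>
    (∏ j, ENNReal.ofReal ((1 + |x.2 j|) ^ γ)) *
      ENNReal.ofReal (Real.exp (-(l * trigForm μ x.1 x.2)))) ?_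
  have := measurable_trigForm (n := n) μ
  fun_prop

theorem gaussMoment_comp_perm {n : ℕ} (μ : Measure ℝ) [IsFiniteMeasure μ] (γ l : ℝ)
    (p : Fin n → ℝ) (σ : Equiv.Perm (Fin n)) :
    gaussMoment μ γ l (p ∘ σ) = gaussMoment μ γ l p := by
  have hmp := volume_measurePreserving_piCongrLeft (fun _ : Fin n => ℝ) σ.symm
  have hm : Measurable fun c : Fin n → ℝ => (∏ j, ENNReal.ofReal ((1 + |c j|) ^ γ)) *
      ENNReal.ofReal (Real.exp (-(l * trigForm μ (p ∘ σ) c))) := by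
    have := measurable_trigForm_right μ (p ∘ σ)
    fun_prop
  unfold gaussMoment
  rw [← hmp.lintegral_comp hm]
  refine lintegral_congr fun c => ?_
  have : (MeasurableEquiv.piCongrLeft (fun _ : Fin n => ℝ) σ.symm) c = c ∘ σ := by
    ext i
    have := MeasurableEquiv.piCongrLeft_apply_apply (β := fun _ : Fin n => ℝ) σ.symm c (σ i)
    simpa using this
  rw [this, trigForm_comp_perm]
  congr 1
  exact Equiv.prod_comp σ fun j => ENNReal.ofReal ((1 + |c j|) ^ γ)

theorem exists_pow_mul_exp_neg_le (m : ℕ) {l : ℝ} (hl : 0 < l) :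
    ∃ C : ℝ, 0 ≤ C ∧ ∀ x : ℝ, 0 ≤ x → (1 + √x) ^ m * Real.exp (-(l * x)) ≤ C := by
  refine ⟨(l⁻¹) ^ m * m.factorial * Real.exp (2 * l), by positivity, fun x hx => ?_⟩
  have h1 : 1 + √x ≤ 2 + x := by
    nlinarith [Real.sq_sqrt hx, sq_nonneg (√x - 1), Real.sqrt_nonneg x]
  have h2 := Real.pow_div_factorial_le_exp (l * (2 + x)) (by positivity) m
  rw [div_le_iff₀ (by positivity)] at h2
  calc (1 + √x) ^ m * Real.exp (-(l * x)) ≤ (2 + x) ^ m * Real.exp (-(l * x)) := by gcongr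
    _ = (l⁻¹) ^ m * (l * (2 + x)) ^ m * Real.exp (-(l * x)) := by
      rw [← mul_pow]; field_simp
    _ ≤ (l⁻¹) ^ m * (Real.exp (l * (2 + x)) * m.factorial) * Real.exp (-(l * x)) := by gcongr
    _ = (l⁻¹) ^ m * m.factorial * (Real.exp (l * (2 + x)) * Real.exp (-(l * x))) := by ring
    _ = _ := by rw [← Real.exp_add]; congr 2; ring

/-- The gap between two consecutive points, truncated at `1`. -/
def gap {n : ℕ} (p : Fin (n + 1) → ℝ) (i : Fin n) : ℝ := min 1 |p i.succ - p i.castSucc|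

theorem gap_sep {n : ℕ} {p : Fin (n + 1) → ℝ} (hp : StrictMono p) (j : Fin (n + 1)) :
    (∀ i, i < j → (Fin.cons 1 (gap p) : Fin (n + 1) → ℝ) j ≤ |p i - p j|) ∧
    (∀ i, j < i → (Fin.snoc (gap p) 1 : Fin (n + 1) → ℝ) j ≤ |p i - p j|) := by
  constructor
  · intro i
    refine Fin.cases (fun h => absurd h (Fin.not_lt_zero _)) (fun j => fun h => ?_) j
    rw [Fin.cons_succ, gap, abs_sub_comm (p i)]
    refine (min_le_right _ _).trans ?_
    have h1 : p i ≤ p j.castSucc := hp.monotone (Fin.le_castSucc_iff.2 h)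
    have h2 : p j.castSucc < p j.succ := hp Fin.castSucc_lt_succ
    rw [abs_of_pos (by linarith), abs_of_pos (by linarith)]
    linarith
  · intro i
    refine Fin.lastCases (fun h => absurd h (not_lt.2 (Fin.le_last _))) (fun j => fun h => ?_) j
    rw [Fin.snoc_castSucc, gap]
    refine (min_le_right _ _).trans ?_
    have h1 : p j.succ ≤ p i := hp.monotone (Fin.castSucc_lt_iff_succ_le.1 h)
    have h2 : p j.castSucc < p j.succ := hp Fin.castSucc_lt_succ
    rw [abs_of_pos (by linarith), abs_of_pos (by linarith)]
    linarith

/-- Two-sided local nondeterminism bounds the coefficients of an increasing configuration. -/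
theorem prod_one_add_abs_rpow_le {μ : Measure ℝ} [IsFiniteMeasure μ] {κ θ : ℝ} (hκ : 0 < κ)
    (hθ : 0 ≤ θ)
    (hlnd : ∀ (n : ℕ) (p c : Fin n → ℝ) (j : Fin n) (δ : ℝ), 0 < δ → δ ≤ 1 →
      (∀ i, i ≠ j → c i = 0 ∨ δ ≤ |p i - p j|) → κ * c j ^ 2 * δ ^ θ ≤ trigForm μ p c)
    {γ : ℝ} (hγ : 0 < γ) (hγ1 : γ ≤ 1) {n : ℕ} {p : Fin (n + 1) → ℝ} (hp : StrictMono p)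
    (c : Fin (n + 1) → ℝ) :
    ∏ j, (1 + |c j|) ^ γ ≤ ((1 + (√κ)⁻¹) ^ γ) ^ (n + 1) *
      (1 + √(trigForm μ p c)) ^ (n + 1) * ∏ i, gap p i ^ (-(θ * γ)) := by
  have hgap : ∀ i, 0 < gap p i := fun i => by
    refine lt_min one_pos (abs_pos.2 (sub_ne_zero.2 (hp Fin.castSucc_lt_succ).ne'))
  have hgap1 : ∀ i, gap p i ≤ 1 := fun i => min_le_left _ _
  set L : Fin (n + 1) → ℝ := Fin.cons 1 (gap p) with hL
  set Rr : Fin (n + 1) → ℝ := Fin.snoc (gap p) 1 with hR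
  have hL0 : ∀ j, 0 < L j := fun j => by
    refine Fin.cases ?_ (fun j => ?_) j <;> simp [hL, hgap]
  have hL1 : ∀ j, L j ≤ 1 := fun j => by
    refine Fin.cases ?_ (fun j => ?_) j <;> simp [hL, hgap1]
  have hR0 : ∀ j, 0 < Rr j := fun j => by
    refine Fin.lastCases ?_ (fun j => ?_) j <;> simp [hR, hgap]
  have hR1 : ∀ j, Rr j ≤ 1 := fun j => by
    refine Fin.lastCases ?_ (fun j => ?_) j <;> simp [hR, hgap1]
  have hprodL : ∀ x : ℝ, ∏ j, L j ^ x = ∏ i, gap p i ^ x := fun x => by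
    simp [hL, Fin.prod_univ_succ]
  have hprodR : ∀ x : ℝ, ∏ j, Rr j ^ x = ∏ i, gap p i ^ x := fun x => by
    simp [hR, Fin.prod_univ_castSucc]
  have htwo : ∀ c j, |c j| ≤ (√κ)⁻¹ * √(trigForm μ p c) * (L j ^ (-(θ / 2)) * Rr j ^ (-(θ / 2))) := by
    intro c j
    have h1 := hlnd _ p c j (L j * Rr j) (mul_pos (hL0 j) (hR0 j))
      (mul_le_one₀ (hL1 j) (hR0 j).le (hR1 j)) (by
        intro i hij
        right
        rcases lt_or_gt_of_ne hij with h | h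
        · exact (mul_le_of_le_one_right (hL0 j).le (hR1 j)).trans ((gap_sep hp j).1 i h)
        · exact (mul_le_of_le_one_left (hR0 j).le (hL1 j)).trans ((gap_sep hp j).2 i h))
    have h2 : √κ * |c j| * (L j * Rr j) ^ (θ / 2) ≤ √(trigForm μ p c) := by
      refine Real.le_sqrt_of_sq_le ?_
      rw [mul_pow, mul_pow, Real.sq_sqrt hκ.le, sq_abs, ← Real.rpow_mul_natCast
        (mul_pos (hL0 j) (hR0 j)).le]
      convert h1 using 3
      push_cast; ring
    have h3 : 0 < (L j * Rr j) ^ (θ / 2) := Real.rpow_pos_of_pos (mul_pos (hL0 j) (hR0 j)) _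
    rw [← Real.mul_rpow (hL0 j).le (hR0 j).le, Real.rpow_neg (mul_pos (hL0 j) (hR0 j)).le]
    rw [mul_assoc, ← div_eq_mul_inv, inv_mul_eq_div, le_div_iff₀ (Real.sqrt_pos.2 hκ),
      le_div_iff₀ h3]
    linarith
  have h1 : ∀ j, (1 + |c j|) ^ γ ≤ ((1 + (√κ)⁻¹) ^ γ * (1 + √(trigForm μ p c))) *
      (L j ^ (-(θ / 2) * γ) * Rr j ^ (-(θ / 2) * γ)) := by
    intro j
    have hl1 : 1 ≤ L j ^ (-(θ / 2)) :=
      Real.one_le_rpow_of_pos_of_le_one_of_nonpos (hL0 j) (hL1 j) (by linarith)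
    have hr1 : 1 ≤ Rr j ^ (-(θ / 2)) :=
      Real.one_le_rpow_of_pos_of_le_one_of_nonpos (hR0 j) (hR1 j) (by linarith)
    have hlr : 1 ≤ L j ^ (-(θ / 2)) * Rr j ^ (-(θ / 2)) := one_le_mul_of_one_le_of_one_le hl1 hr1
    have hs := Real.sqrt_nonneg (trigForm μ p c)
    have hk : 0 ≤ (√κ)⁻¹ := by positivity
    have h2 : 1 + |c j| ≤ (1 + (√κ)⁻¹) * (1 + √(trigForm μ p c)) *
        (L j ^ (-(θ / 2)) * Rr j ^ (-(θ / 2))) := by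
      set P := L j ^ (-(θ / 2)) * Rr j ^ (-(θ / 2))
      calc 1 + |c j| ≤ P + (√κ)⁻¹ * √(trigForm μ p c) * P := add_le_add hlr (htwo c j)
        _ = (1 + (√κ)⁻¹ * √(trigForm μ p c)) * P := by ring
        _ ≤ _ := by
          refine mul_le_mul_of_nonneg_right ?_ (by linarith)
          nlinarith
    calc (1 + |c j|) ^ γ ≤ ((1 + (√κ)⁻¹) * (1 + √(trigForm μ p c)) *
        (L j ^ (-(θ / 2)) * Rr j ^ (-(θ / 2)))) ^ γ :=
          Real.rpow_le_rpow (by positivity) h2 hγ.le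
      _ = (1 + (√κ)⁻¹) ^ γ * (1 + √(trigForm μ p c)) ^ γ *
        (L j ^ (-(θ / 2) * γ) * Rr j ^ (-(θ / 2) * γ)) := by
          rw [Real.mul_rpow (by positivity) (by positivity), Real.mul_rpow (by positivity)
            (by positivity), Real.mul_rpow (by positivity) (by positivity),
            ← Real.rpow_mul (hL0 j).le, ← Real.rpow_mul (hR0 j).le]
      _ ≤ _ := by
          have : (1 + √(trigForm μ p c)) ^ γ ≤ 1 + √(trigForm μ p c) := by
            conv_rhs => rw [← Real.rpow_one (1 + √(trigForm μ p c))]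
            exact Real.rpow_le_rpow_of_exponent_le (by linarith) hγ1
          have hl0 := hL0 j
          have hr0 := hR0 j
          gcongr
  refine (Finset.prod_le_prod (fun j _ => by positivity) fun j _ => h1 j).trans (le_of_eq ?_)
  rw [Finset.prod_mul_distrib, Finset.prod_mul_distrib (f := fun j => L j ^ (-(θ / 2) * γ)),
    hprodL, hprodR, Finset.prod_const,
    Finset.card_univ, Fintype.card_fin, mul_pow, ← Finset.prod_mul_distrib]
  congr 1
  refine Finset.prod_congr rfl fun i _ => ?_
  rw [← Real.rpow_add (hgap i)]; congr 1; ring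

/-- Sequential local nondeterminism bounds the Gaussian integral of an increasing configuration. -/
theorem lintegral_exp_neg_trigForm_le {μ : Measure ℝ} [IsFiniteMeasure μ] {κ θ : ℝ} (hκ : 0 < κ)
    (hlnd : ∀ (n : ℕ) (p c : Fin n → ℝ) (j : Fin n) (δ : ℝ), 0 < δ → δ ≤ 1 →
      (∀ i, i ≠ j → c i = 0 ∨ δ ≤ |p i - p j|) → κ * c j ^ 2 * δ ^ θ ≤ trigForm μ p c)
    {l : ℝ} (hl : 0 < l) {n : ℕ} {p : Fin (n + 1) → ℝ} (hp : StrictMono p) :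
    ∫⁻ c : Fin (n + 1) → ℝ, ENNReal.ofReal (Real.exp (-(l * trigForm μ p c))) ≤
      ENNReal.ofReal ((√Real.pi / √(l * κ)) ^ (n + 1) * ∏ i, gap p i ^ (-(θ / 2))) := by
  have hgap : ∀ i, 0 < gap p i := fun i => by
    refine lt_min one_pos (abs_pos.2 (sub_ne_zero.2 (hp Fin.castSucc_lt_succ).ne'))
  have hgap1 : ∀ i, gap p i ≤ 1 := fun i => min_le_left _ _
  set L : Fin (n + 1) → ℝ := Fin.cons 1 (gap p) with hL
  have hL0 : ∀ j, 0 < L j := fun j => by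
    refine Fin.cases ?_ (fun j => ?_) j <;> simp [hL, hgap]
  have hL1 : ∀ j, L j ≤ 1 := fun j => by
    refine Fin.cases ?_ (fun j => ?_) j <;> simp [hL, hgap1]
  have hprodL : ∀ x : ℝ, ∏ j, L j ^ x = ∏ i, gap p i ^ x := fun x => by
    simp [hL, Fin.prod_univ_succ]
  obtain ⟨e, he⟩ := exists_norm_sum_sq_eq_trigForm μ p
  have hnorm : ∀ c : Fin (n + 1) → ℝ, ‖∑ i, c i • (√(l) • e i)‖ ^ 2 =
      l * trigForm μ p c := by
    intro c
    have : ∑ i, c i • (√(l) • e i) = √(l) • ∑ i, c i • e i := by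
      rw [Finset.smul_sum]
      exact Finset.sum_congr rfl fun i _ => smul_comm _ _ _
    rw [this, norm_smul, mul_pow, he, Real.norm_of_nonneg (Real.sqrt_nonneg _),
      Real.sq_sqrt (by positivity)]
  have h1 := lintegral_exp_neg_norm_sum_sq_le (n + 1) (fun i => √(l) • e i)
    (fun j => √(l * κ) * L j ^ (θ / 2)) (fun j => by have := hL0 j; positivity) (by
      intro j c hc
      refine le_of_sq_le_sq ?_ (norm_nonneg _)
      have h2 := hlnd _ p c j (L j) (hL0 j) (hL1 j) (by
        intro i hij
        rcases lt_or_gt_of_ne hij with h | h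
        · exact Or.inr ((gap_sep hp j).1 i h)
        · exact Or.inl (hc i h))
      rw [hnorm, mul_pow, mul_pow, sq_abs, Real.sq_sqrt (by positivity),
        ← Real.rpow_mul_natCast (hL0 j).le]
      have h3 : θ / 2 * ((2 : ℕ) : ℝ) = θ := by push_cast; ring
      rw [h3]
      nlinarith)
  simp_rw [hnorm] at h1
  refine h1.trans (le_of_eq ?_)
  rw [← ENNReal.ofReal_prod_of_nonneg (fun j _ => by have := hL0 j; positivity)]
  congr 1
  have h4 : ∀ j, √Real.pi / (√(l * κ) * L j ^ (θ / 2)) =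
      (√Real.pi / √(l * κ)) * L j ^ (-(θ / 2)) := fun j => by
    rw [Real.rpow_neg (hL0 j).le, ← div_div, div_eq_mul_inv]
  simp_rw [h4]
  rw [Finset.prod_mul_distrib, hprodL, Finset.prod_const, Finset.card_univ, Fintype.card_fin]

/-- The Gaussian moment of a strictly increasing configuration is controlled by its gaps. -/
theorem exists_gaussMoment_le_strictMono {μ : Measure ℝ} [IsFiniteMeasure μ] {κ θ : ℝ} (hκ : 0 < κ)
    (hθ : 0 ≤ θ)
    (hlnd : ∀ (n : ℕ) (p c : Fin n → ℝ) (j : Fin n) (δ : ℝ), 0 < δ → δ ≤ 1 →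
      (∀ i, i ≠ j → c i = 0 ∨ δ ≤ |p i - p j|) → κ * c j ^ 2 * δ ^ θ ≤ trigForm μ p c)
    {γ l : ℝ} (hγ : 0 < γ) (hγ1 : γ ≤ 1) (hl : 0 < l) (n : ℕ) :
    ∃ C : ℝ, 0 < C ∧ ∀ p : Fin (n + 1) → ℝ, StrictMono p → gaussMoment μ γ l p ≤
      ENNReal.ofReal (C * ∏ i, gap p i ^ (-(θ / 2 * (1 + 2 * γ)))) := by
  obtain ⟨C₁, hC₁, hexp⟩ := exists_pow_mul_exp_neg_le (n + 1) (half_pos hl)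
  have hcon := fun p hp => lintegral_exp_neg_trigForm_le hκ hlnd (half_pos hl) (n := n) (p := p) hp
  generalize (√Real.pi / √(l / 2 * κ)) ^ (n + 1) = C₃ at hcon
  have hwt := fun p hp c => prod_one_add_abs_rpow_le hκ hθ hlnd hγ hγ1 (n := n) (p := p) hp c
  obtain ⟨C₀, hC₀, hC₀0⟩ : ∃ C₀ : ℝ, ((1 + (√κ)⁻¹) ^ γ) ^ (n + 1) = C₀ ∧ 0 ≤ C₀ :=
    ⟨_, rfl, by positivity⟩
  rw [hC₀] at hwt
  refine ⟨C₀ * C₁ * |C₃| + 1, by positivity, fun p hp => ?_⟩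
  have hw := hwt p hp
  have hgap : ∀ i, 0 < gap p i := fun i =>
    lt_min one_pos (abs_pos.2 (sub_ne_zero.2 (hp Fin.castSucc_lt_succ).ne'))
  have hQ0 := fun c => trigForm_nonneg μ p c
  obtain ⟨Pg, hPg, hPg0⟩ : ∃ Pg : ℝ, ∏ i, gap p i ^ (-(θ * γ)) = Pg ∧ 0 ≤ Pg :=
    ⟨_, rfl, Finset.prod_nonneg fun i _ => Real.rpow_nonneg (hgap i).le _⟩
  rw [hPg] at hw
  have hpt : ∀ c : Fin (n + 1) → ℝ, (∏ j, ENNReal.ofReal ((1 + |c j|) ^ γ)) *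
      ENNReal.ofReal (Real.exp (-(l * trigForm μ p c))) ≤
      ENNReal.ofReal (C₀ * C₁ * Pg) * ENNReal.ofReal (Real.exp (-(l / 2 * trigForm μ p c))) := by
    intro c
    rw [← ENNReal.ofReal_prod_of_nonneg (fun j _ => by positivity),
      ← ENNReal.ofReal_mul (Finset.prod_nonneg fun j _ => by positivity),
      ← ENNReal.ofReal_mul (by positivity)]
    refine ENNReal.ofReal_le_ofReal ?_
    have h1 : Real.exp (-(l * trigForm μ p c)) = Real.exp (-(l / 2 * trigForm μ p c)) *
        Real.exp (-(l / 2 * trigForm μ p c)) := by rw [← Real.exp_add]; congr 1; ring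
    have h2 := hexp _ (hQ0 c)
    rw [h1, ← mul_assoc]
    refine mul_le_mul_of_nonneg_right ?_ (Real.exp_nonneg _)
    calc _ ≤ (C₀ * (1 + √(trigForm μ p c)) ^ (n + 1) * Pg) *
          Real.exp (-(l / 2 * trigForm μ p c)) := by gcongr; exact hw c
      _ = C₀ * ((1 + √(trigForm μ p c)) ^ (n + 1) *
          Real.exp (-(l / 2 * trigForm μ p c))) * Pg := by ring
      _ ≤ C₀ * C₁ * Pg := by gcongr
  have hg := hcon p hp
  have hpow : Pg * ∏ i, gap p i ^ (-(θ / 2)) =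
      ∏ i, gap p i ^ (-(θ / 2 * (1 + 2 * γ))) := by
    rw [← hPg, ← Finset.prod_mul_distrib]
    refine Finset.prod_congr rfl fun i _ => ?_
    rw [← Real.rpow_add (hgap i)]; congr 1; ring
  have hG0 : 0 ≤ ∏ i, gap p i ^ (-(θ / 2 * (1 + 2 * γ))) :=
    Finset.prod_nonneg fun i _ => Real.rpow_nonneg (hgap i).le _
  have hmq := measurable_trigForm_right μ p
  calc gaussMoment μ γ l p ≤ ∫⁻ c, ENNReal.ofReal (C₀ * C₁ * Pg) *
        ENNReal.ofReal (Real.exp (-(l / 2 * trigForm μ p c))) := lintegral_mono hpt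
    _ = ENNReal.ofReal (C₀ * C₁ * Pg) *
        ∫⁻ c, ENNReal.ofReal (Real.exp (-(l / 2 * trigForm μ p c))) :=
        lintegral_const_mul _ (by fun_prop)
    _ ≤ ENNReal.ofReal (C₀ * C₁ * Pg) * ENNReal.ofReal (C₃ * ∏ i, gap p i ^ (-(θ / 2))) := by gcongr
    _ = ENNReal.ofReal (C₀ * C₁ * C₃ * ∏ i, gap p i ^ (-(θ / 2 * (1 + 2 * γ)))) := by
        rw [← ENNReal.ofReal_mul (by positivity), ← hpow]; congr 1; ring
    _ ≤ ENNReal.ofReal ((C₀ * C₁ * |C₃| + 1) * ∏ i, gap p i ^ (-(θ / 2 * (1 + 2 * γ)))) := by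
        refine ENNReal.ofReal_le_ofReal (mul_le_mul_of_nonneg_right ?_ hG0)
        have : C₀ * C₁ * C₃ ≤ C₀ * C₁ * |C₃| :=
          mul_le_mul_of_nonneg_left (le_abs_self _) (by positivity)
        linarith

theorem exists_gaussMoment_le_monotone {μ : Measure ℝ} [IsFiniteMeasure μ] {κ θ : ℝ} (hκ : 0 < κ)
    (hθ : 0 < θ)
    (hlnd : ∀ (n : ℕ) (p c : Fin n → ℝ) (j : Fin n) (δ : ℝ), 0 < δ → δ ≤ 1 →
      (∀ i, i ≠ j → c i = 0 ∨ δ ≤ |p i - p j|) → κ * c j ^ 2 * δ ^ θ ≤ trigForm μ p c)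
    {γ l : ℝ} (hγ : 0 < γ) (hγ1 : γ ≤ 1) (hl : 0 < l) (n : ℕ) :
    ∃ C : ℝ, 0 < C ∧ ∀ p : Fin (n + 1) → ℝ, Monotone p → gaussMoment μ γ l p ≤
      ENNReal.ofReal C * ∏ i, ENNReal.ofReal (gap p i) ^ (-(θ / 2 * (1 + 2 * γ))) := by
  obtain ⟨C, hC, h⟩ := exists_gaussMoment_le_strictMono hκ hθ.le hlnd hγ hγ1 hl n
  refine ⟨C, hC, fun p hp => ?_⟩
  have he : -(θ / 2 * (1 + 2 * γ)) < 0 := by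
    have : 0 < θ / 2 * (1 + 2 * γ) := by positivity
    linarith
  by_cases hs : StrictMono p
  · have hgap : ∀ i, 0 < gap p i := fun i =>
      lt_min one_pos (abs_pos.2 (sub_ne_zero.2 (hs Fin.castSucc_lt_succ).ne'))
    refine (h p hs).trans (le_of_eq ?_)
    rw [ENNReal.ofReal_mul hC.le, ENNReal.ofReal_prod_of_nonneg
      fun i _ => Real.rpow_nonneg (hgap i).le _]
    congr 1
    exact Finset.prod_congr rfl fun i _ => (ENNReal.ofReal_rpow_of_pos (hgap i)).symm
  · rw [Fin.strictMono_iff_lt_succ] at hs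
    push Not at hs
    obtain ⟨i, hi⟩ := hs
    have h0 : gap p i = 0 := by
      have : p i.succ = p i.castSucc := le_antisymm hi (hp Fin.castSucc_lt_succ.le)
      simp [gap, this]
    have htop : ∏ i, ENNReal.ofReal (gap p i) ^ (-(θ / 2 * (1 + 2 * γ))) = ⊤ := by
      rw [← Finset.mul_prod_erase _ _ (Finset.mem_univ i), h0, ENNReal.ofReal_zero,
        ENNReal.zero_rpow_of_neg he, ENNReal.top_mul]
      refine Finset.prod_ne_zero_iff.2 fun j _ hj => ?_
      rw [ENNReal.rpow_eq_zero_iff] at hj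
      rcases hj with hj | hj
      · linarith [hj.2]
      · exact ENNReal.ofReal_ne_top hj.1
    rw [htop, ENNReal.mul_top (by simpa using hC)]
    exact le_top

theorem measurable_gap {n : ℕ} (i : Fin n) : Measurable fun p : Fin (n + 1) → ℝ => gap p i := by
  unfold gap
  exact Continuous.measurable (by fun_prop)

theorem exists_lintegral_min_rpow_neg_le {a : ℝ} (ha : a < 1) (R : ℝ) :
    ∃ M : ℝ≥0∞, M < ⊤ ∧ ∀ x : ℝ,
      ∫⁻ y in Set.Icc (-R) R, ENNReal.ofReal (min 1 |y - x|) ^ (-a) ≤ M := by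
  refine ⟨volume (Set.Icc (-R) R) + ∫⁻ y in Set.Icc (-1) 1, ENNReal.ofReal |y| ^ (-a), ?_, ?_⟩
  · refine ENNReal.add_lt_top.2 ⟨by simp [Real.volume_Icc], ?_⟩
    have hi : ∫⁻ y in Set.Ioc (0 : ℝ) 1, ENNReal.ofReal |y| ^ (-a) < ⊤ := by
      have h1 : IntegrableOn (fun ρ : ℝ => ρ ^ (-a)) (Set.Ioc 0 1) :=
        (intervalIntegrable_iff_integrableOn_Ioc_of_le zero_le_one).1
          (intervalIntegral.intervalIntegrable_rpow' (by linarith))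
      refine lt_of_eq_of_lt ?_ h1.lintegral_lt_top
      refine setLIntegral_congr_fun measurableSet_Ioc fun y hy => ?_
      rw [abs_of_pos hy.1, ENNReal.ofReal_rpow_of_pos hy.1]
    have h2 : ∫⁻ y in Set.Icc (-1) 1, ENNReal.ofReal |y| ^ (-a) =
        ∫⁻ y, (Set.Icc (-1) 1).indicator (fun y : ℝ => ENNReal.ofReal |y| ^ (-a)) y :=
      (lintegral_indicator measurableSet_Icc _).symm
    rw [h2, lintegral_even, setLIntegral_indicator measurableSet_Icc]
    · have : Set.Icc (-1 : ℝ) 1 ∩ Set.Ioi 0 = Set.Ioc 0 1 := by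
        ext y; simp only [Set.mem_inter_iff, Set.mem_Icc, Set.mem_Ioi, Set.mem_Ioc]
        constructor
        · rintro ⟨⟨_, h⟩, h'⟩; exact ⟨h', h⟩
        · rintro ⟨h, h'⟩; exact ⟨⟨by linarith, h'⟩, h⟩
      rw [this]
      exact ENNReal.mul_lt_top (by simp) hi
    · intro y
      have : (-y ∈ Set.Icc (-1 : ℝ) 1) ↔ y ∈ Set.Icc (-1 : ℝ) 1 := by
        simp only [Set.mem_Icc]; constructor <;> rintro ⟨h, h'⟩ <;> constructor <;> linarith
      simp only [Set.indicator, this, abs_neg]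
  · intro x
    have hpt : ∀ y : ℝ, ENNReal.ofReal (min 1 |y - x|) ^ (-a) ≤
        1 + (Set.Icc (-1) 1).indicator (fun y : ℝ => ENNReal.ofReal |y| ^ (-a)) (y - x) := by
      intro y
      by_cases hy : |y - x| ≤ 1
      · have hy' : y - x ∈ Set.Icc (-1 : ℝ) 1 := abs_le.1 hy
        rw [Set.indicator_of_mem hy', min_eq_right hy]
        exact le_add_self
      · rw [min_eq_left (not_le.1 hy).le]; simp
    calc _ ≤ ∫⁻ y in Set.Icc (-R) R, (1 + (Set.Icc (-1) 1).indicator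
          (fun y : ℝ => ENNReal.ofReal |y| ^ (-a)) (y - x)) := lintegral_mono hpt
      _ = volume (Set.Icc (-R) R) + ∫⁻ y in Set.Icc (-R) R, (Set.Icc (-1) 1).indicator
          (fun y : ℝ => ENNReal.ofReal |y| ^ (-a)) (y - x) := by
          rw [lintegral_add_left measurable_const]; simp
      _ ≤ volume (Set.Icc (-R) R) + ∫⁻ y, (Set.Icc (-1) 1).indicator
          (fun y : ℝ => ENNReal.ofReal |y| ^ (-a)) (y - x) := by
          gcongr; exact Measure.restrict_le_self
      _ = _ := by
          rw [lintegral_sub_right_eq_self (fun y => (Set.Icc (-1) 1).indicator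
            (fun y : ℝ => ENNReal.ofReal |y| ^ (-a)) y) x, lintegral_indicator measurableSet_Icc]

theorem lintegral_prod_gap_lt_top {a : ℝ} (ha : a < 1) (R : ℝ) (n : ℕ) :
    ∫⁻ p : Fin (n + 1) → ℝ, ∏ i, ENNReal.ofReal (gap p i) ^ (-a)
      ∂(Measure.pi fun _ => volume.restrict (Set.Icc (-R) R)) < ⊤ := by
  obtain ⟨M, hM, hMle⟩ := exists_lintegral_min_rpow_neg_le ha R
  induction n with
  | zero =>
    simp only [Finset.univ_eq_empty, Finset.prod_empty, lintegral_one]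
    rw [Measure.pi_univ]
    exact ENNReal.prod_lt_top fun i _ => by simp [Real.volume_Icc]
  | succ n ih =>
    set ν : Measure ℝ := volume.restrict (Set.Icc (-R) R) with hν
    have hmp := measurePreserving_piFinSuccAbove (fun _ : Fin (n + 2) => ν) (Fin.last (n + 1))
    have hm : Measurable fun p : Fin (n + 2) → ℝ => ∏ i, ENNReal.ofReal (gap p i) ^ (-a) :=
      Finset.measurable_prod _ fun i _ => ((measurable_gap i).ennreal_ofReal.pow_const _)
    have hm' : Measurable fun p : Fin (n + 1) → ℝ => ∏ i, ENNReal.ofReal (gap p i) ^ (-a) :=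
      Finset.measurable_prod _ fun i _ => ((measurable_gap i).ennreal_ofReal.pow_const _)
    rw [← (hmp.symm _).lintegral_comp hm, lintegral_prod_symm
      (fun x => ∏ i, ENNReal.ofReal (gap ((MeasurableEquiv.piFinSuccAbove (fun _ => ℝ)
        (Fin.last (n + 1))).symm x) i) ^ (-a)) (hm.comp (MeasurableEquiv.measurable _)).aemeasurable]
    have hpt : ∀ (q : Fin (n + 1) → ℝ) (y : ℝ),
        ∏ i, ENNReal.ofReal (gap ((MeasurableEquiv.piFinSuccAbove (fun _ => ℝ)
          (Fin.last (n + 1))).symm (y, q)) i) ^ (-a) =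
        (∏ i, ENNReal.ofReal (gap q i) ^ (-a)) *
          ENNReal.ofReal (min 1 |y - q (Fin.last n)|) ^ (-a) := by
      intro q y
      simp only [MeasurableEquiv.piFinSuccAbove_symm_apply, Fin.insertNthEquiv_last]
      rw [Fin.prod_univ_castSucc]
      congr 1
      · refine Finset.prod_congr rfl fun i _ => ?_
        simp only [gap, Fin.snocEquiv_apply]
        rw [← Fin.castSucc_succ, Fin.snoc_castSucc (α := fun _ => ℝ), Fin.snoc_castSucc (α := fun _ => ℝ)]
      · simp only [gap, Fin.snocEquiv_apply]
        rw [Fin.succ_last, Fin.snoc_last (α := fun _ => ℝ), Fin.snoc_castSucc (α := fun _ => ℝ)]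
    calc _ ≤ ∫⁻ q : Fin (n + 1) → ℝ, (∏ i, ENNReal.ofReal (gap q i) ^ (-a)) * M
          ∂(Measure.pi fun _ => ν) := by
          refine lintegral_mono fun q => ?_
          simp_rw [hpt q]
          rw [lintegral_const_mul _ (by fun_prop)]
          gcongr
          exact hMle _
      _ = (∫⁻ q : Fin (n + 1) → ℝ, (∏ i, ENNReal.ofReal (gap q i) ^ (-a))
          ∂(Measure.pi fun _ => ν)) * M := lintegral_mul_const _ hm'
      _ < ⊤ := ENNReal.mul_lt_top ih hM

/-- A power of the Gaussian moment is integrable over bounded configurations. -/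
theorem lintegral_gaussMoment_rpow_lt_top {μ : Measure ℝ} [IsFiniteMeasure μ] {κ θ : ℝ}
    (hκ : 0 < κ) (hθ : 0 < θ)
    (hlnd : ∀ (n : ℕ) (p c : Fin n → ℝ) (j : Fin n) (δ : ℝ), 0 < δ → δ ≤ 1 →
      (∀ i, i ≠ j → c i = 0 ∨ δ ≤ |p i - p j|) → κ * c j ^ 2 * δ ^ θ ≤ trigForm μ p c)
    {γ l e : ℝ} (hγ : 0 < γ) (hγ1 : γ ≤ 1) (hl : 0 < l) (he : 0 ≤ e)
    (hlt : θ / 2 * (1 + 2 * γ) * e < 1) (R : ℝ) (n : ℕ) :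
    ∫⁻ p : Fin (n + 1) → ℝ, gaussMoment μ γ l p ^ e
      ∂(Measure.pi fun _ => volume.restrict (Set.Icc (-R) R)) < ⊤ := by
  obtain ⟨C, hC, hle⟩ := exists_gaussMoment_le_monotone hκ hθ hlnd hγ hγ1 hl n
  set ν : Measure ℝ := volume.restrict (Set.Icc (-R) R) with hν
  set a := θ / 2 * (1 + 2 * γ) * e with ha
  set B : (Fin (n + 1) → ℝ) → ℝ≥0∞ := fun p => ∏ i, ENNReal.ofReal (gap p i) ^ (-a) with hB
  have hBm : Measurable B :=
    Finset.measurable_prod _ fun i _ => ((measurable_gap i).ennreal_ofReal.pow_const _)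
  have hpt : ∀ p : Fin (n + 1) → ℝ, gaussMoment μ γ l p ^ e ≤
      ∑ σ : Equiv.Perm (Fin (n + 1)), ENNReal.ofReal C ^ e * B (p ∘ σ) := by
    intro p
    have h1 := hle (p ∘ Tuple.sort p) (Tuple.monotone_sort p)
    rw [gaussMoment_comp_perm] at h1
    have h2 : gaussMoment μ γ l p ^ e ≤ ENNReal.ofReal C ^ e * B (p ∘ Tuple.sort p) := by
      refine (ENNReal.rpow_le_rpow h1 he).trans (le_of_eq ?_)
      rw [ENNReal.mul_rpow_of_nonneg _ _ he, ← ENNReal.prod_rpow_of_nonneg he]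
      congr 1
      refine Finset.prod_congr rfl fun i _ => ?_
      rw [← ENNReal.rpow_mul]; congr 1; rw [ha]; ring
    exact h2.trans (Finset.single_le_sum (f := fun σ : Equiv.Perm (Fin (n + 1)) =>
      ENNReal.ofReal C ^ e * B (p ∘ σ)) (fun _ _ => zero_le) (Finset.mem_univ _))
  refine (lintegral_mono hpt).trans_lt ?_
  have hBσ : ∀ σ : Equiv.Perm (Fin (n + 1)), Measurable fun p : Fin (n + 1) → ℝ => B (p ∘ σ) :=
    fun σ => hBm.comp (measurable_pi_lambda _ fun i => measurable_pi_apply _)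
  rw [lintegral_finsetSum _ fun σ _ => (hBσ σ).const_mul _]
  refine ENNReal.sum_lt_top.2 fun σ _ => ?_
  rw [lintegral_const_mul _ (hBσ σ)]
  refine ENNReal.mul_lt_top (ENNReal.rpow_lt_top_of_nonneg he ENNReal.ofReal_ne_top) ?_
  have hmp := measurePreserving_piCongrLeft (α := fun _ : Fin (n + 1) => ℝ) (fun _ => ν) σ.symm
  have : ∀ c : Fin (n + 1) → ℝ,
      (MeasurableEquiv.piCongrLeft (fun _ : Fin (n + 1) => ℝ) σ.symm) c = c ∘ σ := by
    intro c
    ext i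
    have := MeasurableEquiv.piCongrLeft_apply_apply (β := fun _ : Fin (n + 1) => ℝ) σ.symm c (σ i)
    simpa using this
  have h3 := hmp.lintegral_comp hBm
  simp_rw [this] at h3
  rw [h3]
  exact lintegral_prod_gap_lt_top hlt R n

/-- The centred Gaussian density with standard deviation `2^{-m}`. -/
def mollifier {d : ℕ} (m : ℕ) (x : EuclideanSpace ℝ (Fin d)) : ℝ :=
  (2 ^ m / √(2 * Real.pi)) ^ d * Real.exp (-(2 ^ m * ‖x‖) ^ 2 / 2)

theorem mollifier_nonneg {d : ℕ} (m : ℕ) (x : EuclideanSpace ℝ (Fin d)) : 0 ≤ mollifier m x := by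
  unfold mollifier; positivity

theorem continuous_mollifier {d : ℕ} (m : ℕ) :
    Continuous (mollifier m : EuclideanSpace ℝ (Fin d) → ℝ) := by
  unfold mollifier; fun_prop

theorem mollifier_const_le (d m : ℕ) : ((2 : ℝ) ^ m / √(2 * Real.pi)) ^ d ≤ 2 ^ (m * d) := by
  rw [pow_mul]
  have h : (1 : ℝ) ≤ √(2 * Real.pi) := by
    rw [Real.one_le_sqrt]; linarith [Real.pi_gt_three]
  gcongr
  exact div_le_self (by positivity) h

theorem mollifier_le {d : ℕ} (m : ℕ) (x : EuclideanSpace ℝ (Fin d)) :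
    mollifier m x ≤ 2 ^ (m * d) := by
  unfold mollifier
  refine (mul_le_of_le_one_right (by positivity) ?_).trans (mollifier_const_le d m)
  rw [Real.exp_le_one_iff]
  have : 0 ≤ (2 ^ m * ‖x‖) ^ 2 := by positivity
  linarith

theorem abs_exp_neg_sq_sub_le (s t : ℝ) :
    |Real.exp (-s ^ 2 / 2) - Real.exp (-t ^ 2 / 2)| ≤ |s - t| := by
  have hd : ∀ x : ℝ, HasDerivAt (fun x : ℝ => Real.exp (-x ^ 2 / 2))
      (Real.exp (-x ^ 2 / 2) * -x) x := by
    intro x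
    have h1 : HasDerivAt (fun x : ℝ => -x ^ 2 / 2) (-x) x := by
      have := ((hasDerivAt_pow 2 x).neg).div_const 2
      refine this.congr_deriv ?_
      push_cast; ring
    exact h1.exp
  have hb : ∀ x : ℝ, ‖Real.exp (-x ^ 2 / 2) * -x‖ ≤ 1 := by
    intro x
    rw [norm_mul, norm_neg, Real.norm_eq_abs, Real.norm_eq_abs, abs_of_pos (Real.exp_pos _),
      neg_div, Real.exp_neg, inv_mul_le_iff₀ (Real.exp_pos _), mul_one]
    have h1 := Real.add_one_le_exp (x ^ 2 / 2)
    nlinarith [sq_abs x, sq_nonneg (|x| - 1)]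
  have := Convex.norm_image_sub_le_of_norm_hasDerivWithin_le
    (f := fun x : ℝ => Real.exp (-x ^ 2 / 2)) (s := Set.univ)
    (fun x _ => (hd x).hasDerivWithinAt) (fun x _ => hb x) convex_univ (Set.mem_univ t)
    (Set.mem_univ s)
  simpa [Real.norm_eq_abs] using this

theorem abs_mollifier_sub_le {d : ℕ} (m : ℕ) (x y : EuclideanSpace ℝ (Fin d)) :
    |mollifier m x - mollifier m y| ≤ 2 ^ (m * (d + 1)) * ‖x - y‖ := by
  unfold mollifier
  rw [← mul_sub, abs_mul, abs_of_nonneg (by positivity)]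
  calc _ ≤ 2 ^ (m * d) * |2 ^ m * ‖x‖ - 2 ^ m * ‖y‖| := by
        exact mul_le_mul (mollifier_const_le d m) (abs_exp_neg_sq_sub_le _ _) (abs_nonneg _)
          (by positivity)
    _ = 2 ^ (m * (d + 1)) * |‖x‖ - ‖y‖| := by
        rw [← mul_sub, abs_mul, abs_of_pos (by positivity : (0 : ℝ) < 2 ^ m), mul_add, pow_add,
          mul_one]
        ring
    _ ≤ _ := by gcongr; exact abs_norm_sub_norm_le x y

theorem integral_mollifier_smul {d : ℕ} (m : ℕ) (φ : EuclideanSpace ℝ (Fin d) → ℝ)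
    (x : EuclideanSpace ℝ (Fin d)) :
    ∫ v, φ v * mollifier m (x - v) =
      ∫ u, φ (x - (2 ^ m : ℝ)⁻¹ • u) * mollifier 0 u := by
  have h1 := Measure.integral_comp_smul (volume : Measure (EuclideanSpace ℝ (Fin d)))
    (fun u => φ (x - (2 ^ m : ℝ)⁻¹ • u) * mollifier 0 u) (2 ^ m)
  have h2 := integral_sub_left_eq_self (fun v => φ v * mollifier m (x - v)) volume x
  rw [← h2]
  have h3 : ∀ u, φ (x - u) * mollifier m (x - (x - u)) = (2 ^ m) ^ d *
      (φ (x - (2 ^ m : ℝ)⁻¹ • ((2 ^ m : ℝ) • u)) * mollifier 0 ((2 ^ m : ℝ) • u)) := by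
    intro u
    rw [smul_smul, inv_mul_cancel₀ (by positivity), one_smul, sub_sub_cancel]
    unfold mollifier
    rw [norm_smul, Real.norm_of_nonneg (by positivity), pow_zero, one_mul, div_pow, div_pow, one_pow]
    ring
  simp_rw [h3]
  rw [integral_const_mul, h1, finrank_euclideanSpace_fin, smul_eq_mul, ← mul_assoc,
    abs_of_pos (by positivity), mul_inv_cancel₀ (by positivity), one_mul]

theorem integral_mollifier_zero (d : ℕ) :
    ∫ u : EuclideanSpace ℝ (Fin d), mollifier 0 u = 1 := by
  have h1 := GaussianFourier.integral_rexp_neg_mul_sq_norm (V := EuclideanSpace ℝ (Fin d))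
    (b := 1 / 2) (by norm_num)
  have h2 : ∀ u : EuclideanSpace ℝ (Fin d), mollifier 0 u =
      (1 / √(2 * Real.pi)) ^ d * Real.exp (-(1 / 2) * ‖u‖ ^ 2) := by
    intro u; unfold mollifier; rw [pow_zero, one_mul]; congr 2; ring
  simp_rw [h2]
  rw [integral_const_mul, h1, finrank_euclideanSpace_fin, div_pow, one_pow, Real.sqrt_eq_rpow,
    ← Real.rpow_mul_natCast (by positivity), show Real.pi / (1 / 2) = 2 * Real.pi by ring,
    show (1 / 2 * (d : ℝ)) = (d : ℝ) / 2 by ring]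
  exact one_div_mul_cancel (by positivity)

theorem integrable_mollifier_zero (d : ℕ) :
    Integrable (mollifier 0 : EuclideanSpace ℝ (Fin d) → ℝ) := by
  by_contra h
  have := integral_undef h
  rw [integral_mollifier_zero] at this
  exact one_ne_zero this

/-- The mollifiers form an approximate identity. -/
theorem tendsto_integral_mul_mollifier {d : ℕ} {φ : EuclideanSpace ℝ (Fin d) → ℝ}
    (hφ : Continuous φ) {C : ℝ} (hC : ∀ x, |φ x| ≤ C) (x : EuclideanSpace ℝ (Fin d)) :
    Tendsto (fun m => ∫ v, φ v * mollifier m (x - v)) atTop (𝓝 (φ x)) := by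
  simp_rw [integral_mollifier_smul]
  have h1 : φ x = ∫ u : EuclideanSpace ℝ (Fin d), φ x * mollifier 0 u := by
    rw [integral_const_mul, integral_mollifier_zero, mul_one]
  rw [h1]
  refine tendsto_integral_of_dominated_convergence (fun u => C * mollifier 0 u) ?_ ?_ ?_ ?_
  · intro m
    have := continuous_mollifier (d := d) 0
    exact Continuous.aestronglyMeasurable (by fun_prop)
  · exact (integrable_mollifier_zero d).const_mul C
  · intro m
    refine ae_of_all _ fun u => ?_
    rw [norm_mul, Real.norm_eq_abs, Real.norm_of_nonneg (mollifier_nonneg _ _)]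
    exact mul_le_mul_of_nonneg_right (hC _) (mollifier_nonneg _ _)
  · refine ae_of_all _ fun u => Tendsto.mul_const _ ?_
    have h2 : Tendsto (fun m : ℕ => x - ((2 : ℝ) ^ m)⁻¹ • u) atTop (𝓝 (x - (0 : ℝ) • u)) := by
      refine tendsto_const_nhds.sub (Tendsto.smul_const ?_ u)
      exact tendsto_inv_atTop_zero.comp (tendsto_pow_atTop_atTop_of_one_lt one_lt_two)
    rw [zero_smul, sub_zero] at h2
    exact (hφ.tendsto x).comp h2

theorem abs_integral_mul_mollifier_le {d : ℕ} {φ : EuclideanSpace ℝ (Fin d) → ℝ} {C : ℝ}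
    (hC : ∀ x, |φ x| ≤ C) (m : ℕ) (x : EuclideanSpace ℝ (Fin d)) :
    |∫ v, φ v * mollifier m (x - v)| ≤ C := by
  rw [integral_mollifier_smul, ← Real.norm_eq_abs]
  have h1 : C = ∫ u : EuclideanSpace ℝ (Fin d), C * mollifier 0 u := by
    rw [integral_const_mul, integral_mollifier_zero, mul_one]
  conv_rhs => rw [h1]
  refine norm_integral_le_of_norm_le ((integrable_mollifier_zero d).const_mul C)
    (ae_of_all _ fun u => ?_)
  rw [norm_mul, Real.norm_eq_abs, Real.norm_of_nonneg (mollifier_nonneg _ _)]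
  exact mul_le_mul_of_nonneg_right (hC _) (mollifier_nonneg _ _)

/-- Fourier transform of the mollifier. -/
def mollifierFourier {d : ℕ} (m : ℕ) (y : Fin d → ℝ) : ℝ :=
  Real.exp (-(∑ k, y k ^ 2) / (2 * 4 ^ m))

theorem continuous_mollifierFourier {d : ℕ} (m : ℕ) :
    Continuous (mollifierFourier m : (Fin d → ℝ) → ℝ) := by
  unfold mollifierFourier; fun_prop

theorem mollifierFourier_eq_prod {d : ℕ} (m : ℕ) (y : Fin d → ℝ) :
    mollifierFourier m y = ∏ k, Real.exp (-(2 * 4 ^ m)⁻¹ * y k ^ 2) := by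
  unfold mollifierFourier
  rw [← Real.exp_sum, ← Finset.mul_sum]
  congr 1; rw [div_eq_inv_mul]; ring

theorem integrable_mollifierFourier {d : ℕ} (m : ℕ) :
    Integrable (mollifierFourier m : (Fin d → ℝ) → ℝ) := by
  have : (mollifierFourier m : (Fin d → ℝ) → ℝ) =
      fun y => ∏ k, Real.exp (-(2 * 4 ^ m)⁻¹ * y k ^ 2) := funext (mollifierFourier_eq_prod m)
  rw [this]
  exact Integrable.fintype_prod (f := fun (_ : Fin d) (x : ℝ) => Real.exp (-(2 * 4 ^ m)⁻¹ * x ^ 2))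
    fun _ => integrable_exp_neg_mul_sq (by positivity)

theorem mollifier_eq_integral {d : ℕ} (m : ℕ) (x : EuclideanSpace ℝ (Fin d)) :
    (mollifier m x : ℂ) = ∫ y : Fin d → ℝ, (((2 * Real.pi)⁻¹ ^ d * mollifierFourier m y : ℝ) : ℂ) *
      Complex.exp (((∑ k, y k * x k : ℝ) : ℂ) * Complex.I) := by
  have h1 : ∀ t : ℝ, ∫ s : ℝ, (((2 * Real.pi)⁻¹ * Real.exp (-(2 * 4 ^ m)⁻¹ * s ^ 2) : ℝ) : ℂ) *
      Complex.exp (((s * t : ℝ) : ℂ) * Complex.I) =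
      ((2 ^ m / √(2 * Real.pi) * Real.exp (-(2 ^ m * t) ^ 2 / 2) : ℝ) : ℂ) := by
    intro t
    have h2 := fourierIntegral_gaussian (b := ((2 * 4 ^ m)⁻¹ : ℝ)) (by
      rw [Complex.ofReal_re]; positivity) t
    have h3 : ∀ s : ℝ, (((2 * Real.pi)⁻¹ * Real.exp (-(2 * 4 ^ m)⁻¹ * s ^ 2) : ℝ) : ℂ) *
        Complex.exp (((s * t : ℝ) : ℂ) * Complex.I) = ((2 * Real.pi)⁻¹ : ℝ) *
        (Complex.exp (Complex.I * t * s) * Complex.exp (-((2 * 4 ^ m)⁻¹ : ℝ) * s ^ 2)) := by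
      intro s
      push_cast
      rw [show ((s : ℂ) * t * Complex.I) = Complex.I * t * s by ring]
      ring
    simp_rw [h3]
    rw [integral_const_mul, h2]
    have h4 : ((Real.pi : ℂ) / ((2 * 4 ^ m)⁻¹ : ℝ)) ^ (1 / 2 : ℂ) =
        ((2 ^ m * √(2 * Real.pi) : ℝ) : ℂ) := by
      have h5 : (Real.pi : ℂ) / ((2 * 4 ^ m)⁻¹ : ℝ) = ((4 ^ m * (2 * Real.pi) : ℝ) : ℂ) := by
        push_cast; field_simp
      rw [h5, show (1 / 2 : ℂ) = ((1 / 2 : ℝ) : ℂ) by push_cast; rfl,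
        ← Complex.ofReal_cpow (by positivity), ← Real.sqrt_eq_rpow, Real.sqrt_mul (by positivity)]
      congr 2
      rw [show (4 : ℝ) ^ m = (2 ^ m) ^ 2 by rw [← pow_mul, mul_comm, pow_mul]; norm_num,
        Real.sqrt_sq (by positivity)]
    rw [h4]
    have h6 : -(t : ℂ) ^ 2 / (4 * ((2 * 4 ^ m)⁻¹ : ℝ)) = ((-(2 ^ m * t) ^ 2 / 2 : ℝ) : ℂ) := by
      push_cast
      rw [mul_pow, ← pow_mul, mul_comm m 2, pow_mul]
      norm_num
      field_simp
      norm_num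
    rw [h6, ← Complex.ofReal_exp, ← Complex.ofReal_mul, ← Complex.ofReal_mul]
    congr 1
    have h7 : √(2 * Real.pi) * √(2 * Real.pi) = 2 * Real.pi := Real.mul_self_sqrt (by positivity)
    have h8 : 0 < √(2 * Real.pi) := by positivity
    have h10 : (2 * Real.pi)⁻¹ = (√(2 * Real.pi))⁻¹ * (√(2 * Real.pi))⁻¹ := by
      rw [← mul_inv, h7]
    rw [h10]
    field_simp
  have h9 : ∀ y : Fin d → ℝ, (((2 * Real.pi)⁻¹ ^ d * mollifierFourier m y : ℝ) : ℂ) *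
      Complex.exp (((∑ k, y k * x k : ℝ) : ℂ) * Complex.I) =
      ∏ k, ((((2 * Real.pi)⁻¹ * Real.exp (-(2 * 4 ^ m)⁻¹ * y k ^ 2) : ℝ) : ℂ) *
      Complex.exp (((y k * x k : ℝ) : ℂ) * Complex.I)) := by
    intro y
    rw [Finset.prod_mul_distrib, ← Complex.exp_sum, ← Finset.sum_mul, ← Complex.ofReal_prod,
      Finset.prod_mul_distrib, ← mollifierFourier_eq_prod, ← Complex.ofReal_sum]
    simp
  simp_rw [h9]
  rw [integral_fintype_prod_volume_eq_prod (fun (k : Fin d) (s : ℝ) =>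
    (((2 * Real.pi)⁻¹ * Real.exp (-(2 * 4 ^ m)⁻¹ * s ^ 2) : ℝ) : ℂ) *
      Complex.exp (((s * x k : ℝ) : ℂ) * Complex.I))]
  simp_rw [h1]
  rw [← Complex.ofReal_prod, Finset.prod_mul_distrib]
  congr 1
  unfold mollifier
  rw [Finset.prod_const, Finset.card_univ, Fintype.card_fin, ← Real.exp_sum, mul_pow,
    EuclideanSpace.norm_sq_eq]
  congr 2
  rw [← Finset.sum_div, Finset.sum_neg_distrib, Finset.mul_sum]
  simp [mul_pow]

/-- Consecutive mollifiers differ little at moderate frequencies. -/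
theorem abs_mollifierFourier_sub_le {d : ℕ} (m : ℕ) {γ : ℝ} (hγ : 0 < γ) (hγ1 : γ ≤ 1)
    (y : Fin d → ℝ) :
    |mollifierFourier (m + 1) y - mollifierFourier m y| ≤
      ((2 : ℝ) ^ (-γ)) ^ m * ∏ k, (1 + |y k|) ^ γ := by
  set S := ∑ k, y k ^ 2 with hS
  have hS0 : 0 ≤ S := Finset.sum_nonneg fun k _ => sq_nonneg _
  set u := (2 ^ m : ℝ)⁻¹ * √S with hu
  have hu0 : 0 ≤ u := by positivity
  have hu2 : S / (2 * 4 ^ m) = u ^ 2 / 2 := by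
    rw [hu, mul_pow, Real.sq_sqrt hS0, inv_pow, ← pow_mul, mul_comm m 2, pow_mul]
    norm_num
    field_simp
  have h1 : mollifierFourier m y ≤ mollifierFourier (m + 1) y := by
    unfold mollifierFourier
    refine Real.exp_le_exp.2 ?_
    rw [neg_div, neg_div, neg_le_neg_iff, ← hS]
    gcongr
    · norm_num
    · omega
  have h2 : mollifierFourier (m + 1) y ≤ 1 := by
    unfold mollifierFourier
    rw [Real.exp_le_one_iff, neg_div, neg_nonpos, ← hS]
    positivity
  have h3 : mollifierFourier m y = Real.exp (-(u ^ 2 / 2)) := by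
    unfold mollifierFourier
    rw [← hS, neg_div, hu2]
  have h4 : |mollifierFourier (m + 1) y - mollifierFourier m y| ≤ u ^ γ := by
    rw [abs_of_nonneg (by linarith)]
    have h5 : mollifierFourier (m + 1) y - mollifierFourier m y ≤ 1 - Real.exp (-(u ^ 2 / 2)) := by
      linarith
    rcases le_total u 1 with hu1 | hu1
    · have h6 := Real.add_one_le_exp (-(u ^ 2 / 2))
      have h7 : u ≤ u ^ γ := by
        conv_lhs => rw [← Real.rpow_one u]
        exact Real.rpow_le_rpow_of_exponent_ge_of_imp hu0 hu1 hγ1 (by intro _ h; linarith)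
      nlinarith
    · have h6 : 1 ≤ u ^ γ := Real.one_le_rpow hu1 hγ.le
      have := Real.exp_pos (-(u ^ 2 / 2))
      linarith
  refine h4.trans ?_
  rw [hu, Real.mul_rpow (by positivity) (Real.sqrt_nonneg _)]
  have h8 : ((2 ^ m : ℝ)⁻¹) ^ γ = ((2 : ℝ) ^ (-γ)) ^ m := by
    rw [← inv_pow, ← Real.rpow_natCast, ← Real.rpow_natCast, ← Real.rpow_mul (by positivity),
      ← Real.rpow_mul (by positivity), Real.inv_rpow (by positivity), ← Real.rpow_neg (by positivity)]
    congr 1; ring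
  rw [h8, Real.finsetProd_rpow _ _ (fun k _ => by positivity)]
  gcongr
  have h9 : S ≤ (∏ k, (1 + |y k|)) ^ 2 := by
    have h10 : ∑ k, |y k| ≤ ∏ k, (1 + |y k|) := by
      have h12 : ∀ s : Finset (Fin d), 1 + ∑ k ∈ s, |y k| ≤ ∏ k ∈ s, (1 + |y k|) := by
        intro s
        induction s using Finset.induction_on with
        | empty => simp
        | insert k s hk ih =>
          rw [Finset.sum_insert hk, Finset.prod_insert hk]
          have h13 : 0 ≤ ∑ k ∈ s, |y k| := Finset.sum_nonneg fun k _ => abs_nonneg _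
          nlinarith [abs_nonneg (y k), mul_nonneg (abs_nonneg (y k)) h13]
      linarith [h12 Finset.univ]
    have h11 : S ≤ (∑ k, |y k|) ^ 2 := by
      have := Finset.sum_sq_le_sq_sum_of_nonneg (s := Finset.univ) (f := fun k => |y k|)
        (fun k _ => abs_nonneg _)
      simpa [hS] using this
    refine h11.trans ?_
    have : 0 ≤ ∑ k, |y k| := Finset.sum_nonneg fun k _ => abs_nonneg _
    gcongr
  calc √S ≤ √((∏ k, (1 + |y k|)) ^ 2) := Real.sqrt_le_sqrt h9
    _ = _ := Real.sqrt_sq (Finset.prod_nonneg fun k _ => by positivity)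

variable {k d : ℕ} {Ω : Type*}

/-- The occupation density of `X` on `(-∞, z] ∩ [a, b]`, mollified at scale `2^{-m}`. -/
def occDensity (X : (Fin k → ℝ) → Ω → EuclideanSpace ℝ (Fin d)) (a b : Fin k → ℝ) (m : ℕ)
    (v : EuclideanSpace ℝ (Fin d)) (z : Fin k → ℝ) (ω : Ω) : ℝ :=
  ∫ w in Set.Iic z ∩ Set.Icc a b, mollifier m (X w ω - v)

theorem occDensity_nonneg (X : (Fin k → ℝ) → Ω → EuclideanSpace ℝ (Fin d)) (a b : Fin k → ℝ) (m : ℕ)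
    (v : EuclideanSpace ℝ (Fin d)) (z : Fin k → ℝ) (ω : Ω) : 0 ≤ occDensity X a b m v z ω :=
  integral_nonneg fun _ => mollifier_nonneg _ _

/-- Fourier integrand of the difference of two consecutive mollified occupation densities. -/
def occIntegrand (X : (Fin k → ℝ) → Ω → EuclideanSpace ℝ (Fin d)) (m : ℕ)
    (v : EuclideanSpace ℝ (Fin d)) (ω : Ω) (x : (Fin k → ℝ) × (Fin d → ℝ)) : ℂ :=
  (((2 * Real.pi)⁻¹ ^ d * (mollifierFourier (m + 1) x.2 - mollifierFourier m x.2) : ℝ) : ℂ) *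
    Complex.exp (((∑ j, x.2 j * (X x.1 ω j - v j) : ℝ) : ℂ) * Complex.I)

theorem norm_occIntegrand (X : (Fin k → ℝ) → Ω → EuclideanSpace ℝ (Fin d)) (m : ℕ)
    (v : EuclideanSpace ℝ (Fin d)) (ω : Ω) (x : (Fin k → ℝ) × (Fin d → ℝ)) :
    ‖occIntegrand X m v ω x‖ =
      (2 * Real.pi)⁻¹ ^ d * |mollifierFourier (m + 1) x.2 - mollifierFourier m x.2| := by
  unfold occIntegrand
  rw [norm_mul, Complex.norm_exp_ofReal_mul_I, mul_one, Complex.norm_real, Real.norm_eq_abs, abs_mul,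
    abs_of_nonneg (by positivity)]

theorem prod_occIntegrand {n : ℕ} (X : (Fin k → ℝ) → Ω → EuclideanSpace ℝ (Fin d)) (m : ℕ)
    (v : EuclideanSpace ℝ (Fin d)) (ω : Ω) (x : Fin n → (Fin k → ℝ) × (Fin d → ℝ)) :
    ∏ j, occIntegrand X m v ω (x j) =
      ((∏ j, (((2 * Real.pi)⁻¹ ^ d * (mollifierFourier (m + 1) (x j).2 -
        mollifierFourier m (x j).2) : ℝ) : ℂ)) *
      Complex.exp (((-∑ j, ∑ i, (x j).2 i * v i : ℝ) : ℂ) * Complex.I)) *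
      Complex.exp (((∑ j, ∑ i, (x j).2 i * X (x j).1 ω i : ℝ) : ℂ) * Complex.I) := by
  unfold occIntegrand
  rw [Finset.prod_mul_distrib, mul_assoc, ← Complex.exp_add, ← Complex.exp_sum, ← add_mul,
    ← Finset.sum_mul, ← Complex.ofReal_sum, ← Complex.ofReal_add]
  congr 4
  rw [← Finset.sum_neg_distrib, ← Finset.sum_add_distrib]
  refine Finset.sum_congr rfl fun j _ => ?_
  rw [← Finset.sum_neg_distrib, ← Finset.sum_add_distrib]
  refine Finset.sum_congr rfl fun i _ => ?_
  ring

variable [MeasurableSpace Ω]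

theorem measurable_occDensity {X : (Fin k → ℝ) → Ω → EuclideanSpace ℝ (Fin d)}
    (hX : Measurable fun p : (Fin k → ℝ) × Ω => X p.1 p.2) (a b : Fin k → ℝ) (m : ℕ)
    (z : Fin k → ℝ) :
    Measurable fun p : EuclideanSpace ℝ (Fin d) × Ω => occDensity X a b m p.1 z p.2 := by
  have h : StronglyMeasurable fun q : (EuclideanSpace ℝ (Fin d) × Ω) × (Fin k → ℝ) =>
      mollifier m (X q.2 q.1.2 - q.1.1) := by
    refine Measurable.stronglyMeasurable ?_
    refine (continuous_mollifier m).measurable.comp ?_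
    exact (hX.comp (by fun_prop : Measurable fun q : (EuclideanSpace ℝ (Fin d) × Ω) × (Fin k → ℝ) =>
      (q.2, q.1.2))).sub (by fun_prop)
  exact h.integral_prod_right.measurable

theorem isFiniteMeasure_restrict_Iic_inter_Icc (z a b : Fin k → ℝ) :
    IsFiniteMeasure ((volume : Measure (Fin k → ℝ)).restrict (Set.Iic z ∩ Set.Icc a b)) := by
  refine isFiniteMeasure_restrict.2 (ne_top_of_le_ne_top ?_ (measure_mono Set.inter_subset_right))
  exact isCompact_Icc.measure_lt_top.ne

theorem measurable_section {X : (Fin k → ℝ) → Ω → EuclideanSpace ℝ (Fin d)}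
    (hX : Measurable fun p : (Fin k → ℝ) × Ω => X p.1 p.2) (ω : Ω) : Measurable fun w => X w ω :=
  hX.comp measurable_prodMk_right

theorem integrable_mollifier_comp {X : (Fin k → ℝ) → Ω → EuclideanSpace ℝ (Fin d)}
    (hX : Measurable fun p : (Fin k → ℝ) × Ω => X p.1 p.2) (m : ℕ)
    (v : EuclideanSpace ℝ (Fin d)) (ω : Ω) (μ : Measure (Fin k → ℝ)) [IsFiniteMeasure μ] :
    Integrable (fun w => mollifier m (X w ω - v)) μ := by
  refine Integrable.of_bound (C := 2 ^ (m * d)) ?_ (ae_of_all _ fun w => ?_)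
  · exact ((continuous_mollifier m).measurable.comp
      ((measurable_section hX ω).sub_const v)).aestronglyMeasurable
  · rw [Real.norm_of_nonneg (mollifier_nonneg _ _)]
    exact mollifier_le _ _

theorem measurable_occIntegrand {X : (Fin k → ℝ) → Ω → EuclideanSpace ℝ (Fin d)}
    (hX : Measurable fun p : (Fin k → ℝ) × Ω => X p.1 p.2) (m : ℕ)
    (v : EuclideanSpace ℝ (Fin d)) :
    Measurable fun q : Ω × ((Fin k → ℝ) × (Fin d → ℝ)) => occIntegrand X m v q.1 q.2 := by
  unfold occIntegrand
  have h1 : ∀ m, Measurable fun q : Ω × ((Fin k → ℝ) × (Fin d → ℝ)) => mollifierFourier m q.2.2 :=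
    fun m => (continuous_mollifierFourier m).measurable.comp (by fun_prop)
  have h2 : ∀ j, Measurable fun q : Ω × ((Fin k → ℝ) × (Fin d → ℝ)) => X q.2.1 q.1 j := by
    intro j
    have h3 : Measurable fun q : Ω × ((Fin k → ℝ) × (Fin d → ℝ)) => X q.2.1 q.1 :=
      hX.comp (by fun_prop : Measurable fun q : Ω × ((Fin k → ℝ) × (Fin d → ℝ)) => (q.2.1, q.1))
    have h4 : Continuous fun x : EuclideanSpace ℝ (Fin d) => x j := by fun_prop
    exact h4.measurable.comp h3
  fun_prop

theorem integrable_norm_occIntegrand_bound (μ : Measure (Fin k → ℝ)) [IsFiniteMeasure μ] (m : ℕ) :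
    Integrable (fun x : (Fin k → ℝ) × (Fin d → ℝ) => (2 * Real.pi)⁻¹ ^ d *
      |mollifierFourier (m + 1) x.2 - mollifierFourier m x.2|) (μ.prod volume) :=
  ((((integrable_mollifierFourier (m + 1)).sub (integrable_mollifierFourier m)).abs.const_mul
    ((2 * Real.pi)⁻¹ ^ d)).comp_snd μ)

theorem integrable_occIntegrand {X : (Fin k → ℝ) → Ω → EuclideanSpace ℝ (Fin d)}
    (hX : Measurable fun p : (Fin k → ℝ) × Ω => X p.1 p.2) (m : ℕ)
    (v : EuclideanSpace ℝ (Fin d)) (ω : Ω) (μ : Measure (Fin k → ℝ)) [IsFiniteMeasure μ] :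
    Integrable (occIntegrand X m v ω) (μ.prod volume) := by
  refine (integrable_norm_occIntegrand_bound μ m).mono'
    ((measurable_occIntegrand hX m v).comp measurable_prodMk_left).aestronglyMeasurable
    (ae_of_all _ fun x => (norm_occIntegrand X m v ω x).le)

theorem occDensity_sub_eq_integral {X : (Fin k → ℝ) → Ω → EuclideanSpace ℝ (Fin d)}
    (hX : Measurable fun p : (Fin k → ℝ) × Ω => X p.1 p.2) (a b : Fin k → ℝ) (m : ℕ)
    (v : EuclideanSpace ℝ (Fin d)) (z : Fin k → ℝ) (ω : Ω) :
    ((occDensity X a b (m + 1) v z ω - occDensity X a b m v z ω : ℝ) : ℂ) =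
      ∫ x, occIntegrand X m v ω x
        ∂(((volume : Measure (Fin k → ℝ)).restrict (Set.Iic z ∩ Set.Icc a b)).prod volume) := by
  have := isFiniteMeasure_restrict_Iic_inter_Icc z a b
  rw [integral_prod _ (integrable_occIntegrand hX m v ω _)]
  unfold occDensity
  rw [← integral_sub (integrable_mollifier_comp hX (m + 1) v ω _)
    (integrable_mollifier_comp hX m v ω _), ← integral_complex_ofReal]
  refine integral_congr_ae (ae_of_all _ fun w => ?_)
  simp only [Complex.ofReal_sub]
  rw [mollifier_eq_integral, mollifier_eq_integral, ← integral_sub]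
  · refine integral_congr_ae (ae_of_all _ fun y => ?_)
    simp only [occIntegrand, PiLp.sub_apply]
    push_cast; ring
  all_goals
    refine Integrable.mul_bdd (c := 1) (((integrable_mollifierFourier _).const_mul _).ofReal)
      (Continuous.aestronglyMeasurable (by fun_prop)) (ae_of_all _ fun y => ?_)
    rw [Complex.norm_exp_ofReal_mul_I]

/-- The weighted integral of the characteristic functions of the finite-dimensional distributions
of `X` that controls the moments of the increments of local time. -/
def charMoment (P : Measure Ω) (X : (Fin k → ℝ) → Ω → EuclideanSpace ℝ (Fin d)) (a b : Fin k → ℝ)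
    (γ : ℝ) (n : ℕ) : ℝ≥0∞ :=
  ∫⁻ w : Fin n → Fin k → ℝ, (∫⁻ y : Fin n → Fin d → ℝ,
    (∏ j, ∏ i, ENNReal.ofReal ((1 + |y j i|) ^ γ)) *
      ‖∫ ω, Complex.exp (((∑ j, ∑ i, y j i * X (w j) ω i : ℝ) : ℂ) * Complex.I) ∂P‖ₑ)
    ∂(Measure.pi fun _ => (volume : Measure (Fin k → ℝ)).restrict (Set.Icc a b))

theorem measurable_charFun_fdd {n : ℕ} {P : Measure Ω} [IsProbabilityMeasure P]
    {X : (Fin k → ℝ) → Ω → EuclideanSpace ℝ (Fin d)}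
    (hX : Measurable fun p : (Fin k → ℝ) × Ω => X p.1 p.2) :
    Measurable fun x : (Fin n → Fin k → ℝ) × (Fin n → Fin d → ℝ) =>
      ∫ ω, Complex.exp (((∑ j, ∑ i, x.2 j i * X (x.1 j) ω i : ℝ) : ℂ) * Complex.I) ∂P := by
  have h2 : ∀ j i, Measurable fun q : ((Fin n → Fin k → ℝ) × (Fin n → Fin d → ℝ)) × Ω =>
      X (q.1.1 j) q.2 i := by
    intro j i
    have h3 : Measurable fun q : ((Fin n → Fin k → ℝ) × (Fin n → Fin d → ℝ)) × Ω => X (q.1.1 j) q.2 :=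
      hX.comp (by fun_prop : Measurable
        fun q : ((Fin n → Fin k → ℝ) × (Fin n → Fin d → ℝ)) × Ω => (q.1.1 j, q.2))
    have h4 : Continuous fun x : EuclideanSpace ℝ (Fin d) => x i := by fun_prop
    exact h4.measurable.comp h3
  have h : Measurable fun q : ((Fin n → Fin k → ℝ) × (Fin n → Fin d → ℝ)) × Ω =>
      Complex.exp (((∑ j, ∑ i, q.1.2 j i * X (q.1.1 j) q.2 i : ℝ) : ℂ) * Complex.I) := by
    fun_prop
  exact h.stronglyMeasurable.integral_prod_right.measurable

/-- Even moments of the difference of consecutive mollified occupation densities. -/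
theorem lintegral_occDensity_sub_pow_le {P : Measure Ω} [IsProbabilityMeasure P]
    {X : (Fin k → ℝ) → Ω → EuclideanSpace ℝ (Fin d)}
    (hX : Measurable fun p : (Fin k → ℝ) × Ω => X p.1 p.2) (a b : Fin k → ℝ) {γ : ℝ} (hγ : 0 < γ)
    (hγ1 : γ ≤ 1) {n : ℕ} (hn : Even n) (m : ℕ) (v : EuclideanSpace ℝ (Fin d)) (z : Fin k → ℝ) :
    ∫⁻ ω, ENNReal.ofReal ((occDensity X a b (m + 1) v z ω - occDensity X a b m v z ω) ^ n) ∂P ≤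
      ENNReal.ofReal (((2 : ℝ) ^ (-γ)) ^ m) ^ n * charMoment P X a b γ n := by
  set μ : Measure (Fin k → ℝ) := volume.restrict (Set.Iic z ∩ Set.Icc a b) with hμ
  have : IsFiniteMeasure μ := isFiniteMeasure_restrict_Iic_inter_Icc z a b
  set r : Ω → ℝ := fun ω => occDensity X a b (m + 1) v z ω - occDensity X a b m v z ω with hr
  set lam : Measure ((Fin k → ℝ) × (Fin d → ℝ)) := μ.prod volume with hlam
  have hprodm : Measurable fun q : Ω × (Fin n → (Fin k → ℝ) × (Fin d → ℝ)) =>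
      ∏ j, occIntegrand X m v q.1 (q.2 j) := by
    refine Finset.measurable_prod _ fun j _ => ?_
    have h := (measurable_occIntegrand hX m v).comp
      (by fun_prop : Measurable fun q : Ω × (Fin n → (Fin k → ℝ) × (Fin d → ℝ)) => (q.1, q.2 j))
    simpa only [Function.comp_def] using h
  have hpi : Integrable (fun q : Ω × (Fin n → (Fin k → ℝ) × (Fin d → ℝ)) =>
      ∏ j, occIntegrand X m v q.1 (q.2 j)) (P.prod (Measure.pi fun _ => lam)) := by
    have h1 : Integrable (fun x : Fin n → (Fin k → ℝ) × (Fin d → ℝ) => ∏ j, ((2 * Real.pi)⁻¹ ^ d *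
        |mollifierFourier (m + 1) (x j).2 - mollifierFourier m (x j).2|))
        (Measure.pi fun _ => lam) :=
      Integrable.fintype_prod fun _ => integrable_norm_occIntegrand_bound μ m
    refine (h1.comp_snd P).mono' hprodm.aestronglyMeasurable (ae_of_all _ fun q => ?_)
    rw [norm_prod]
    exact (Finset.prod_congr rfl fun j _ => norm_occIntegrand X m v q.1 (q.2 j)).le
  have hpow : ∀ ω, ((r ω ^ n : ℝ) : ℂ) =
      ∫ x : Fin n → (Fin k → ℝ) × (Fin d → ℝ), ∏ j, occIntegrand X m v ω (x j)
        ∂(Measure.pi fun _ => lam) := by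
    intro ω
    rw [integral_fintype_prod_eq_pow, Fintype.card_fin, Complex.ofReal_pow, hr]
    congr 1
    exact occDensity_sub_eq_integral hX a b m v z ω
  have hri : Integrable (fun ω => ((r ω ^ n : ℝ) : ℂ)) P := by
    simp_rw [hpow]
    exact hpi.integral_prod_left
  have hri' : Integrable (fun ω => r ω ^ n) P := by
    have := hri.re
    simpa only [RCLike.re_to_complex, Complex.ofReal_re] using this
  rw [← ofReal_integral_eq_lintegral_ofReal hri' (ae_of_all _ fun ω => hn.pow_nonneg _)]
  have h1 : ENNReal.ofReal (∫ ω, r ω ^ n ∂P) = ‖∫ ω, ((r ω ^ n : ℝ) : ℂ) ∂P‖ₑ := by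
    rw [integral_complex_ofReal, ← ofReal_norm, Complex.norm_real,
      Real.norm_of_nonneg (integral_nonneg fun ω => hn.pow_nonneg _)]
  rw [h1]
  simp_rw [hpow]
  rw [integral_integral_swap hpi]
  refine (enorm_integral_le_lintegral_enorm _).trans ?_
  have hcf := measurable_charFun_fdd (n := n) (P := P) hX
  have hpt : ∀ x : Fin n → (Fin k → ℝ) × (Fin d → ℝ),
      ‖∫ ω, ∏ j, occIntegrand X m v ω (x j) ∂P‖ₑ ≤ ENNReal.ofReal (((2 : ℝ) ^ (-γ)) ^ m) ^ n *
      ((∏ j, ∏ i, ENNReal.ofReal ((1 + |(x j).2 i|) ^ γ)) *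
      ‖∫ ω, Complex.exp (((∑ j, ∑ i, (x j).2 i * X (x j).1 ω i : ℝ) : ℂ) * Complex.I) ∂P‖ₑ) := by
    intro x
    simp_rw [prod_occIntegrand]
    rw [integral_const_mul, enorm_mul, ← mul_assoc]
    gcongr
    rw [enorm_mul, ← ofReal_norm, ← ofReal_norm, Complex.norm_exp_ofReal_mul_I,
      ENNReal.ofReal_one, mul_one, norm_prod, ENNReal.ofReal_prod_of_nonneg
      (fun _ _ => norm_nonneg _)]
    have h2 : ENNReal.ofReal (((2 : ℝ) ^ (-γ)) ^ m) ^ n =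
        ∏ _j : Fin n, ENNReal.ofReal (((2 : ℝ) ^ (-γ)) ^ m) := by simp
    rw [h2, ← Finset.prod_mul_distrib]
    refine Finset.prod_le_prod' fun j _ => ?_
    rw [← ENNReal.ofReal_prod_of_nonneg (fun i _ => by positivity),
      ← ENNReal.ofReal_mul (by positivity)]
    refine ENNReal.ofReal_le_ofReal ?_
    rw [Complex.norm_real, Real.norm_eq_abs, abs_mul, abs_of_nonneg (by positivity)]
    refine (mul_le_of_le_one_left (abs_nonneg _) ?_).trans
      (abs_mollifierFourier_sub_le m hγ hγ1 _)
    refine pow_le_one₀ (by positivity) (inv_le_one_of_one_le₀ ?_)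
    linarith [Real.pi_gt_three]
  refine (lintegral_mono hpt).trans ?_
  have hGm : Measurable fun x : (Fin n → Fin k → ℝ) × (Fin n → Fin d → ℝ) =>
      (∏ j, ∏ i, ENNReal.ofReal ((1 + |x.2 j i|) ^ γ)) *
      ‖∫ ω, Complex.exp (((∑ j, ∑ i, x.2 j i * X (x.1 j) ω i : ℝ) : ℂ) * Complex.I) ∂P‖ₑ := by
    fun_prop
  have hmp := measurePreserving_arrowProdEquivProdArrow (Fin k → ℝ) (Fin d → ℝ) (Fin n)
    (fun _ => μ) (fun _ => volume)
  rw [lintegral_const_mul' _ _ (ENNReal.pow_ne_top ENNReal.ofReal_ne_top)]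
  gcongr
  have h3 := hmp.lintegral_comp hGm
  refine h3.le.trans ?_
  rw [lintegral_prod _ hGm.aemeasurable]
  unfold charMoment
  refine lintegral_mono' ?_ le_rfl
  rw [← Measure.restrict_pi_pi, ← Measure.restrict_pi_pi]
  exact Measure.restrict_mono (Set.pi_mono fun _ _ => Set.inter_subset_right) le_rfl

section Grid

variable {ι : Type*}

/-- Points of a regular grid in the box `[p, q]`. -/
def gridPoint (p q : ι → ℝ) (M : ℕ) (g : ι → Fin (M + 1)) (i : ι) : ℝ :=
  p i + (q i - p i) * ((g i : ℕ) / M)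

theorem gridPoint_mem {p q : ι → ℝ} (hpq : p ≤ q) {M : ℕ} (hM : 0 < M) (g : ι → Fin (M + 1)) :
    gridPoint p q M g ∈ Set.Icc p q := by
  have hM' : (0 : ℝ) < M := by exact_mod_cast hM
  have h1 : ∀ i, ((g i : ℕ) : ℝ) / M ≤ 1 := fun i => by
    rw [div_le_one hM']
    exact_mod_cast Nat.lt_succ_iff.1 (g i).2
  have h0 : ∀ i, (0 : ℝ) ≤ ((g i : ℕ) : ℝ) / M := fun i => by positivity
  refine ⟨fun i => ?_, fun i => ?_⟩
  · have := mul_nonneg (sub_nonneg.2 (hpq i)) (h0 i)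
    simp only [gridPoint]; linarith
  · have := mul_le_mul_of_nonneg_left (h1 i) (sub_nonneg.2 (hpq i))
    simp only [gridPoint]; linarith

theorem exists_gridPoint_dist_le [Fintype ι] {p q : ι → ℝ} (hpq : p ≤ q) {M : ℕ} (hM : 0 < M) {x : ι → ℝ}
    (hx : x ∈ Set.Icc p q) : ∃ g : ι → Fin (M + 1), dist x (gridPoint p q M g) ≤ dist p q / M := by
  have hM' : (0 : ℝ) < M := by exact_mod_cast hM
  have key : ∀ i, ∃ j : Fin (M + 1), |x i - (p i + (q i - p i) * ((j : ℕ) / M))| ≤ dist p q / M := by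
    intro i
    have hd : q i - p i ≤ dist p q := by
      have := dist_le_pi_dist p q i
      rw [Real.dist_eq, abs_sub_comm] at this
      exact (le_abs_self _).trans this
    have hx1 := hx.1 i
    have hx2 := hx.2 i
    rcases (hpq i).eq_or_lt with h | h
    · refine ⟨0, ?_⟩
      have : x i = p i := le_antisymm (h ▸ hx2) hx1
      simp [this]
      positivity
    · have hpos : 0 < q i - p i := sub_pos.2 h
      set y := (x i - p i) / (q i - p i) with hy
      have hy0 : 0 ≤ y := div_nonneg (by linarith) hpos.le
      have hy1 : y ≤ 1 := (div_le_one hpos).2 (by linarith)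
      have hfl : ⌊y * M⌋₊ < M + 1 := by
        have : ⌊y * M⌋₊ ≤ M := by
          refine Nat.floor_le_of_le ?_
          nlinarith
        omega
      refine ⟨⟨⌊y * M⌋₊, hfl⟩, ?_⟩
      have hxy : x i = p i + (q i - p i) * y := by rw [hy]; field_simp; ring
      have h1 : (⌊y * M⌋₊ : ℝ) ≤ y * M := Nat.floor_le (by positivity)
      have h2 : y * M < ⌊y * M⌋₊ + 1 := Nat.lt_floor_add_one _
      have h3 : x i - (p i + (q i - p i) * ((⌊y * M⌋₊ : ℝ) / M)) =
          (q i - p i) * ((y * M - ⌊y * M⌋₊) / M) := by rw [hxy]; field_simp; ring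
      simp only [h3]
      rw [abs_of_nonneg (mul_nonneg hpos.le (div_nonneg (by linarith) hM'.le)), ← mul_div_assoc]
      gcongr
      nlinarith
  choose g hg using key
  refine ⟨g, (dist_pi_le_iff (by positivity)).2 fun i => ?_⟩
  rw [Real.dist_eq]
  exact hg i

end Grid

section Chaining

variable {ι Ω : Type*} [Fintype ι] [DecidableEq ι] [MeasurableSpace Ω]

/-- A moment bound that decays geometrically, together with a Lipschitz bound that grows at most
geometrically, gives a geometrically decaying uniform bound over a box, almost surely. -/
theorem ae_eventually_forall_abs_le {P : Measure Ω} {D : ℕ → (ι → ℝ) → Ω → ℝ} {p q : ι → ℝ}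
    (hpq : p ≤ q) (hD : ∀ m x, Measurable (D m x)) {C : ℝ} {K : ℕ} (hK : 0 < K)
    (hlip : ∀ m ω, ∀ x ∈ Set.Icc p q, ∀ y ∈ Set.Icc p q,
      |D m x ω - D m y ω| ≤ C * K ^ m * dist x y)
    {s : ℝ} (hs0 : 0 < s) (hs1 : s < 1)
    (hmom : ∀ n, Even n → 0 < n → ∃ A : ℝ≥0∞, A ≠ ⊤ ∧ ∀ m x,
      ∫⁻ ω, ENNReal.ofReal (D m x ω ^ n) ∂P ≤ ENNReal.ofReal ((s ^ 2) ^ m) ^ n * A) :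
    ∀ᵐ ω ∂P, ∀ᶠ m in atTop, ∀ x ∈ Set.Icc p q,
      |D m x ω| ≤ s ^ m + |C| * dist p q * (1 / 2) ^ m := by
  have hM0 : ∀ m : ℕ, 0 < (2 * K) ^ m := fun m => by positivity
  set J : ℕ := Fintype.card ι with hJ
  set B : ℕ := (2 * K) ^ J with hB
  have hB0 : (0 : ℝ) < B := by rw [hB]; positivity
  obtain ⟨n₀, hn₀⟩ := exists_pow_lt_of_lt_one (show (0 : ℝ) < 1 / (2 * B) by positivity) hs1
  set n := 2 * (n₀ + 1) with hn
  have hsn : s ^ n * B ≤ 1 / 2 := by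
    have : s ^ n ≤ s ^ n₀ := pow_le_pow_of_le_one hs0.le hs1.le (by omega)
    have h2 : s ^ n ≤ 1 / (2 * B) := this.trans hn₀.le
    calc s ^ n * B ≤ 1 / (2 * B) * B := by gcongr
      _ = 1 / 2 := by field_simp
  obtain ⟨A, hA, hAm⟩ := hmom n ⟨n₀ + 1, by omega⟩ (by omega)
  set bad : ℕ → Set Ω := fun m => ⋃ g : ι → Fin ((2 * K) ^ m + 1),
    {ω | s ^ m ≤ |D m (gridPoint p q ((2 * K) ^ m) g) ω|} with hbad
  have hone : ∀ m x, P {ω | s ^ m ≤ |D m x ω|} ≤ ENNReal.ofReal ((s ^ n) ^ m) * A := by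
    intro m x
    have hpos : (0 : ℝ) < (s ^ m) ^ n := by positivity
    have h1 : {ω | s ^ m ≤ |D m x ω|} ⊆
        {ω | ENNReal.ofReal ((s ^ m) ^ n) ≤ ENNReal.ofReal (D m x ω ^ n)} := by
      intro ω hω
      refine ENNReal.ofReal_le_ofReal ?_
      rw [← Even.pow_abs (show Even n from ⟨n₀ + 1, by omega⟩) (D m x ω)]
      exact pow_le_pow_left₀ (by positivity) hω n
    have h2 := mul_meas_ge_le_lintegral (μ := P) (f := fun ω => ENNReal.ofReal (D m x ω ^ n))
      (((hD m x).pow_const n).ennreal_ofReal) (ENNReal.ofReal ((s ^ m) ^ n))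
    have h3 := (h2.trans (hAm m x))
    have h4 : ENNReal.ofReal ((s ^ 2) ^ m) ^ n * A =
        ENNReal.ofReal ((s ^ m) ^ n) * (ENNReal.ofReal ((s ^ n) ^ m) * A) := by
      rw [← ENNReal.ofReal_pow (by positivity), ← mul_assoc, ← ENNReal.ofReal_mul hpos.le]
      congr 2
      ring
    rw [h4, ENNReal.mul_le_mul_iff_right (ENNReal.ofReal_pos.2 hpos).ne' ENNReal.ofReal_ne_top]
      at h3
    exact (measure_mono h1).trans h3
  have hbadle : ∀ m, P (bad m) ≤ (2 ^ J * A) * (2⁻¹ : ℝ≥0∞) ^ m := by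
    intro m
    have hcard : (Fintype.card (ι → Fin ((2 * K) ^ m + 1)) : ℝ≥0∞) ≤ 2 ^ J * (B : ℝ≥0∞) ^ m := by
      have : Fintype.card (ι → Fin ((2 * K) ^ m + 1)) ≤ 2 ^ J * B ^ m := by
        rw [Fintype.card_fun, Fintype.card_fin, ← hJ, hB, ← pow_mul, mul_comm J m, pow_mul,
          ← mul_pow]
        have := hM0 m
        exact Nat.pow_le_pow_left (by omega) _
      exact_mod_cast this
    calc P (bad m) ≤ ∑ g : ι → Fin ((2 * K) ^ m + 1),
          P {ω | s ^ m ≤ |D m (gridPoint p q ((2 * K) ^ m) g) ω|} :=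
          measure_iUnion_fintype_le _ _
      _ ≤ ∑ _g : ι → Fin ((2 * K) ^ m + 1), ENNReal.ofReal ((s ^ n) ^ m) * A :=
          Finset.sum_le_sum fun g _ => hone m _
      _ = Fintype.card (ι → Fin ((2 * K) ^ m + 1)) * (ENNReal.ofReal ((s ^ n) ^ m) * A) := by
          rw [Finset.sum_const, Finset.card_univ, nsmul_eq_mul]
      _ ≤ (2 ^ J * (B : ℝ≥0∞) ^ m) * (ENNReal.ofReal ((s ^ n) ^ m) * A) := by gcongr
      _ = (2 ^ J * A) * (ENNReal.ofReal (s ^ n * B)) ^ m := by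
          rw [ENNReal.ofReal_mul (by positivity), ENNReal.ofReal_natCast,
            ENNReal.ofReal_pow (by positivity : 0 ≤ s ^ n), mul_pow]
          ring
      _ ≤ (2 ^ J * A) * (2⁻¹ : ℝ≥0∞) ^ m := by
          gcongr
          refine (ENNReal.ofReal_le_ofReal hsn).trans_eq ?_
          rw [one_div, ENNReal.ofReal_inv_of_pos (by norm_num)]
          simp
  have hsum : ∑' m, P (bad m) ≠ ⊤ := by
    refine ne_top_of_le_ne_top ?_ (ENNReal.tsum_le_tsum hbadle)
    rw [ENNReal.tsum_mul_left, ENNReal.tsum_geometric]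
    refine ENNReal.mul_ne_top (ENNReal.mul_ne_top (by simp) hA) ?_
    simp
  filter_upwards [ae_eventually_notMem hsum] with ω hω
  filter_upwards [hω] with m hm x hx
  obtain ⟨g, hg⟩ := exists_gridPoint_dist_le hpq (hM0 m) hx
  have h1 : |D m (gridPoint p q ((2 * K) ^ m) g) ω| < s ^ m := by
    by_contra hcon
    exact hm (Set.mem_iUnion.2 ⟨g, not_lt.1 hcon⟩)
  have h2 := hlip m ω x hx _ (gridPoint_mem hpq (hM0 m) g)
  have h3 : C * K ^ m * dist x (gridPoint p q ((2 * K) ^ m) g) ≤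
      |C| * dist p q * (1 / 2) ^ m := by
    calc C * K ^ m * dist x (gridPoint p q ((2 * K) ^ m) g)
        ≤ |C| * K ^ m * (dist p q / ((2 * K) ^ m : ℕ)) := by
          gcongr
          exact le_abs_self C
      _ = |C| * dist p q * (1 / 2) ^ m := by
          have : (K : ℝ) ≠ 0 := by exact_mod_cast hK.ne'
          push_cast
          rw [mul_pow, div_pow, one_pow]
          field_simp
  have h4 := abs_sub_abs_le_abs_sub (D m x ω) (D m (gridPoint p q ((2 * K) ^ m) g) ω)
  linarith

end Chaining

section Lipschitz

variable {k d : ℕ} {Ω : Type*} [MeasurableSpace Ω]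

theorem volume_slab_le {a b : Fin k → ℝ} (hab : a ≤ b) (i : Fin k) (r s : ℝ) :
    volume (Set.Icc a b ∩ {w | w i ∈ Set.uIcc r s}) ≤
      ENNReal.ofReal (|r - s| * ∏ j, (1 + (b j - a j))) := by
  have hsub : Set.Icc a b ∩ {w | w i ∈ Set.uIcc r s} ⊆
      Set.univ.pi (Function.update (fun j => Set.Icc (a j) (b j)) i (Set.uIcc r s)) := by
    rintro w ⟨hw, hwi⟩ j -
    rcases eq_or_ne j i with rfl | hj
    · simpa using hwi
    · simpa [hj] using ⟨hw.1 j, hw.2 j⟩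
  have hnn : ∀ j, 0 ≤ b j - a j := fun j => sub_nonneg.2 (hab j)
  refine (measure_mono hsub).trans ?_
  rw [volume_pi_pi, Fintype.prod_eq_mul_prod_compl i, Function.update_self, Real.volume_interval,
    ENNReal.ofReal_mul (abs_nonneg _), abs_sub_comm]
  gcongr
  rw [ENNReal.ofReal_prod_of_nonneg (fun j _ => by linarith [hnn j])]
  calc ∏ j ∈ {i}ᶜ, volume (Function.update (fun j => Set.Icc (a j) (b j)) i (Set.uIcc r s) j)
      ≤ ∏ j ∈ {i}ᶜ, ENNReal.ofReal (1 + (b j - a j)) := by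
        refine Finset.prod_le_prod' fun j hj => ?_
        rw [Function.update_of_ne (by simpa using hj), Real.volume_Icc]
        exact ENNReal.ofReal_le_ofReal (by linarith)
    _ ≤ ∏ j, ENNReal.ofReal (1 + (b j - a j)) :=
        Finset.prod_le_prod_of_subset_of_one_le' (Finset.subset_univ _) fun j _ _ => by
          rw [← ENNReal.ofReal_one]
          exact ENNReal.ofReal_le_ofReal (by linarith [hnn j])

theorem abs_occDensity_sub_left_le {X : (Fin k → ℝ) → Ω → EuclideanSpace ℝ (Fin d)}
    (hX : Measurable fun p : (Fin k → ℝ) × Ω => X p.1 p.2) (a b : Fin k → ℝ) (m : ℕ)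
    (v v' : EuclideanSpace ℝ (Fin d)) (z : Fin k → ℝ) (ω : Ω) :
    |occDensity X a b m v z ω - occDensity X a b m v' z ω| ≤
      2 ^ (m * (d + 1)) * ‖v - v'‖ * volume.real (Set.Icc a b) := by
  have hfin : volume (Set.Icc a b) ≠ ⊤ := isCompact_Icc.measure_lt_top.ne
  have := isFiniteMeasure_restrict_Iic_inter_Icc z a b
  unfold occDensity
  rw [← integral_sub (integrable_mollifier_comp hX m v ω _) (integrable_mollifier_comp hX m v' ω _)]
  have hb : ∀ w ∈ Set.Iic z ∩ Set.Icc a b,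
      ‖mollifier m (X w ω - v) - mollifier m (X w ω - v')‖ ≤ 2 ^ (m * (d + 1)) * ‖v - v'‖ := by
    intro w _
    rw [Real.norm_eq_abs]
    refine (abs_mollifier_sub_le _ _ _).trans_eq ?_
    rw [sub_sub_sub_cancel_left, norm_sub_rev]
  refine (norm_setIntegral_le_of_norm_le_const
    (measure_lt_top_of_subset Set.inter_subset_right hfin) hb).trans ?_
  gcongr
  exact Set.inter_subset_right

theorem abs_occDensity_sub_right_le {X : (Fin k → ℝ) → Ω → EuclideanSpace ℝ (Fin d)}
    (hX : Measurable fun p : (Fin k → ℝ) × Ω => X p.1 p.2) {a b : Fin k → ℝ} (hab : a ≤ b) (m : ℕ)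
    (v : EuclideanSpace ℝ (Fin d)) (z z' : Fin k → ℝ) (ω : Ω) :
    |occDensity X a b m v z ω - occDensity X a b m v z' ω| ≤
      2 ^ (m * d) * (k * (dist z z' * ∏ j, (1 + (b j - a j)))) := by
  have hfin : volume (Set.Icc a b) ≠ ⊤ := isCompact_Icc.measure_lt_top.ne
  have hprod : 0 ≤ ∏ j, (1 + (b j - a j)) :=
    Finset.prod_nonneg fun j _ => by linarith [hab j]
  have : IsFiniteMeasure ((volume : Measure (Fin k → ℝ)).restrict (Set.Icc a b)) :=
    isFiniteMeasure_restrict.2 hfin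
  have hint := integrable_mollifier_comp hX m v ω (volume.restrict (Set.Icc a b))
  have hrw : ∀ z, occDensity X a b m v z ω = ∫ w in Set.Icc a b,
      (Set.Iic z).indicator (fun w => mollifier m (X w ω - v)) w := fun z => by
    rw [integral_indicator measurableSet_Iic, Measure.restrict_restrict measurableSet_Iic, occDensity]
  rw [hrw, hrw, ← integral_sub (hint.indicator measurableSet_Iic) (hint.indicator measurableSet_Iic)]
  set S : Fin k → Set (Fin k → ℝ) := fun i => {w | w i ∈ Set.uIcc (z i) (z' i)} with hS
  have hSm : ∀ i, MeasurableSet (S i) := fun i => measurable_pi_apply i measurableSet_uIcc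
  have hbound : ∀ w, ‖(Set.Iic z).indicator (fun w => mollifier m (X w ω - v)) w -
      (Set.Iic z').indicator (fun w => mollifier m (X w ω - v)) w‖ ≤
      ∑ i, (S i).indicator (fun _ => (2 : ℝ) ^ (m * d)) w := by
    intro w
    have hmn := mollifier_nonneg m (X w ω - v)
    have hml := mollifier_le m (X w ω - v)
    have hnn : ∀ i ∈ Finset.univ, 0 ≤ (S i).indicator (fun _ => (2 : ℝ) ^ (m * d)) w := fun i _ =>
      Set.indicator_nonneg (fun _ _ => by positivity) _
    have hcase : ∀ i, w i ∈ Set.uIcc (z i) (z' i) →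
        (2 : ℝ) ^ (m * d) ≤ ∑ i, (S i).indicator (fun _ => (2 : ℝ) ^ (m * d)) w := by
      intro i hi
      refine le_trans ?_ (Finset.single_le_sum hnn (Finset.mem_univ i))
      rw [Set.indicator_of_mem (show w ∈ S i from hi)]
    by_cases h1 : w ∈ Set.Iic z <;> by_cases h2 : w ∈ Set.Iic z'
    · simpa [h1, h2] using Finset.sum_nonneg hnn
    · obtain ⟨i, hi⟩ : ∃ i, z' i < w i := by
        by_contra hcon; push Not at hcon; exact h2 hcon
      simp only [Set.indicator_of_mem h1, Set.indicator_of_notMem h2, sub_zero, Real.norm_eq_abs,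
        abs_of_nonneg hmn]
      exact hml.trans (hcase i (Set.mem_uIcc.2 (Or.inr ⟨hi.le, h1 i⟩)))
    · obtain ⟨i, hi⟩ : ∃ i, z i < w i := by
        by_contra hcon; push Not at hcon; exact h1 hcon
      simp only [Set.indicator_of_mem h2, Set.indicator_of_notMem h1, zero_sub, norm_neg,
        Real.norm_eq_abs, abs_of_nonneg hmn]
      exact hml.trans (hcase i (Set.mem_uIcc.2 (Or.inl ⟨hi.le, h2 i⟩)))
    · simpa [h1, h2] using Finset.sum_nonneg hnn
  have hbi : ∀ i ∈ Finset.univ, Integrable ((S i).indicator (fun _ => (2 : ℝ) ^ (m * d)))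
      (volume.restrict (Set.Icc a b)) := fun i _ => (integrable_const _).indicator (hSm i)
  refine (norm_integral_le_of_norm_le (integrable_finsetSum _ hbi)
    (ae_of_all _ hbound)).trans ?_
  rw [integral_finsetSum _ hbi]
  calc ∑ i, ∫ w in Set.Icc a b, (S i).indicator (fun _ => (2 : ℝ) ^ (m * d)) w
      ≤ ∑ _i : Fin k, 2 ^ (m * d) * (dist z z' * ∏ j, (1 + (b j - a j))) := by
        refine Finset.sum_le_sum fun i _ => ?_
        rw [integral_indicator (hSm i), Measure.restrict_restrict (hSm i), setIntegral_const,
          smul_eq_mul, mul_comm, Set.inter_comm]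
        gcongr
        have h1 := ENNReal.toReal_mono ENNReal.ofReal_ne_top (volume_slab_le hab i (z i) (z' i))
        rw [ENNReal.toReal_ofReal (by positivity)] at h1
        refine h1.trans ?_
        gcongr
        exact dist_le_pi_dist z z' i
    _ = _ := by
        rw [Finset.sum_const, Finset.card_univ, Fintype.card_fin, nsmul_eq_mul]
        ring

end Lipschitz

section LocalTime

variable {k d : ℕ} {Ω : Type*} [MeasurableSpace Ω]

/-- If the mollified occupation densities of `x` converge locally uniformly to a continuous
function, then this function is a density of the occupation measure. -/
theorem map_eq_withDensity_of_tendstoUniformlyOn {Z : Type*} [MeasurableSpace Z] {μ : Measure Z}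
    [IsFiniteMeasure μ] {x : Z → EuclideanSpace ℝ (Fin d)} (hx : Measurable x)
    {l : EuclideanSpace ℝ (Fin d) → ℝ≥0} (hl : Continuous l)
    (hlim : ∀ R : ℕ, TendstoUniformlyOn (fun m v => ∫ w, mollifier m (x w - v) ∂μ)
      (fun v => (l v : ℝ)) atTop (Metric.closedBall 0 R)) :
    μ.map x = volume.withDensity fun v => (l v : ℝ≥0∞) := by
  have hlf : IsLocallyFiniteMeasure
      ((volume : Measure (EuclideanSpace ℝ (Fin d))).withDensity fun v => (l v : ℝ≥0∞)) :=
    IsLocallyFiniteMeasure.withDensity_coe hl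
  have hreg : Measure.Regular
      ((volume : Measure (EuclideanSpace ℝ (Fin d))).withDensity fun v => (l v : ℝ≥0∞)) :=
    inferInstance
  refine Measure.ext_of_integral_eq_on_compactlySupported fun φ => ?_
  have hφc : Continuous φ := φ.continuous
  have hφs : HasCompactSupport φ := φ.hasCompactSupport
  obtain ⟨C, hC⟩ := hφs.exists_bound_of_continuous hφc
  have hφi : Integrable φ := hφc.integrable_of_hasCompactSupport hφs
  rw [integral_map hx.aemeasurable hφc.aestronglyMeasurable,
    integral_withDensity_eq_integral_smul hl.measurable]
  have hswap : ∀ m, ∫ v, φ v * ∫ w, mollifier m (x w - v) ∂μ =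
      ∫ w, (∫ v, φ v * mollifier m (x w - v)) ∂μ := by
    intro m
    simp_rw [← integral_const_mul]
    refine integral_integral_swap ?_
    have h1 : Integrable (fun q : EuclideanSpace ℝ (Fin d) × Z => φ q.1)
        (volume.prod μ) := hφi.comp_fst μ
    refine h1.mul_bdd (c := 2 ^ (m * d)) ?_ (ae_of_all _ fun q => ?_)
    · exact ((continuous_mollifier m).measurable.comp
        ((hx.comp measurable_snd).sub measurable_fst)).aestronglyMeasurable
    · rw [Real.norm_eq_abs, abs_of_nonneg (mollifier_nonneg _ _)]
      exact mollifier_le _ _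
  have hlim1 : Tendsto (fun m => ∫ v, φ v * ∫ w, mollifier m (x w - v) ∂μ) atTop
      (𝓝 (∫ w, φ (x w) ∂μ)) := by
    simp_rw [hswap]
    refine tendsto_integral_of_dominated_convergence (fun _ => C) (fun m => ?_)
      (integrable_const _) (fun m => ae_of_all _ fun w => ?_) (ae_of_all _ fun w => ?_)
    · have hm : StronglyMeasurable fun q : Z × EuclideanSpace ℝ (Fin d) =>
          φ q.2 * mollifier m (x q.1 - q.2) := by
        refine Measurable.stronglyMeasurable ?_
        exact (hφc.measurable.comp measurable_snd).mul ((continuous_mollifier m).measurable.comp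
          ((hx.comp measurable_fst).sub measurable_snd))
      exact hm.integral_prod_right'.aestronglyMeasurable
    · exact abs_integral_mul_mollifier_le hC m (x w)
    · exact tendsto_integral_mul_mollifier hφc hC (x w)
  have hlim2 : Tendsto (fun m => ∫ v, φ v * ∫ w, mollifier m (x w - v) ∂μ) atTop
      (𝓝 (∫ v, l v • φ v)) := by
    obtain ⟨R, hR⟩ : ∃ R : ℕ, tsupport φ ⊆ Metric.closedBall 0 R := by
      obtain ⟨r, hr⟩ := hφs.isBounded.subset_closedBall 0
      obtain ⟨R, hR⟩ := exists_nat_ge r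
      exact ⟨R, hr.trans (Metric.closedBall_subset_closedBall hR)⟩
    have hun := Metric.tendstoUniformlyOn_iff.1 (hlim R)
    have hbd : Integrable fun v => ‖φ v‖ * ((l v : ℝ) + 1) := by
      refine Continuous.integrable_of_hasCompactSupport (by fun_prop) ?_
      exact hφs.norm.mul_right
    refine tendsto_integral_filter_of_dominated_convergence (fun v => ‖φ v‖ * ((l v : ℝ) + 1))
      (Eventually.of_forall fun m => ?_) ?_ hbd (ae_of_all _ fun v => ?_)
    · refine hφc.aestronglyMeasurable.mul ?_
      have hm : StronglyMeasurable fun q : EuclideanSpace ℝ (Fin d) × Z =>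
          mollifier m (x q.2 - q.1) := by
        refine Measurable.stronglyMeasurable ?_
        exact (continuous_mollifier m).measurable.comp
          ((hx.comp measurable_snd).sub measurable_fst)
      exact hm.integral_prod_right'.aestronglyMeasurable
    · filter_upwards [hun 1 one_pos] with m hm
      refine ae_of_all _ fun v => ?_
      by_cases hv : v ∈ tsupport φ
      · rw [norm_mul]
        gcongr
        have h1 := hm v (hR hv)
        rw [dist_comm, Real.dist_eq] at h1
        have h2 := abs_sub_abs_le_abs_sub (∫ w, mollifier m (x w - v) ∂μ) (l v : ℝ)
        rw [abs_of_nonneg (l v).coe_nonneg] at h2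
        rw [Real.norm_eq_abs]
        linarith
      · simp [image_eq_zero_of_notMem_tsupport hv]
    · by_cases hv : v ∈ tsupport φ
      · rw [NNReal.smul_def, smul_eq_mul, mul_comm]
        exact ((hlim R).tendsto_at (hR hv)).const_mul _
      · simp [image_eq_zero_of_notMem_tsupport hv]
  exact tendsto_nhds_unique hlim1 hlim2

/-- The difference of consecutive mollified occupation densities, as a function of the joint
variable `(v, z)`. -/
def occDiff (X : (Fin k → ℝ) → Ω → EuclideanSpace ℝ (Fin d)) (a b : Fin k → ℝ) (m : ℕ)
    (x : Fin d ⊕ Fin k → ℝ) (ω : Ω) : ℝ :=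
  occDensity X a b (m + 1) (WithLp.toLp 2 fun i => x (Sum.inl i)) (fun i => x (Sum.inr i)) ω -
    occDensity X a b m (WithLp.toLp 2 fun i => x (Sum.inl i)) (fun i => x (Sum.inr i)) ω

theorem exists_abs_occDensity_sub_le {X : (Fin k → ℝ) → Ω → EuclideanSpace ℝ (Fin d)}
    (hX : Measurable fun p : (Fin k → ℝ) × Ω => X p.1 p.2) {a b : Fin k → ℝ} (hab : a ≤ b) :
    ∃ C, 0 ≤ C ∧ ∀ m ω (x y : Fin d ⊕ Fin k → ℝ),
      |occDensity X a b m (WithLp.toLp 2 fun i => x (Sum.inl i)) (fun i => x (Sum.inr i)) ω -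
        occDensity X a b m (WithLp.toLp 2 fun i => y (Sum.inl i)) (fun i => y (Sum.inr i)) ω| ≤
      C * ((2 ^ (d + 1) : ℕ) : ℝ) ^ m * dist x y := by
  have hprod : 0 ≤ ∏ j, (1 + (b j - a j)) :=
    Finset.prod_nonneg fun j _ => by linarith [hab j]
  refine ⟨d * volume.real (Set.Icc a b) + k * ∏ j, (1 + (b j - a j)), by positivity,
    fun m ω x y => ?_⟩
  have h1 := abs_occDensity_sub_left_le hX a b m (WithLp.toLp 2 fun i => x (Sum.inl i))
    (WithLp.toLp 2 fun i => y (Sum.inl i)) (fun i => x (Sum.inr i)) ω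
  have h2 := abs_occDensity_sub_right_le hX hab m (WithLp.toLp 2 fun i => y (Sum.inl i))
    (fun i => x (Sum.inr i)) (fun i => y (Sum.inr i)) ω
  have h3 : ‖(WithLp.toLp 2 fun i => x (Sum.inl i) : EuclideanSpace ℝ (Fin d)) -
      WithLp.toLp 2 fun i => y (Sum.inl i)‖ ≤ d * dist x y := by
    rw [EuclideanSpace.norm_eq]
    refine Real.sqrt_le_iff.2 ⟨by positivity, ?_⟩
    calc ∑ i, ‖((WithLp.toLp 2 fun i => x (Sum.inl i) : EuclideanSpace ℝ (Fin d)) -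
          WithLp.toLp 2 fun i => y (Sum.inl i)) i‖ ^ 2 ≤ ∑ _i : Fin d, dist x y ^ 2 := by
          refine Finset.sum_le_sum fun i _ => ?_
          gcongr
          exact dist_le_pi_dist x y (Sum.inl i)
      _ = d * dist x y ^ 2 := by simp
      _ ≤ (d * dist x y) ^ 2 := by
          rw [mul_pow]
          gcongr
          have : d ≤ d ^ 2 := Nat.le_self_pow two_ne_zero d
          exact_mod_cast this
  have h4 : dist (fun i => x (Sum.inr i)) (fun i => y (Sum.inr i)) ≤ dist x y :=
    (dist_pi_le_iff dist_nonneg).2 fun i => dist_le_pi_dist x y (Sum.inr i)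
  have h5 : (2 : ℝ) ^ (m * (d + 1)) = ((2 ^ (d + 1) : ℕ) : ℝ) ^ m := by
    push_cast; rw [← pow_mul, mul_comm]
  have h6 : (2 : ℝ) ^ (m * d) ≤ ((2 ^ (d + 1) : ℕ) : ℝ) ^ m := by
    rw [← h5]
    exact pow_le_pow_right₀ one_le_two (Nat.mul_le_mul_left m (Nat.le_succ d))
  refine (abs_sub_le _ _ _).trans ((add_le_add h1 h2).trans ?_)
  calc _ ≤ ((2 ^ (d + 1) : ℕ) : ℝ) ^ m * (d * dist x y) * volume.real (Set.Icc a b) +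
        ((2 ^ (d + 1) : ℕ) : ℝ) ^ m * (k * (dist x y * ∏ j, (1 + (b j - a j)))) := by
        rw [h5]; gcongr
    _ = _ := by ring

/-- The upper limit of the mollified occupation densities. -/
def localTime (X : (Fin k → ℝ) → Ω → EuclideanSpace ℝ (Fin d)) (a b : Fin k → ℝ)
    (v : EuclideanSpace ℝ (Fin d)) (z : Fin k → ℝ) (ω : Ω) : ℝ≥0 :=
  (limsup (fun m => ENNReal.ofReal (occDensity X a b m v z ω)) atTop).toNNReal

/-- The lower corner of the box `[-R, R]^d × [a, b]`. -/
def boxLower (d : ℕ) (a : Fin k → ℝ) (R : ℕ) : Fin d ⊕ Fin k → ℝ := Sum.elim (fun _ => -(R : ℝ)) a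

/-- The upper corner of the box `[-R, R]^d × [a, b]`. -/
def boxUpper (d : ℕ) (b : Fin k → ℝ) (R : ℕ) : Fin d ⊕ Fin k → ℝ := Sum.elim (fun _ => (R : ℝ)) b

theorem boxLower_le_boxUpper (d : ℕ) {a b : Fin k → ℝ} (hab : a ≤ b) (R : ℕ) :
    boxLower d a R ≤ boxUpper d b R := by
  rintro (i | i)
  · simp only [boxLower, boxUpper, Sum.elim_inl]; linarith [(Nat.cast_nonneg R : (0 : ℝ) ≤ R)]
  · exact hab i

theorem elim_mem_Icc_box {a b : Fin k → ℝ} {v : EuclideanSpace ℝ (Fin d)} {z : Fin k → ℝ} {R : ℕ}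
    (hv : ‖v‖ ≤ R) (hz : z ∈ Set.Icc a b) :
    (Sum.elim v.ofLp z : Fin d ⊕ Fin k → ℝ) ∈ Set.Icc (boxLower d a R) (boxUpper d b R) := by
  have h1 : ∀ i, |v i| ≤ R := fun i => (PiLp.norm_apply_le v i).trans hv
  constructor
  · rintro (i | i)
    · exact (abs_le.1 (h1 i)).1
    · exact hz.1 i
  · rintro (i | i)
    · exact (abs_le.1 (h1 i)).2
    · exact hz.2 i

theorem ae_exists_summable_bound_occDiff {P : Measure Ω} [IsProbabilityMeasure P]
    {X : (Fin k → ℝ) → Ω → EuclideanSpace ℝ (Fin d)}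
    (hX : Measurable fun p : (Fin k → ℝ) × Ω => X p.1 p.2) {a b : Fin k → ℝ} (hab : a ≤ b) {γ : ℝ}
    (hγ : 0 < γ) (hγ1 : γ ≤ 1) (hmom : ∀ n, charMoment P X a b γ (n + 1) < ⊤) :
    ∀ᵐ ω ∂P, ∀ R : ℕ, ∃ u : ℕ → ℝ, Summable u ∧ ∀ᶠ m in atTop,
      ∀ x ∈ Set.Icc (boxLower d a R) (boxUpper d b R), |occDiff X a b m x ω| ≤ u m := by
  obtain ⟨C, -, hC⟩ := exists_abs_occDensity_sub_le hX hab
  have hK0 : 0 < 2 ^ (d + 1) := by positivity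
  generalize 2 ^ (d + 1) = K at hC hK0
  obtain ⟨s, hs0, hs1, hs2⟩ : ∃ s : ℝ, 0 < s ∧ s < 1 ∧ s ^ 2 = (2 : ℝ) ^ (-γ) :=
    ⟨(2 : ℝ) ^ (-γ / 2), by positivity,
      Real.rpow_lt_one_of_one_lt_of_neg one_lt_two (by linarith), by
        rw [← Real.rpow_natCast, ← Real.rpow_mul two_pos.le]; norm_num⟩
  have hm : ∀ m v z, Measurable fun ω => occDensity X a b m v z ω := fun m v z => by
    have h := (measurable_occDensity hX a b m z).comp (measurable_prodMk_left (x := v))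
    simpa only [Function.comp_def] using h
  have hDm : ∀ m x, Measurable (occDiff X a b m x) := fun m x => (hm _ _ _).sub (hm _ _ _)
  refine ae_all_iff.2 fun R => ?_
  have hmain : ∀ᵐ ω ∂P, ∀ᶠ m in atTop, ∀ x ∈ Set.Icc (boxLower d a R) (boxUpper d b R),
      |occDiff X a b m x ω| ≤ s ^ m +
        |C * (K + 1)| * dist (boxLower d a R) (boxUpper d b R) * (1 / 2) ^ m := by
    refine ae_eventually_forall_abs_le (boxLower_le_boxUpper d hab R) hDm (K := K) hK0
      (fun m ω x _ y _ => ?_) hs0 hs1 (fun n hn hn0 => ?_)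
    · have h1 := hC (m + 1) ω x y
      have h2 := hC m ω x y
      calc |occDiff X a b m x ω - occDiff X a b m y ω| ≤
          C * (K : ℝ) ^ (m + 1) * dist x y + C * (K : ℝ) ^ m * dist x y := by
            unfold occDiff
            rw [sub_sub_sub_comm]
            exact (abs_sub _ _).trans (add_le_add h1 h2)
        _ = _ := by ring
    · obtain ⟨n', rfl⟩ : ∃ n', n = n' + 1 := ⟨n - 1, by omega⟩
      refine ⟨_, (hmom n').ne, fun m x => ?_⟩
      rw [hs2]
      exact lintegral_occDensity_sub_pow_le hX a b hγ hγ1 hn m _ _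
  filter_upwards [hmain] with ω hω
  exact ⟨_, (summable_geometric_of_lt_one hs0.le hs1).add
    ((summable_geometric_of_lt_one (by norm_num) (by norm_num)).mul_left _), hω⟩

theorem ae_tendstoUniformlyOn_occDensity {P : Measure Ω} [IsProbabilityMeasure P]
    {X : (Fin k → ℝ) → Ω → EuclideanSpace ℝ (Fin d)}
    (hX : Measurable fun p : (Fin k → ℝ) × Ω => X p.1 p.2) {a b : Fin k → ℝ} (hab : a ≤ b) {γ : ℝ}
    (hγ : 0 < γ) (hγ1 : γ ≤ 1) (hmom : ∀ n, charMoment P X a b γ (n + 1) < ⊤) :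
    ∀ᵐ ω ∂P, ∀ R : ℕ, TendstoUniformlyOn
      (fun m (y : EuclideanSpace ℝ (Fin d) × (Fin k → ℝ)) => occDensity X a b m y.1 y.2 ω)
      (fun y => (localTime X a b y.1 y.2 ω : ℝ)) atTop (Metric.closedBall 0 R ×ˢ Set.Icc a b) := by
  filter_upwards [ae_exists_summable_bound_occDiff hX hab hγ hγ1 hmom] with ω hω R
  obtain ⟨u, hsum, hu⟩ := hω R
  have h1 := tendstoUniformlyOn_tsum_nat_eventually (s := Set.Icc (boxLower d a R) (boxUpper d b R))
    (f := fun m x => occDiff X a b m x ω) hsum hu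
  have h2 : TendstoUniformlyOn
      (fun m (y : EuclideanSpace ℝ (Fin d) × (Fin k → ℝ)) => occDensity X a b m y.1 y.2 ω)
      (fun y => occDensity X a b 0 y.1 y.2 ω +
        ∑' m, occDiff X a b m (Sum.elim y.1.ofLp y.2) ω) atTop
      (Metric.closedBall 0 R ×ˢ Set.Icc a b) := by
    rw [Metric.tendstoUniformlyOn_iff] at h1 ⊢
    intro ε hε
    filter_upwards [h1 ε hε] with m hm y hy
    have h3 := hm _ (elim_mem_Icc_box (by simpa using hy.1) hy.2)
    have h4 : ∑ n ∈ Finset.range m, occDiff X a b n (Sum.elim y.1.ofLp y.2) ω =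
        occDensity X a b m y.1 y.2 ω - occDensity X a b 0 y.1 y.2 ω :=
      Finset.sum_range_sub (fun n => occDensity X a b n y.1 y.2 ω) m
    rw [h4, Real.dist_eq] at h3
    rw [Real.dist_eq]
    convert h3 using 2
    ring
  refine h2.congr_right fun y hy => ?_
  have h5 := h2.tendsto_at hy
  have h6 := (ENNReal.continuous_ofReal.tendsto _).comp h5
  have h7 := h6.limsup_eq
  have h8 : 0 ≤ occDensity X a b 0 y.1 y.2 ω +
        ∑' m, occDiff X a b m (Sum.elim y.1.ofLp y.2) ω :=
    ge_of_tendsto' h5 fun m => occDensity_nonneg X a b m _ _ _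
  simp only [Function.comp_def] at h7
  simp only [localTime, h7]
  rw [ENNReal.coe_toNNReal_eq_toReal, ENNReal.toReal_ofReal h8]

theorem continuous_occDensity {X : (Fin k → ℝ) → Ω → EuclideanSpace ℝ (Fin d)}
    (hX : Measurable fun p : (Fin k → ℝ) × Ω => X p.1 p.2) {a b : Fin k → ℝ} (hab : a ≤ b) (m : ℕ)
    (ω : Ω) : Continuous fun y : EuclideanSpace ℝ (Fin d) × (Fin k → ℝ) =>
      occDensity X a b m y.1 y.2 ω := by
  obtain ⟨C, hC0, hC⟩ := exists_abs_occDensity_sub_le hX hab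
  generalize 2 ^ (d + 1) = K at hC
  have h1 : Continuous fun x : Fin d ⊕ Fin k → ℝ =>
      occDensity X a b m (WithLp.toLp 2 fun i => x (Sum.inl i)) (fun i => x (Sum.inr i)) ω := by
    refine (LipschitzWith.of_dist_le_mul (K := ⟨C * (K : ℝ) ^ m, by positivity⟩)
      fun x y => ?_).continuous
    exact hC m ω x y
  have h2 : Continuous fun y : EuclideanSpace ℝ (Fin d) × (Fin k → ℝ) =>
      (Sum.elim y.1.ofLp y.2 : Fin d ⊕ Fin k → ℝ) := by
    refine continuous_pi ?_
    rintro (i | i)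
    · simp only [Sum.elim_inl]; fun_prop
    · simp only [Sum.elim_inr]; fun_prop
  exact h1.comp h2

/-- Berman's principle: integrability of weighted joint characteristic functions of all orders
yields a jointly continuous local time. -/
theorem hasJointlyContinuousLocalTime_of_charMoment {P : Measure Ω} [IsProbabilityMeasure P]
    {X : (Fin k → ℝ) → Ω → EuclideanSpace ℝ (Fin d)}
    (hX : Measurable fun p : (Fin k → ℝ) × Ω => X p.1 p.2) {a b : Fin k → ℝ} {γ : ℝ} (hγ : 0 < γ)
    (hγ1 : γ ≤ 1) (hmom : ∀ n, charMoment P X a b γ (n + 1) < ⊤) :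
    HasJointlyContinuousLocalTime P X a b := by
  by_cases hab : a ≤ b
  swap
  · have : Set.Icc a b = ∅ := Set.Icc_eq_empty hab
    exact ⟨fun _ _ _ => 0, ⟨fun _ _ => measurable_const, by simp [this]⟩, by simp [this]⟩
  have huniform := ae_tendstoUniformlyOn_occDensity hX hab hγ hγ1 hmom
  have hcont : ∀ᵐ ω ∂P, ContinuousOn
      (fun y : EuclideanSpace ℝ (Fin d) × (Fin k → ℝ) => localTime X a b y.1 y.2 ω) (Set.univ ×ˢ Set.Icc a b) := by
    filter_upwards [huniform] with ω hω y hy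
    obtain ⟨R, hR⟩ := exists_nat_gt ‖y.1‖
    have h1 : ContinuousOn
        (fun y : EuclideanSpace ℝ (Fin d) × (Fin k → ℝ) => (localTime X a b y.1 y.2 ω : ℝ))
        (Metric.closedBall 0 R ×ˢ Set.Icc a b) :=
      (hω R).continuousOn (Eventually.of_forall fun m => (continuous_occDensity hX hab m ω).continuousOn).frequently
    have h2 := h1 y ⟨by simpa using hR.le, hy.2⟩
    have h3 : ContinuousWithinAt
        (fun y : EuclideanSpace ℝ (Fin d) × (Fin k → ℝ) => (localTime X a b y.1 y.2 ω : ℝ))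
        (Set.univ ×ˢ Set.Icc a b) y := by
      refine h2.mono_of_mem_nhdsWithin ?_
      have h4 : Metric.closedBall (0 : EuclideanSpace ℝ (Fin d)) R ×ˢ Set.univ ∈ 𝓝 y := by
        refine prod_mem_nhds ?_ univ_mem
        exact mem_of_superset (Metric.isOpen_ball.mem_nhds (by simpa using hR))
          Metric.ball_subset_closedBall
      filter_upwards [mem_nhdsWithin_of_mem_nhds h4, self_mem_nhdsWithin] with x hx hx'
      exact ⟨hx.1, hx'.2⟩
    have h5 := (continuous_real_toNNReal.continuousAt).comp_continuousWithinAt h3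
    simpa [Function.comp_def] using h5
  refine ⟨localTime X a b, ⟨fun z _ => ?_, ?_⟩, hcont⟩
  · refine Measurable.ennreal_toNNReal (Measurable.limsup fun m => ?_)
    exact (measurable_occDensity hX a b m z).ennreal_ofReal
  · filter_upwards [huniform, hcont] with ω hω hcω z hz B hB
    have := isFiniteMeasure_restrict_Iic_inter_Icc z a b
    have hxm := measurable_section hX ω
    have h1 : Continuous fun v => localTime X a b v z ω := by
      rw [← continuousOn_univ]
      have h := hcω.comp (t := Set.univ ×ˢ Set.Icc a b) (s := Set.univ)
        (f := fun v : EuclideanSpace ℝ (Fin d) => (v, z))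
        (by fun_prop) fun v _ => ⟨Set.mem_univ _, hz⟩
      simpa only [Function.comp_def] using h
    have h2 := map_eq_withDensity_of_tendstoUniformlyOn
      (μ := (volume : Measure (Fin k → ℝ)).restrict (Set.Iic z ∩ Set.Icc a b)) hxm h1
      fun R => by
        have h3 := (hω R).comp (fun v : EuclideanSpace ℝ (Fin d) => (v, z))
        refine h3.mono fun v hv => ⟨hv, hz⟩
    have h4 := congrArg (fun ν => ν B) h2
    rw [Measure.map_apply hxm hB, withDensity_apply _ hB, Measure.restrict_apply (hxm hB)] at h4
    rw [← h4]
    congr 1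
    ext w
    simp [and_comm]

end LocalTime

section Gram

/-- A quadratic form with kernel `∫ e(t, y) e(s, y) dν(y)` dominates the square of every linear
functional whose representative is of the form `∫ e(t, y) g(y) dν(y)`. -/
theorem enorm_integral_sq_le_gram {T Y : Type*} [MeasurableSpace T] [MeasurableSpace Y]
    {μ : Measure T} {ν : Measure Y} [SFinite μ] [SFinite ν] {F : T → ℂ} {e : T → Y → ℝ} {g : Y → ℂ}
    (hF : Measurable F) (he : Measurable fun q : T × Y => e q.1 q.2) (hg : Measurable g)
    (h1 : Integrable (fun q : (T × T) × Y => F q.1.1 * (starRingEnd ℂ) (F q.1.2) *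
      ((e q.1.1 q.2 * e q.1.2 q.2 : ℝ) : ℂ)) ((μ.prod μ).prod ν))
    (h2 : Integrable (fun q : T × Y => F q.1 * ((e q.1 q.2 : ℂ) * g q.2)) (μ.prod ν)) :
    0 ≤ (∫ p, F p.1 * (starRingEnd ℂ) (F p.2) *
        ((∫ y, e p.1 y * e p.2 y ∂ν : ℝ) : ℂ) ∂(μ.prod μ)).re ∧
    ‖∫ t, F t * ∫ y, (e t y : ℂ) * g y ∂ν ∂μ‖ₑ ^ 2 ≤
      ENNReal.ofReal (∫ p, F p.1 * (starRingEnd ℂ) (F p.2) *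
        ((∫ y, e p.1 y * e p.2 y ∂ν : ℝ) : ℂ) ∂(μ.prod μ)).re * ∫⁻ y, ‖g y‖ₑ ^ 2 ∂ν := by
  set E : Y → ℂ := fun y => ∫ t, F t * (e t y : ℂ) ∂μ with hE
  have hEm : StronglyMeasurable E := by
    have h : StronglyMeasurable fun q : Y × T => F q.2 * ((e q.2 q.1 : ℝ) : ℂ) := by
      refine Measurable.stronglyMeasurable ((hF.comp measurable_snd).mul ?_)
      exact Complex.measurable_ofReal.comp (he.comp measurable_swap)
    exact h.integral_prod_right'
  have hsq : ∀ y, ∫ p, F p.1 * (starRingEnd ℂ) (F p.2) * ((e p.1 y * e p.2 y : ℝ) : ℂ) ∂(μ.prod μ) =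
      ((‖E y‖ ^ 2 : ℝ) : ℂ) := by
    intro y
    have h3 : ∀ p : T × T, F p.1 * (starRingEnd ℂ) (F p.2) * ((e p.1 y * e p.2 y : ℝ) : ℂ) =
        (F p.1 * (e p.1 y : ℂ)) * (starRingEnd ℂ) (F p.2 * (e p.2 y : ℂ)) := by
      intro p
      simp only [map_mul, Complex.conj_ofReal, Complex.ofReal_mul]
      ring
    simp_rw [h3]
    rw [integral_prod_mul (fun t => F t * (e t y : ℂ)) fun t => (starRingEnd ℂ) (F t * (e t y : ℂ)),
      integral_conj, Complex.mul_conj, Complex.normSq_eq_norm_sq]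
  have hint : Integrable (fun y => ((‖E y‖ ^ 2 : ℝ) : ℂ)) ν := by
    have := h1.integral_prod_right
    simpa only [hsq] using this
  have hint' : Integrable (fun y => ‖E y‖ ^ 2) ν := by
    refine hint.re.congr (ae_of_all _ fun y => ?_)
    exact Complex.ofReal_re _
  have hform : ∫ p, F p.1 * (starRingEnd ℂ) (F p.2) *
      ((∫ y, e p.1 y * e p.2 y ∂ν : ℝ) : ℂ) ∂(μ.prod μ) = ((∫ y, ‖E y‖ ^ 2 ∂ν : ℝ) : ℂ) := by
    calc _ = ∫ p, ∫ y, F p.1 * (starRingEnd ℂ) (F p.2) *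
          ((e p.1 y * e p.2 y : ℝ) : ℂ) ∂ν ∂(μ.prod μ) := by
          refine integral_congr_ae (ae_of_all _ fun p => ?_)
          simp only
          rw [integral_const_mul]
          exact congrArg _ integral_ofReal.symm
      _ = ∫ y, ((‖E y‖ ^ 2 : ℝ) : ℂ) ∂ν := by
          rw [integral_integral_swap h1]
          simp_rw [hsq]
      _ = _ := integral_ofReal
  have hlin : ∫ t, F t * ∫ y, (e t y : ℂ) * g y ∂ν ∂μ = ∫ y, E y * g y ∂ν := by
    simp_rw [← integral_const_mul]
    rw [integral_integral_swap h2]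
    refine integral_congr_ae (ae_of_all _ fun y => ?_)
    simp only [hE]
    rw [← integral_mul_const]
    simp_rw [mul_assoc]
  rw [hlin, hform, Complex.ofReal_re]
  refine ⟨integral_nonneg fun y => by positivity, ?_⟩
  rw [ofReal_integral_eq_lintegral_ofReal hint'
    (ae_of_all _ fun y => by positivity)]
  have h4 : ‖∫ y, E y * g y ∂ν‖ₑ ≤ ∫⁻ y, ‖E y‖ₑ * ‖g y‖ₑ ∂ν := by
    refine (enorm_integral_le_lintegral_enorm _).trans_eq ?_
    simp_rw [enorm_mul]
  have h5 : ∀ y, ENNReal.ofReal (‖E y‖ ^ 2) = ‖E y‖ₑ ^ 2 := fun y => by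
    rw [ENNReal.ofReal_pow (norm_nonneg _), ofReal_norm]
  simp_rw [h5]
  exact (pow_le_pow_left' h4 2).trans (sq_lintegral_mul_le hEm.measurable.enorm.aemeasurable
    hg.enorm.aemeasurable)

end Gram

section TimeMeasure

/-- The measure `ρ_H(t - s) dt ds` on `ℝ₊ × ℝ₊`. -/
def timeMeasure (H : ℝ) : Measure (ℝ × ℝ) :=
  if H = 1 / 2 then (volume.restrict (Set.Ici (0 : ℝ))).map fun t => (t, t)
  else ((volume.restrict (Set.Ici (0 : ℝ))).prod (volume.restrict (Set.Ici (0 : ℝ)))).withDensity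
    fun p => ENNReal.ofReal (|p.1 - p.2| ^ (2 * H - 2))

instance sFinite_timeMeasure (H : ℝ) : SFinite (timeMeasure H) := by
  unfold timeMeasure
  split_ifs <;> infer_instance

theorem measurable_abs_sub_rpow (e : ℝ) :
    Measurable fun p : ℝ × ℝ => ENNReal.ofReal (|p.1 - p.2| ^ e) := by fun_prop

theorem timePairing_eq_integral {F : Type*} [NormedAddCommGroup F] [NormedSpace ℝ F] {H : ℝ}
    {k : ℝ → ℝ → F} (hk : Integrable (fun p : ℝ × ℝ => k p.1 p.2) (timeMeasure H)) :
    timePairing H k = ∫ p, k p.1 p.2 ∂(timeMeasure H) := by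
  unfold timePairing timeMeasure at *
  split_ifs at hk ⊢ with h
  · rw [integral_map (by fun_prop) hk.aestronglyMeasurable]
  · have hfin : ∀ᵐ p ∂((volume.restrict (Set.Ici (0 : ℝ))).prod (volume.restrict (Set.Ici (0 : ℝ)))),
        ENNReal.ofReal (|p.1 - p.2| ^ (2 * H - 2)) < ⊤ := ae_of_all _ fun _ => ENNReal.ofReal_lt_top
    rw [integral_withDensity_eq_integral_toReal_smul (measurable_abs_sub_rpow _) hfin]
    rw [integrable_withDensity_iff_integrable_smul' (measurable_abs_sub_rpow _) hfin] at hk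
    rw [integral_prod _ hk]
    have : ∀ t s : ℝ, (ENNReal.ofReal (|t - s| ^ (2 * H - 2))).toReal = |t - s| ^ (2 * H - 2) :=
      fun t s => ENNReal.toReal_ofReal (by positivity)
    simp_rw [this]

theorem lintegral_abs_rpow_Icc_lt_top {e : ℝ} (he : -1 < e) (M : ℝ) :
    ∫⁻ x in Set.Icc (-M) M, ENNReal.ofReal (|x| ^ e) < ⊤ := by
  rw [← lintegral_indicator measurableSet_Icc, lintegral_even]
  · refine ENNReal.mul_lt_top (by simp) ?_
    rw [lintegral_indicator measurableSet_Icc, Measure.restrict_restrict measurableSet_Icc]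
    have h1 : IntegrableOn (fun x : ℝ => x ^ e) (Set.Ioc 0 |M|) := by
      have := intervalIntegral.intervalIntegrable_rpow' (a := 0) (b := |M|) he
      rwa [intervalIntegrable_iff_integrableOn_Ioc_of_le (abs_nonneg _)] at this
    refine lt_of_le_of_lt ?_ h1.lintegral_lt_top
    calc ∫⁻ x in Set.Icc (-M) M ∩ Set.Ioi 0, ENNReal.ofReal (|x| ^ e)
        ≤ ∫⁻ x in Set.Ioc 0 |M|, ENNReal.ofReal (|x| ^ e) :=
          lintegral_mono_set fun x hx => ⟨hx.2, hx.1.2.trans (le_abs_self M)⟩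
      _ = _ := by
          refine setLIntegral_congr_fun measurableSet_Ioc fun x hx => ?_
          simp only [abs_of_pos hx.1]
  · intro x
    have : -x ∈ Set.Icc (-M) M ↔ x ∈ Set.Icc (-M) M := by
      simp only [Set.mem_Icc]
      constructor <;> rintro ⟨h1, h2⟩ <;> constructor <;> linarith
    by_cases hx : x ∈ Set.Icc (-M) M
    · rw [Set.indicator_of_mem hx, Set.indicator_of_mem (this.2 hx), abs_neg]
    · rw [Set.indicator_of_notMem hx, Set.indicator_of_notMem (fun h => hx (this.1 h))]

theorem timeMeasure_box_lt_top {H : ℝ} (hH : 1 / 2 ≤ H) (M : ℝ) :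
    timeMeasure H (Set.Icc (-M) M ×ˢ Set.Icc (-M) M) < ⊤ := by
  have hm : MeasurableSet (Set.Icc (-M) M ×ˢ Set.Icc (-M) M) :=
    measurableSet_Icc.prod measurableSet_Icc
  unfold timeMeasure
  split_ifs with h
  · rw [Measure.map_apply (by fun_prop) hm]
    refine lt_of_le_of_lt (Measure.restrict_apply_le _ _) ?_
    refine lt_of_le_of_lt (measure_mono (t := Set.Icc (-M) M) fun t ht => ht.1) ?_
    exact measure_Icc_lt_top
  · have hH' : 1 / 2 < H := lt_of_le_of_ne hH (Ne.symm h)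
    rw [withDensity_apply _ hm, ← lintegral_indicator hm]
    set J := ∫⁻ x in Set.Icc (-(2 * M)) (2 * M), ENNReal.ofReal (|x| ^ (2 * H - 2)) with hJ
    have hJ' : J < ⊤ := lintegral_abs_rpow_Icc_lt_top (by linarith) _
    have hmeas : Measurable ((Set.Icc (-M) M ×ˢ Set.Icc (-M) M).indicator
        fun p : ℝ × ℝ => ENNReal.ofReal (|p.1 - p.2| ^ (2 * H - 2))) :=
      (measurable_abs_sub_rpow _).indicator hm
    calc _ ≤ ∫⁻ t : ℝ, ∫⁻ s : ℝ, (Set.Icc (-M) M ×ˢ Set.Icc (-M) M).indicator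
          (fun p : ℝ × ℝ => ENNReal.ofReal (|p.1 - p.2| ^ (2 * H - 2))) (t, s) := by
          rw [← lintegral_prod _ hmeas.aemeasurable]
          exact lintegral_mono' (Measure.prod_mono Measure.restrict_le_self
            Measure.restrict_le_self) le_rfl
      _ ≤ ∫⁻ t : ℝ, (Set.Icc (-M) M).indicator (fun _ => J) t := by
          refine lintegral_mono fun t => ?_
          by_cases ht : t ∈ Set.Icc (-M) M
          · rw [Set.indicator_of_mem ht, hJ, ← lintegral_indicator measurableSet_Icc,
              ← lintegral_sub_left_eq_self _ t]
            refine lintegral_mono fun s => ?_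
            by_cases hs : t - s ∈ Set.Icc (-M) M
            · rw [Set.indicator_of_mem (Set.mk_mem_prod ht hs), Set.indicator_of_mem]
              · simp only [sub_sub_cancel, le_refl]
              constructor <;> linarith [ht.1, ht.2, hs.1, hs.2]
            · rw [Set.indicator_of_notMem (fun h => hs h.2)]
              exact zero_le
          · rw [Set.indicator_of_notMem ht]
            refine (lintegral_eq_zero_of_ae_eq_zero (ae_of_all _ fun s => ?_)).le
            exact Set.indicator_of_notMem (fun h => ht h.1) _
      _ = J * volume (Set.Icc (-M) M) := by
          rw [lintegral_indicator measurableSet_Icc, setLIntegral_const]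
      _ < ⊤ := ENNReal.mul_lt_top hJ' measure_Icc_lt_top

/-- Bounded measurable functions that vanish outside a bounded set. -/
structure IsBoundedSupported (F : ℝ → ℂ) : Prop where
  measurable : Measurable F
  bounded : ∃ C, ∀ t, ‖F t‖ ≤ C
  supported : ∃ M, ∀ t, t ∉ Set.Icc (-M) M → F t = 0

theorem IsBoundedSupported.integrable_timeMeasure {H : ℝ} (hH : 1 / 2 ≤ H) {F G : ℝ → ℂ}
    (hF : IsBoundedSupported F) (hG : IsBoundedSupported G) :
    Integrable (fun p : ℝ × ℝ => F p.1 * (starRingEnd ℂ) (G p.2)) (timeMeasure H) := by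
  obtain ⟨C, hC⟩ := hF.bounded
  obtain ⟨D, hD⟩ := hG.bounded
  obtain ⟨M, hM⟩ := hF.supported
  obtain ⟨M', hM'⟩ := hG.supported
  set K := max M M' with hK
  have hms : MeasurableSet (Set.Icc (-K) K ×ˢ Set.Icc (-K) K) :=
    measurableSet_Icc.prod measurableSet_Icc
  have hmeas : Measurable fun p : ℝ × ℝ => F p.1 * (starRingEnd ℂ) (G p.2) :=
    (hF.measurable.comp measurable_fst).mul
      (Complex.continuous_conj.measurable.comp (hG.measurable.comp measurable_snd))
  have hon : IntegrableOn (fun p : ℝ × ℝ => F p.1 * (starRingEnd ℂ) (G p.2))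
      (Set.Icc (-K) K ×ˢ Set.Icc (-K) K) (timeMeasure H) := by
    refine Measure.integrableOn_of_bounded (M := C * D) (timeMeasure_box_lt_top hH K).ne
      hmeas.aestronglyMeasurable (ae_of_all _ fun p => ?_)
    rw [norm_mul, RCLike.norm_conj]
    exact mul_le_mul (hC _) (hD _) (norm_nonneg _) ((norm_nonneg _).trans (hC p.1))
  refine (integrableOn_iff_integrable_of_support_subset fun p hp => ?_).1 hon
  by_contra hcon
  apply hp
  simp only [Set.mem_prod, not_and_or] at hcon
  rcases hcon with h | h
  · have : p.1 ∉ Set.Icc (-M) M := fun h' => h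
      ⟨by linarith [h'.1, le_max_left M M'], by linarith [h'.2, le_max_left M M']⟩
    simp [hM _ this]
  · have : p.2 ∉ Set.Icc (-M') M' := fun h' => h
      ⟨by linarith [h'.1, le_max_right M M'], by linarith [h'.2, le_max_right M M']⟩
    simp [hM' _ this]

end TimeMeasure

section ExponentialMixture

/-- One-sided exponentials `e^{-λ(t - v)} 1_{v < t}`, with `y = (λ, v)`. -/
def expKernel (t : ℝ) (y : ℝ × ℝ) : ℝ := if y.2 < t then Real.exp (-(y.1 * (t - y.2))) else 0

theorem expKernel_nonneg (t : ℝ) (y : ℝ × ℝ) : 0 ≤ expKernel t y := by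
  unfold expKernel
  split_ifs <;> positivity

theorem expKernel_le_one (t : ℝ) {y : ℝ × ℝ} (hy : 0 ≤ y.1) : expKernel t y ≤ 1 := by
  unfold expKernel
  split_ifs with h
  · exact Real.exp_le_one_iff.2 (neg_nonpos.2 (mul_nonneg hy (sub_nonneg.2 h.le)))
  · exact zero_le_one

theorem measurable_expKernel : Measurable fun q : ℝ × (ℝ × ℝ) => expKernel q.1 q.2 := by
  unfold expKernel
  refine Measurable.ite (measurableSet_lt (by fun_prop) (by fun_prop)) (by fun_prop)
    measurable_const

/-- The mixing measure `2 λ^{2-2H} / Γ(2-2H) dλ` on `(0, ∞)`. -/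
def rateMeasure (H : ℝ) : Measure ℝ := (volume.restrict (Set.Ioi (0 : ℝ))).withDensity
  fun l => ENNReal.ofReal (2 / Real.Gamma (2 - 2 * H) * l ^ (2 - 2 * H))

instance sFinite_rateMeasure (H : ℝ) : SFinite (rateMeasure H) := by
  unfold rateMeasure; infer_instance

theorem lintegral_exp_inner {l t s : ℝ} (hl : 0 < l) :
    ∫⁻ v, ENNReal.ofReal (expKernel t (l, v) * expKernel s (l, v)) =
      ENNReal.ofReal (Real.exp (-(|t - s| * l)) / (2 * l)) := by
  have h1 : ∀ v, ENNReal.ofReal (expKernel t (l, v) * expKernel s (l, v)) =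
      (Set.Iio (min t s)).indicator
        (fun v => ENNReal.ofReal (Real.exp (-(l * (t + s))) * Real.exp (2 * l * v))) v := by
    intro v
    unfold expKernel
    by_cases hv : v < min t s
    · rw [lt_min_iff] at hv
      rw [Set.indicator_of_mem (by simpa using hv), if_pos hv.1, if_pos hv.2, ← Real.exp_add,
        ← Real.exp_add]
      congr 2
      ring
    · rw [Set.indicator_of_notMem (by simpa using hv)]
      rw [lt_min_iff, not_and_or] at hv
      rcases hv with h | h <;> simp [h]
  simp_rw [h1]
  rw [lintegral_indicator measurableSet_Iio, setLIntegral_congr Iio_ae_eq_Iic,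
    ← ofReal_integral_eq_lintegral_ofReal ((integrableOn_exp_mul_Iic (by positivity) _).const_mul _)
      (ae_of_all _ fun v => by positivity), integral_const_mul, integral_exp_mul_Iic (by positivity),
    ← mul_div_assoc, ← Real.exp_add]
  congr 3
  rcases le_total t s with h | h
  · rw [min_eq_left h, abs_of_nonpos (by linarith)]; ring
  · rw [min_eq_right h, abs_of_nonneg (by linarith)]; ring

/-- The kernel `|t - s|^{2H-2}` is a mixture of products of one-sided exponentials. -/
theorem lintegral_expKernel_mul {H : ℝ} (hH : H < 1) {t s : ℝ} (hts : t ≠ s) :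
    ∫⁻ y, ENNReal.ofReal (expKernel t y * expKernel s y) ∂((rateMeasure H).prod volume) =
      ENNReal.ofReal (|t - s| ^ (2 * H - 2)) := by
  have hG : 0 < Real.Gamma (2 - 2 * H) := Real.Gamma_pos_of_pos (by linarith)
  have hd : 0 < |t - s| := abs_pos.2 (sub_ne_zero.2 hts)
  have hm : ∀ t, Measurable fun y : ℝ × ℝ => expKernel t y := fun t =>
    measurable_expKernel.comp measurable_prodMk_left
  have hval := Real.integral_rpow_mul_exp_neg_mul_Ioi (a := 2 - 2 * H) (by linarith) hd
  have hint : IntegrableOn (fun l : ℝ => l ^ (2 - 2 * H - 1) * Real.exp (-(|t - s| * l)))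
      (Set.Ioi 0) := by
    by_contra hcon
    rw [integral_undef hcon] at hval
    have : 0 < (1 / |t - s|) ^ (2 - 2 * H) * Real.Gamma (2 - 2 * H) := by positivity
    exact this.ne hval
  have hint' := hint.const_mul (1 / Real.Gamma (2 - 2 * H))
  have hmp : Measurable fun y : ℝ × ℝ => ENNReal.ofReal (expKernel t y * expKernel s y) :=
    ((hm t).mul (hm s)).ennreal_ofReal
  rw [lintegral_prod _ hmp.aemeasurable]
  have hmi : Measurable fun l : ℝ =>
      ∫⁻ v, ENNReal.ofReal (expKernel t (l, v) * expKernel s (l, v)) :=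
    hmp.lintegral_prod_right'
  rw [rateMeasure, lintegral_withDensity_eq_lintegral_mul _ (by fun_prop) hmi]
  calc _ = ∫⁻ l in Set.Ioi (0 : ℝ), ENNReal.ofReal (1 / Real.Gamma (2 - 2 * H) *
        (l ^ (2 - 2 * H - 1) * Real.exp (-(|t - s| * l)))) := by
        refine setLIntegral_congr_fun measurableSet_Ioi fun l hl => ?_
        have hl' : (0 : ℝ) < l := hl
        simp only [Pi.mul_apply]
        rw [lintegral_exp_inner hl', ← ENNReal.ofReal_mul (by positivity), Real.rpow_sub_one hl'.ne']
        congr 1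
        field_simp
    _ = _ := by
        rw [← ofReal_integral_eq_lintegral_ofReal hint' ?_, integral_const_mul, hval]
        · congr 1
          rw [one_div, one_div, Real.inv_rpow hd.le, ← Real.rpow_neg hd.le, neg_sub,
            mul_comm (_ ^ _), ← mul_assoc, inv_mul_cancel₀ hG.ne', one_mul]
        · refine (ae_restrict_iff' measurableSet_Ioi).2 (ae_of_all _ fun l hl => ?_)
          have hl' : (0 : ℝ) < l := hl
          simp only [Pi.zero_apply]
          positivity

theorem ae_prod_ne : ∀ᵐ p ∂((volume.restrict (Set.Ici (0 : ℝ))).prod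
    (volume.restrict (Set.Ici (0 : ℝ)))), p.1 ≠ p.2 := by
  have hset : {p : ℝ × ℝ | ¬p.1 ≠ p.2} = Set.diagonal ℝ := by ext p; simp [Set.mem_diagonal_iff]
  rw [ae_iff, hset, Measure.measure_prod_null measurableSet_diagonal]
  refine ae_of_all _ fun x => ?_
  have : Prod.mk x ⁻¹' Set.diagonal ℝ = {x} := by
    ext y; simp [eq_comm]
  simp only [this]
  simp

theorem rateMeasure_Icc {H : ℝ} (hH : H < 1) {R : ℝ} (hR : 0 < R) :
    ENNReal.ofReal (2 / Real.Gamma (2 - 2 * H) * R ^ (3 - 2 * H)) ≤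
      rateMeasure H (Set.Icc R (2 * R)) ∧ rateMeasure H (Set.Icc R (2 * R)) < ⊤ := by
  have hG : 0 < Real.Gamma (2 - 2 * H) := Real.Gamma_pos_of_pos (by linarith)
  have hsub : Set.Icc R (2 * R) ∩ Set.Ioi 0 = Set.Icc R (2 * R) :=
    Set.inter_eq_left.2 fun x hx => lt_of_lt_of_le hR hx.1
  rw [rateMeasure, withDensity_apply _ measurableSet_Icc, Measure.restrict_restrict measurableSet_Icc,
    hsub]
  constructor
  · calc ENNReal.ofReal (2 / Real.Gamma (2 - 2 * H) * R ^ (3 - 2 * H))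
        = ENNReal.ofReal (2 / Real.Gamma (2 - 2 * H) * R ^ (2 - 2 * H)) *
            volume (Set.Icc R (2 * R)) := by
          rw [Real.volume_Icc, ← ENNReal.ofReal_mul (by positivity)]
          congr 1
          rw [show 3 - 2 * H = (2 - 2 * H) + 1 by ring, Real.rpow_add_one hR.ne']
          ring
      _ = ∫⁻ _l in Set.Icc R (2 * R),
            ENNReal.ofReal (2 / Real.Gamma (2 - 2 * H) * R ^ (2 - 2 * H)) := by
          rw [setLIntegral_const]
      _ ≤ _ := by
          refine setLIntegral_mono (by fun_prop) fun l hl => ENNReal.ofReal_le_ofReal ?_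
          gcongr
          · linarith
          · exact hl.1
  · calc _ ≤ ∫⁻ _l in Set.Icc R (2 * R),
            ENNReal.ofReal (2 / Real.Gamma (2 - 2 * H) * (2 * R) ^ (2 - 2 * H)) := by
          refine setLIntegral_mono (by fun_prop) fun l hl => ENNReal.ofReal_le_ofReal ?_
          have : 0 ≤ l := hR.le.trans hl.1
          gcongr
          · linarith
          · exact hl.2
      _ < ⊤ := by
          rw [setLIntegral_const]
          exact ENNReal.mul_lt_top ENNReal.ofReal_lt_top measure_Icc_lt_top

/-- Reproducing formula for the one-sided exponentials. -/
theorem integral_expKernel_mul {a : ℝ} (ha : 0 < a) {ψ ψ' : ℝ → ℂ}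
    (hψ : ∀ v, HasDerivAt ψ (ψ' v) v) (hψ' : Continuous ψ') (h0 : ψ 0 = 0) (h1 : ψ a = 0)
    {l t : ℝ} (ht : 0 ≤ t) :
    ∫ v, ((expKernel t (l, v) : ℝ) : ℂ) *
        (Set.Icc 0 a).indicator (fun v => (l : ℂ) * ψ v + ψ' v) v =
      (Set.Icc 0 a).indicator ψ t := by
  have hψc : Continuous ψ := continuous_iff_continuousAt.2 fun v => (hψ v).continuousAt
  set b := min t a with hb
  have hb0 : 0 ≤ b := le_min ht ha.le
  have hd : ∀ v, HasDerivAt (fun v : ℝ => Complex.exp (((-(l * (t - v)) : ℝ) : ℂ)) * ψ v)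
      (Complex.exp (((-(l * (t - v)) : ℝ) : ℂ)) * ((l : ℂ) * ψ v + ψ' v)) v := by
    intro v
    have h2 : HasDerivAt (fun v : ℝ => -(l * (t - v))) l v := by
      have := (((hasDerivAt_id v).const_sub t).const_mul l).neg
      simp only [mul_neg, mul_one, neg_neg] at this
      exact this
    have h3 := (h2.ofReal_comp.cexp).mul (hψ v)
    refine h3.congr_deriv ?_
    ring
  have hcong : ∫ v, ((expKernel t (l, v) : ℝ) : ℂ) *
        (Set.Icc 0 a).indicator (fun v => (l : ℂ) * ψ v + ψ' v) v =
      ∫ v in Set.Ioc 0 b,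
        Complex.exp (((-(l * (t - v)) : ℝ) : ℂ)) * ((l : ℂ) * ψ v + ψ' v) := by
    rw [← integral_indicator measurableSet_Ioc]
    have hne : ∀ c : ℝ, ∀ᵐ v : ℝ, v ≠ c := fun c => Measure.ae_ne volume c
    refine integral_congr_ae ?_
    filter_upwards [hne 0, hne t] with v hv0 hvt
    by_cases hv : v ∈ Set.Icc 0 a
    · rw [Set.indicator_of_mem hv]
      by_cases hv' : v < t
      · rw [Set.indicator_of_mem (Set.mem_Ioc.2 ⟨lt_of_le_of_ne hv.1 hv0.symm, le_min hv'.le hv.2⟩)]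
        simp [expKernel, hv']
      · rw [Set.indicator_of_notMem fun h => hv' (lt_of_le_of_ne (h.2.trans (min_le_left _ _)) hvt)]
        simp [expKernel, hv']
    · rw [Set.indicator_of_notMem hv, Set.indicator_of_notMem
        fun h => hv ⟨h.1.le, h.2.trans (min_le_right _ _)⟩, mul_zero]
  rw [hcong, ← intervalIntegral.integral_of_le hb0,
    intervalIntegral.integral_eq_sub_of_hasDerivAt (fun v _ => hd v)
      (Continuous.intervalIntegrable (by fun_prop) _ _), h0, mul_zero, sub_zero]
  rcases le_total t a with h | h
  · rw [hb, min_eq_left h, Set.indicator_of_mem (Set.mem_Icc.2 ⟨ht, h⟩)]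
    simp
  · rw [hb, min_eq_right h, h1, mul_zero]
    rcases h.eq_or_lt with h | h
    · rw [← h, Set.indicator_of_mem (Set.mem_Icc.2 ⟨ha.le, le_rfl⟩), h1]
    · rw [Set.indicator_of_notMem fun h' => not_lt.2 h'.2 h]

end ExponentialMixture

section TimeLowerBound

theorem enorm_integral_sq_le_timePairing_half {a B R : ℝ}
    {ψ : ℝ → ℂ} (hψc : Continuous ψ) (hb : ∀ v ∈ Set.Icc 0 a, ‖ψ v‖ ≤ B * R)
    {F : ℝ → ℂ} (hF : IsBoundedSupported F) :
    0 ≤ (timePairing (1 / 2) fun t s => F t * (starRingEnd ℂ) (F s)).re ∧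
    ‖∫ s in Set.Icc 0 a, F s * ψ s‖ₑ ^ 2 ≤ ENNReal.ofReal (a * B ^ 2 * R ^ 2) *
      ENNReal.ofReal (timePairing (1 / 2) fun t s => F t * (starRingEnd ℂ) (F s)).re := by
  have hpair : (timePairing (1 / 2) fun t s => F t * (starRingEnd ℂ) (F s)).re =
      ∫ t in Set.Ici (0 : ℝ), ‖F t‖ ^ 2 := by
    simp only [timePairing, if_true, Complex.mul_conj, Complex.normSq_eq_norm_sq]
    exact (congrArg Complex.re integral_ofReal).trans (Complex.ofReal_re _)
  have hint : IntegrableOn (fun t => ‖F t‖ ^ 2) (Set.Ici (0 : ℝ)) := by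
    have h := hF.integrable_timeMeasure le_rfl hF
    rw [timeMeasure, if_pos rfl, integrable_map_measure h.aestronglyMeasurable (by fun_prop)] at h
    refine h.norm.congr (ae_of_all _ fun t => ?_)
    simp [sq]
  rw [hpair]
  refine ⟨integral_nonneg fun t => by positivity, ?_⟩
  rw [ofReal_integral_eq_lintegral_ofReal hint (ae_of_all _ fun t => by positivity)]
  have h1 : ‖∫ s in Set.Icc 0 a, F s * ψ s‖ₑ ≤ ∫⁻ s in Set.Icc 0 a, ‖F s‖ₑ * ‖ψ s‖ₑ := by
    refine (enorm_integral_le_lintegral_enorm _).trans_eq ?_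
    simp_rw [enorm_mul]
  refine (pow_le_pow_left' h1 2).trans ((sq_lintegral_mul_le hF.measurable.enorm.aemeasurable
    hψc.measurable.enorm.aemeasurable).trans ?_)
  rw [mul_comm]
  refine mul_le_mul' ?_ ?_
  · calc ∫⁻ s in Set.Icc 0 a, ‖ψ s‖ₑ ^ 2 ≤ ∫⁻ _s in Set.Icc 0 a, ENNReal.ofReal ((B * R) ^ 2) := by
          refine setLIntegral_mono measurable_const fun s hs => ?_
          rw [← ofReal_norm, ← ENNReal.ofReal_pow (norm_nonneg _)]
          exact ENNReal.ofReal_le_ofReal (pow_le_pow_left₀ (norm_nonneg _) (hb s hs) 2)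
      _ = _ := by
          rw [setLIntegral_const, Real.volume_Icc, ← ENNReal.ofReal_mul (by positivity)]
          congr 1
          ring
  · calc ∫⁻ s in Set.Icc 0 a, ‖F s‖ₑ ^ 2 ≤ ∫⁻ s in Set.Ici (0 : ℝ), ‖F s‖ₑ ^ 2 :=
          lintegral_mono_set Set.Icc_subset_Ici_self
      _ = _ := by
          refine lintegral_congr fun s => ?_
          rw [ENNReal.ofReal_pow (norm_nonneg _), ofReal_norm]

theorem enorm_integral_sq_le_timePairing_of_half_lt {H a B R : ℝ} (hH : 1 / 2 < H) (hH1 : H < 1)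
    (ha : 0 < a) (hB : 0 ≤ B) (hR : 0 < R) {ψ ψ' : ℝ → ℂ} (hψ : ∀ v, HasDerivAt ψ (ψ' v) v)
    (hψ' : Continuous ψ') (h0 : ψ 0 = 0) (h1 : ψ a = 0) (hb : ∀ v ∈ Set.Icc 0 a, ‖ψ v‖ ≤ B * R)
    (hb' : ∀ v ∈ Set.Icc 0 a, ‖ψ' v‖ ≤ B * R ^ 2) {F : ℝ → ℂ} (hF : IsBoundedSupported F) :
    0 ≤ (timePairing H fun t s => F t * (starRingEnd ℂ) (F s)).re ∧
    ‖∫ s in Set.Icc 0 a, F s * ψ s‖ₑ ^ 2 ≤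
      ENNReal.ofReal (9 * Real.Gamma (2 - 2 * H) / 2 * (a * B ^ 2 * R ^ (1 + 2 * H))) *
      ENNReal.ofReal (timePairing H fun t s => F t * (starRingEnd ℂ) (F s)).re := by
  have hG : 0 < Real.Gamma (2 - 2 * H) := Real.Gamma_pos_of_pos (by linarith)
  have hψc : Continuous ψ := continuous_iff_continuousAt.2 fun v => (hψ v).continuousAt
  set μ : Measure ℝ := volume.restrict (Set.Ici (0 : ℝ)) with hμ
  set ν : Measure (ℝ × ℝ) := (rateMeasure H).prod volume with hν
  obtain ⟨hIlow, hItop⟩ := rateMeasure_Icc hH1 hR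
  set I : ℝ := (rateMeasure H (Set.Icc R (2 * R))).toReal with hI
  have hIlow' : 2 / Real.Gamma (2 - 2 * H) * R ^ (3 - 2 * H) ≤ I :=
    (ENNReal.ofReal_le_iff_le_toReal hItop.ne).1 hIlow
  have hlow0 : 0 < 2 / Real.Gamma (2 - 2 * H) * R ^ (3 - 2 * H) := by positivity
  have hI0 : 0 < I := lt_of_lt_of_le hlow0 hIlow'
  have hIe : rateMeasure H (Set.Icc R (2 * R)) = ENNReal.ofReal I :=
    (ENNReal.ofReal_toReal hItop.ne).symm
  set S : Set (ℝ × ℝ) := Set.Icc R (2 * R) ×ˢ Set.Icc 0 a with hS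
  have hSm : MeasurableSet S := measurableSet_Icc.prod measurableSet_Icc
  have hνS : ν S = ENNReal.ofReal (I * a) := by
    rw [hν, hS, Measure.prod_prod, hIe, Real.volume_Icc, sub_zero, ENNReal.ofReal_mul hI0.le]
  set g : ℝ × ℝ → ℂ := S.indicator fun y => ((1 / I : ℝ) : ℂ) * ((y.1 : ℂ) * ψ y.2 + ψ' y.2) with hg
  have hgm : Measurable g := by
    refine Measurable.indicator ?_ hSm
    fun_prop
  have hgb : ∀ y, ‖g y‖ ≤ 1 / I * (3 * B * R ^ 2) := by
    intro y
    by_cases hy : y ∈ S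
    · rw [hg, Set.indicator_of_mem hy, norm_mul, Complex.norm_real, Real.norm_of_nonneg (by positivity)]
      gcongr
      have hy1 : ‖(y.1 : ℂ)‖ ≤ 2 * R := by
        rw [Complex.norm_real, Real.norm_of_nonneg (hR.le.trans hy.1.1)]
        exact hy.1.2
      calc ‖(y.1 : ℂ) * ψ y.2 + ψ' y.2‖ ≤ ‖(y.1 : ℂ)‖ * ‖ψ y.2‖ + ‖ψ' y.2‖ := by
            rw [← norm_mul]; exact norm_add_le _ _
        _ ≤ 2 * R * (B * R) + B * R ^ 2 := by
            gcongr
            · exact hb _ hy.2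
            · exact hb' _ hy.2
        _ = 3 * B * R ^ 2 := by ring
    · rw [hg, Set.indicator_of_notMem hy, norm_zero]
      positivity
  have hg0 : ∀ y, y ∉ S → g y = 0 := fun y hy => Set.indicator_of_notMem hy _
  -- the mass of the representing function
  have hmass : ∫⁻ y, ‖g y‖ₑ ^ 2 ∂ν ≤
      ENNReal.ofReal (9 * Real.Gamma (2 - 2 * H) / 2 * (a * B ^ 2 * R ^ (1 + 2 * H))) := by
    calc ∫⁻ y, ‖g y‖ₑ ^ 2 ∂ν ≤ ∫⁻ y, S.indicator
          (fun _ => ENNReal.ofReal ((1 / I * (3 * B * R ^ 2)) ^ 2)) y ∂ν := by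
          refine lintegral_mono fun y => ?_
          by_cases hy : y ∈ S
          · rw [Set.indicator_of_mem hy, ← ofReal_norm, ← ENNReal.ofReal_pow (norm_nonneg _)]
            exact ENNReal.ofReal_le_ofReal (pow_le_pow_left₀ (norm_nonneg _) (hgb y) 2)
          · simp [hg0 y hy]
      _ = ENNReal.ofReal (9 * a * B ^ 2 * R ^ 4 / I) := by
          rw [lintegral_indicator hSm, setLIntegral_const, hνS, ← ENNReal.ofReal_mul (by positivity)]
          congr 1
          field_simp
          ring
      _ ≤ _ := by
          refine ENNReal.ofReal_le_ofReal ?_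
          calc 9 * a * B ^ 2 * R ^ 4 / I ≤
              9 * a * B ^ 2 * R ^ 4 / (2 / Real.Gamma (2 - 2 * H) * R ^ (3 - 2 * H)) := by gcongr
            _ = _ := by
                have h4 : R ^ 4 = R ^ (1 + 2 * H) * R ^ (3 - 2 * H) := by
                  rw [← Real.rpow_add hR, ← Real.rpow_natCast]
                  congr 1
                  push_cast
                  ring
                rw [h4]
                field_simp
  have hem : ∀ t, Measurable fun y : ℝ × ℝ => expKernel t y := fun t =>
    measurable_expKernel.comp measurable_prodMk_left
  have hyS : ∀ y ∈ S, 0 ≤ y.1 := fun y hy => hR.le.trans hy.1.1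
  have hegb : ∀ t y, ‖((expKernel t y : ℝ) : ℂ) * g y‖ ≤
      S.indicator (fun _ => 1 / I * (3 * B * R ^ 2)) y := by
    intro t y
    by_cases hy : y ∈ S
    · rw [Set.indicator_of_mem hy, norm_mul, Complex.norm_real,
        Real.norm_of_nonneg (expKernel_nonneg _ _)]
      exact (mul_le_of_le_one_left (norm_nonneg _) (expKernel_le_one t (hyS y hy))).trans (hgb y)
    · simp [hg0 y hy, Set.indicator_of_notMem hy]
  have hSint : Integrable (S.indicator fun _ => 1 / I * (3 * B * R ^ 2)) ν := by
    refine (integrable_indicator_iff hSm).2 (integrableOn_const ?_)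
    rw [hνS]; exact ENNReal.ofReal_ne_top
  have hrep : ∀ t, 0 ≤ t → ∫ y, ((expKernel t y : ℝ) : ℂ) * g y ∂ν = (Set.Icc 0 a).indicator ψ t := by
    intro t ht
    have hi : Integrable (fun y => ((expKernel t y : ℝ) : ℂ) * g y) ν := by
      refine hSint.mono' ?_ (ae_of_all _ (hegb t))
      exact ((Complex.measurable_ofReal.comp (hem t)).mul hgm).aestronglyMeasurable
    rw [hν, integral_prod _ hi]
    have hin : ∀ l, ∫ v, ((expKernel t (l, v) : ℝ) : ℂ) * g (l, v) =
        (Set.Icc R (2 * R)).indicator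
          (fun _ => ((1 / I : ℝ) : ℂ) * (Set.Icc 0 a).indicator ψ t) l := by
      intro l
      by_cases hl : l ∈ Set.Icc R (2 * R)
      · rw [Set.indicator_of_mem hl, ← integral_expKernel_mul ha hψ hψ' h0 h1 (l := l) ht,
          ← integral_const_mul]
        refine integral_congr_ae (ae_of_all _ fun v => ?_)
        simp only
        by_cases hv : v ∈ Set.Icc 0 a
        · rw [Set.indicator_of_mem hv, hg, Set.indicator_of_mem (Set.mk_mem_prod hl hv)]
          ring
        · rw [Set.indicator_of_notMem hv, hg0 _ fun h => hv h.2]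
          ring
      · rw [Set.indicator_of_notMem hl]
        refine integral_eq_zero_of_ae (ae_of_all _ fun v => ?_)
        simp [hg0 (l, v) fun h => hl h.1]
    simp_rw [hin]
    rw [integral_indicator measurableSet_Icc, setIntegral_const, measureReal_def, ← hI,
      Complex.real_smul, ← mul_assoc, ← Complex.ofReal_mul, mul_one_div_cancel hI0.ne',
      Complex.ofReal_one, one_mul]
  -- integrability needed for Fubini
  have hFF := hF.integrable_timeMeasure hH.le hF
  rw [timeMeasure, if_neg hH.ne'] at hFF
  have hkm : Measurable fun q : (ℝ × ℝ) × (ℝ × ℝ) =>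
      F q.1.1 * (starRingEnd ℂ) (F q.1.2) * ((expKernel q.1.1 q.2 * expKernel q.1.2 q.2 : ℝ) : ℂ) := by
    have e1 : Measurable fun q : (ℝ × ℝ) × (ℝ × ℝ) => expKernel q.1.1 q.2 :=
      measurable_expKernel.comp (by fun_prop : Measurable fun q : (ℝ × ℝ) × (ℝ × ℝ) => (q.1.1, q.2))
    have e2 : Measurable fun q : (ℝ × ℝ) × (ℝ × ℝ) => expKernel q.1.2 q.2 :=
      measurable_expKernel.comp (by fun_prop : Measurable fun q : (ℝ × ℝ) × (ℝ × ℝ) => (q.1.2, q.2))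
    refine ((hF.measurable.comp (by fun_prop)).mul
      (Complex.continuous_conj.measurable.comp (hF.measurable.comp (by fun_prop)))).mul ?_
    exact Complex.measurable_ofReal.comp (e1.mul e2)
  have hI1 : Integrable (fun q : (ℝ × ℝ) × (ℝ × ℝ) =>
      F q.1.1 * (starRingEnd ℂ) (F q.1.2) * ((expKernel q.1.1 q.2 * expKernel q.1.2 q.2 : ℝ) : ℂ))
      ((μ.prod μ).prod ν) := by
    refine ⟨hkm.aestronglyMeasurable, ?_⟩
    rw [hasFiniteIntegral_iff_enorm, lintegral_prod _ hkm.enorm.aemeasurable]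
    have hlt := hFF.2
    rw [hasFiniteIntegral_iff_enorm] at hlt
    refine lt_of_le_of_lt (le_of_eq ?_) hlt
    have hFm : Measurable fun p : ℝ × ℝ => ‖F p.1 * (starRingEnd ℂ) (F p.2)‖ₑ :=
      ((hF.measurable.comp measurable_fst).mul
        (Complex.continuous_conj.measurable.comp (hF.measurable.comp measurable_snd))).enorm
    rw [lintegral_withDensity_eq_lintegral_mul _ (measurable_abs_sub_rpow _) hFm]
    refine lintegral_congr_ae ?_
    filter_upwards [ae_prod_ne] with p hp
    simp only [Pi.mul_apply]
    have hmp : Measurable fun y : ℝ × ℝ => ENNReal.ofReal (expKernel p.1 y * expKernel p.2 y) :=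
      ((hem p.1).mul (hem p.2)).ennreal_ofReal
    rw [← lintegral_expKernel_mul hH1 hp, ← lintegral_mul_const'' _ hmp.aemeasurable]
    refine lintegral_congr fun y => ?_
    rw [enorm_mul (F p.1 * (starRingEnd ℂ) (F p.2)), mul_comm]
    congr 1
    rw [← ofReal_norm, Complex.norm_real,
      Real.norm_of_nonneg (mul_nonneg (expKernel_nonneg _ _) (expKernel_nonneg _ _))]
  obtain ⟨C, hC⟩ := hF.bounded
  obtain ⟨M, hM⟩ := hF.supported
  have hI2 : Integrable (fun q : ℝ × (ℝ × ℝ) => F q.1 * (((expKernel q.1 q.2 : ℝ) : ℂ) * g q.2))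
      (μ.prod ν) := by
    have hFi : Integrable F μ := by
      have hon : IntegrableOn F (Set.Icc (-M) M) μ := by
        refine Measure.integrableOn_of_bounded (M := C) ?_ hF.measurable.aestronglyMeasurable
          (ae_of_all _ fun p => hC p)
        exact (lt_of_le_of_lt (Measure.restrict_apply_le _ _) measure_Icc_lt_top).ne
      refine (integrableOn_iff_integrable_of_support_subset fun p hp => ?_).1 hon
      by_contra hcon
      exact hp (hM p hcon)
    refine (hFi.norm.mul_prod hSint).mono' ?_ (ae_of_all _ fun q => ?_)
    · exact ((hF.measurable.comp measurable_fst).mul ((Complex.measurable_ofReal.comp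
        measurable_expKernel).mul (hgm.comp measurable_snd))).aestronglyMeasurable
    · rw [norm_mul]
      exact mul_le_mul_of_nonneg_left (hegb q.1 q.2) (norm_nonneg _)
  have hgram := enorm_integral_sq_le_gram hF.measurable measurable_expKernel hgm hI1 hI2
  have hL : ∫ t, F t * ∫ y, ((expKernel t y : ℝ) : ℂ) * g y ∂ν ∂μ =
      ∫ s in Set.Icc 0 a, F s * ψ s := by
    have hsub : Set.Icc 0 a ∩ Set.Ici 0 = Set.Icc 0 a :=
      Set.inter_eq_left.2 Set.Icc_subset_Ici_self
    calc _ = ∫ t, (Set.Icc 0 a).indicator (fun s => F s * ψ s) t ∂μ := by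
          refine setIntegral_congr_fun measurableSet_Ici fun t ht => ?_
          rw [hrep t ht]
          by_cases h : t ∈ Set.Icc 0 a
          · rw [Set.indicator_of_mem h, Set.indicator_of_mem h]
          · rw [Set.indicator_of_notMem h, Set.indicator_of_notMem h, mul_zero]
      _ = _ := by
          rw [integral_indicator measurableSet_Icc, hμ, Measure.restrict_restrict measurableSet_Icc,
            hsub]
  have hR' : timePairing H (fun t s => F t * (starRingEnd ℂ) (F s)) =
      ∫ p, F p.1 * (starRingEnd ℂ) (F p.2) *
        ((∫ y, expKernel p.1 y * expKernel p.2 y ∂ν : ℝ) : ℂ) ∂(μ.prod μ) := by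
    rw [timePairing_eq_integral (hF.integrable_timeMeasure hH.le hF), timeMeasure, if_neg hH.ne',
      integral_withDensity_eq_integral_toReal_smul (measurable_abs_sub_rpow _)
        (ae_of_all _ fun _ => ENNReal.ofReal_lt_top)]
    refine integral_congr_ae ?_
    filter_upwards [ae_prod_ne] with p hp
    have : ∫ y, expKernel p.1 y * expKernel p.2 y ∂ν =
        (ENNReal.ofReal (|p.1 - p.2| ^ (2 * H - 2))).toReal := by
      rw [← lintegral_expKernel_mul hH1 hp, integral_eq_lintegral_of_nonneg_ae
        (ae_of_all _ fun y => mul_nonneg (expKernel_nonneg _ _) (expKernel_nonneg _ _))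
        ((hem p.1).mul (hem p.2)).aestronglyMeasurable]
    rw [this, Complex.real_smul, mul_comm]
  rw [hL, ← hR'] at hgram
  refine ⟨hgram.1, hgram.2.trans ?_⟩
  rw [mul_comm]
  gcongr

theorem enorm_integral_sq_le_timePairing {H a B R : ℝ} (hH : 1 / 2 ≤ H) (hH1 : H < 1)
    (ha : 0 < a) (hB : 0 ≤ B) (hR : 0 < R) {ψ ψ' : ℝ → ℂ} (hψ : ∀ v, HasDerivAt ψ (ψ' v) v)
    (hψ' : Continuous ψ') (h0 : ψ 0 = 0) (h1 : ψ a = 0) (hb : ∀ v ∈ Set.Icc 0 a, ‖ψ v‖ ≤ B * R)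
    (hb' : ∀ v ∈ Set.Icc 0 a, ‖ψ' v‖ ≤ B * R ^ 2) {F : ℝ → ℂ} (hF : IsBoundedSupported F) :
    0 ≤ (timePairing H fun t s => F t * (starRingEnd ℂ) (F s)).re ∧
    ‖∫ s in Set.Icc 0 a, F s * ψ s‖ₑ ^ 2 ≤
      ENNReal.ofReal (9 * Real.Gamma (2 - 2 * H) / 2 * (a * B ^ 2 * R ^ (1 + 2 * H))) *
      ENNReal.ofReal (timePairing H fun t s => F t * (starRingEnd ℂ) (F s)).re := by
  rcases hH.eq_or_lt with h | h
  · subst h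
    obtain ⟨hnn, hle⟩ := enorm_integral_sq_le_timePairing_half
      (continuous_iff_continuousAt.2 fun v => (hψ v).continuousAt) hb hF
    refine ⟨hnn, hle.trans ?_⟩
    refine mul_le_mul' (ENNReal.ofReal_le_ofReal ?_) le_rfl
    rw [show (2 : ℝ) - 2 * (1 / 2) = 1 by norm_num, Real.Gamma_one,
      show (1 : ℝ) + 2 * (1 / 2) = (2 : ℕ) by norm_num, Real.rpow_natCast]
    have : 0 ≤ a * B ^ 2 * R ^ 2 := by positivity
    linarith
  · exact enorm_integral_sq_le_timePairing_of_half_lt h hH1 ha hB hR hψ hψ' h0 h1 hb hb' hF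

end TimeLowerBound

section Probe

/-- A polynomial that vanishes to second order at both ends of `[0, a]`. -/
def window (a s : ℝ) : ℝ := s ^ 2 * (a - s) ^ 2

/-- The derivative of `window`. -/
def windowDeriv (a s : ℝ) : ℝ := 2 * s * (a - s) ^ 2 - 2 * s ^ 2 * (a - s)

/-- The second derivative of `window`. -/
def windowDerivTwo (a s : ℝ) : ℝ := 2 * (a - s) ^ 2 - 8 * s * (a - s) + 2 * s ^ 2

theorem hasDerivAt_window (a s : ℝ) : HasDerivAt (window a) (windowDeriv a s) s := by
  have h := ((hasDerivAt_id s).pow 2).mul (((hasDerivAt_id s).const_sub a).pow 2)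
  refine h.congr_deriv ?_
  simp only [windowDeriv, id_eq, Pi.pow_apply]
  norm_num
  ring

theorem hasDerivAt_windowDeriv (a s : ℝ) : HasDerivAt (windowDeriv a) (windowDerivTwo a s) s := by
  have h := (((hasDerivAt_id s).const_mul 2).mul (((hasDerivAt_id s).const_sub a).pow 2)).sub
    ((((hasDerivAt_id s).pow 2).const_mul 2).mul ((hasDerivAt_id s).const_sub a))
  refine h.congr_deriv ?_
  simp only [windowDerivTwo, id_eq, Pi.pow_apply]
  norm_num
  ring

/-- The test function in time that isolates the wave `e^{it r}`. -/
def probe (a r s : ℝ) : ℂ :=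
  Complex.exp (((s * r : ℝ) : ℂ) * Complex.I) *
    ((windowDeriv a s : ℂ) + 2 * Complex.I * (r : ℂ) * (window a s : ℂ))

/-- The derivative of `probe`. -/
def probeDeriv (a r s : ℝ) : ℂ :=
  Complex.exp (((s * r : ℝ) : ℂ) * Complex.I) *
    ((r : ℂ) * Complex.I * ((windowDeriv a s : ℂ) + 2 * Complex.I * (r : ℂ) * (window a s : ℂ)) +
      ((windowDerivTwo a s : ℂ) + 2 * Complex.I * (r : ℂ) * (windowDeriv a s : ℂ)))

theorem hasDerivAt_exp_mul_I (r s : ℝ) :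
    HasDerivAt (fun s : ℝ => Complex.exp (((s * r : ℝ) : ℂ) * Complex.I))
      (Complex.exp (((s * r : ℝ) : ℂ) * Complex.I) * ((r : ℂ) * Complex.I)) s := by
  have h1 : HasDerivAt (fun s : ℝ => s * r) r s := by
    have := (hasDerivAt_id s).mul_const r
    rw [one_mul] at this
    exact this
  exact (h1.ofReal_comp.mul_const Complex.I).cexp

theorem hasDerivAt_probe (a r s : ℝ) : HasDerivAt (probe a r) (probeDeriv a r s) s := by
  have h := (hasDerivAt_exp_mul_I r s).mul ((hasDerivAt_windowDeriv a s).ofReal_comp.add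
    ((hasDerivAt_window a s).ofReal_comp.const_mul (2 * Complex.I * (r : ℂ))))
  refine h.congr_deriv ?_
  simp only [probeDeriv, Pi.add_apply]
  ring

theorem continuous_probe (a r : ℝ) : Continuous (probe a r) := by
  unfold probe window windowDeriv; fun_prop

theorem continuous_probeDeriv (a r : ℝ) : Continuous (probeDeriv a r) := by
  unfold probeDeriv window windowDeriv windowDerivTwo; fun_prop

theorem exists_norm_probe_le (a : ℝ) : ∃ B, 0 ≤ B ∧ ∀ r, 0 ≤ r → ∀ s ∈ Set.Icc 0 a,
    ‖probe a r s‖ ≤ B * (1 + r) ∧ ‖probeDeriv a r s‖ ≤ B * (1 + r) ^ 2 := by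
  have hc0 : Continuous (window a) := by unfold window; fun_prop
  have hc1 : Continuous (windowDeriv a) := by unfold windowDeriv; fun_prop
  have hc2 : Continuous (windowDerivTwo a) := by unfold windowDerivTwo; fun_prop
  obtain ⟨B₀, h0⟩ := isCompact_Icc.exists_bound_of_continuousOn (s := Set.Icc 0 a) hc0.continuousOn
  obtain ⟨B₁, h1⟩ := isCompact_Icc.exists_bound_of_continuousOn (s := Set.Icc 0 a) hc1.continuousOn
  obtain ⟨B₂, h2⟩ := isCompact_Icc.exists_bound_of_continuousOn (s := Set.Icc 0 a) hc2.continuousOn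
  set B := |B₀| + |B₁| + |B₂| with hB
  have hB0 : 0 ≤ B := by positivity
  refine ⟨4 * B, by positivity, fun r hr s hs => ?_⟩
  have k0 : ‖(window a s : ℂ)‖ ≤ B := by
    rw [Complex.norm_real]
    linarith [h0 s hs, le_abs_self B₀, abs_nonneg B₁, abs_nonneg B₂]
  have k1 : ‖(windowDeriv a s : ℂ)‖ ≤ B := by
    rw [Complex.norm_real]
    linarith [h1 s hs, le_abs_self B₁, abs_nonneg B₀, abs_nonneg B₂]
  have k2 : ‖(windowDerivTwo a s : ℂ)‖ ≤ B := by
    rw [Complex.norm_real]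
    linarith [h2 s hs, le_abs_self B₂, abs_nonneg B₀, abs_nonneg B₁]
  have hnr : ‖(r : ℂ)‖ = r := by rw [Complex.norm_real, Real.norm_of_nonneg hr]
  have hA : ∀ x y : ℂ, ‖x‖ ≤ B → ‖y‖ ≤ B → ‖x + 2 * Complex.I * (r : ℂ) * y‖ ≤ B * (1 + 2 * r) := by
    intro x y hx hy
    calc ‖x + 2 * Complex.I * (r : ℂ) * y‖ ≤ ‖x‖ + ‖2 * Complex.I * (r : ℂ) * y‖ := norm_add_le _ _
      _ = ‖x‖ + 2 * r * ‖y‖ := by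
          rw [norm_mul, norm_mul, norm_mul, hnr, Complex.norm_I]
          norm_num
      _ ≤ B + 2 * r * B := by gcongr
      _ = _ := by ring
  constructor
  · rw [probe, norm_mul, Complex.norm_exp_ofReal_mul_I, one_mul]
    refine (hA _ _ k1 k0).trans ?_
    nlinarith
  · rw [probeDeriv, norm_mul, Complex.norm_exp_ofReal_mul_I, one_mul]
    calc _ ≤ r * (B * (1 + 2 * r)) + B * (1 + 2 * r) := by
          refine (norm_add_le _ _).trans (add_le_add ?_ (hA _ _ k2 k1))
          rw [norm_mul, norm_mul, hnr, Complex.norm_I, mul_one]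
          exact mul_le_mul_of_nonneg_left (hA _ _ k1 k0) hr
      _ ≤ _ := by nlinarith [mul_nonneg hB0 hr, mul_nonneg (mul_nonneg hB0 hr) hr]

theorem exists_enorm_integral_probe_sq_le {H a : ℝ} (hH : 1 / 2 ≤ H) (hH1 : H < 1) (ha : 0 < a) :
    ∃ C, 0 < C ∧ ∀ r, 0 ≤ r → ∀ F : ℝ → ℂ, IsBoundedSupported F →
      0 ≤ (timePairing H fun t s => F t * (starRingEnd ℂ) (F s)).re ∧
      ‖∫ s in Set.Icc 0 a, F s * probe a r s‖ₑ ^ 2 ≤ ENNReal.ofReal (C * (1 + r) ^ (1 + 2 * H)) *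
        ENNReal.ofReal (timePairing H fun t s => F t * (starRingEnd ℂ) (F s)).re := by
  obtain ⟨B, hB, hb⟩ := exists_norm_probe_le a
  have hG : 0 < Real.Gamma (2 - 2 * H) := Real.Gamma_pos_of_pos (by linarith)
  refine ⟨9 * Real.Gamma (2 - 2 * H) / 2 * (a * B ^ 2) + 1, by positivity, fun r hr F hF => ?_⟩
  obtain ⟨hnn, hle⟩ := enorm_integral_sq_le_timePairing hH hH1 ha hB (R := 1 + r) (by positivity)
    (hasDerivAt_probe a r) (continuous_probeDeriv a r) (by simp [probe, window, windowDeriv])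
    (by simp [probe, window, windowDeriv]) (fun v hv => (hb r hr v hv).1)
    (fun v hv => (hb r hr v hv).2) hF
  refine ⟨hnn, hle.trans ?_⟩
  refine mul_le_mul' (ENNReal.ofReal_le_ofReal ?_) le_rfl
  rw [← mul_assoc]
  gcongr
  linarith

/-- The total mass of the window. -/
def windowMass (a : ℝ) : ℝ := ∫ s in (0 : ℝ)..a, window a s

theorem windowMass_pos {a : ℝ} (ha : 0 < a) : 0 < windowMass a := by
  refine intervalIntegral.intervalIntegral_pos_of_pos_on
    (Continuous.intervalIntegrable (by unfold window; fun_prop) _ _) (fun s hs => ?_) ha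
  have h1 : 0 < s := hs.1
  have h2 : 0 < a - s := sub_pos.2 hs.2
  unfold window
  positivity

/-- The probe extracts a plane wave from the Green kernel. -/
theorem integral_greenFourier_mul_probe {N : ℕ} {a t : ℝ} (ha : 0 < a) (hat : a ≤ t)
    (x : EuclideanSpace ℝ (Fin N)) {ξ : EuclideanSpace ℝ (Fin N)} (hξ : ξ ≠ 0) :
    ∫ s in Set.Icc 0 a, greenFourier t x s ξ * probe a ‖ξ‖ s =
      (windowMass a : ℂ) *
        Complex.exp (((‖ξ‖ * t - inner ℝ x ξ : ℝ) : ℂ) * Complex.I) := by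
  set r := ‖ξ‖ with hr
  have hr0 : (r : ℂ) ≠ 0 := by
    rw [hr]; exact_mod_cast (norm_ne_zero_iff.2 hξ)
  set A : ℂ := Complex.exp (((t * r : ℝ) : ℂ) * Complex.I) with hA
  set A' : ℂ := Complex.exp (-((t * r : ℝ) : ℂ) * Complex.I) with hA'
  set X : ℂ := Complex.exp (-Complex.I * ((inner ℝ x ξ : ℝ) : ℂ)) with hX
  set e : ℝ → ℂ := fun s => Complex.exp (((s * r : ℝ) : ℂ) * Complex.I) with he
  set G : ℝ → ℂ := fun s => X * ((A - A' * (e s * e s)) / (2 * Complex.I * r) * (window a s : ℂ))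
    with hG
  have hderiv : ∀ s, HasDerivAt G
      (X * ((A - A' * (e s * e s)) / (2 * Complex.I * r) * (windowDeriv a s : ℂ)
        - A' * (e s * e s) * (window a s : ℂ))) s := by
    intro s
    have h1 := hasDerivAt_exp_mul_I r s
    have h2 := (((((h1.mul h1).const_mul A').const_sub A).div_const (2 * Complex.I * r)).mul
      (hasDerivAt_window a s).ofReal_comp).const_mul X
    refine h2.congr_deriv ?_
    simp only [he, Pi.mul_apply]
    field_simp
    ring
  have hint : ∀ s ∈ Set.Icc 0 a, greenFourier t x s ξ * probe a r s =
      (X * ((A - A' * (e s * e s)) / (2 * Complex.I * r) * (windowDeriv a s : ℂ)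
        - A' * (e s * e s) * (window a s : ℂ))) + X * A * (window a s : ℂ) := by
    intro s hs
    have hsin : ((Real.sin ((t - s) * r) : ℝ) : ℂ) * e s = (A - A' * (e s * e s)) / (2 * Complex.I) := by
      have h1 : Complex.exp (((((t - s) * r : ℝ) : ℂ)) * Complex.I) * e s = A := by
        rw [he, hA, ← Complex.exp_add]; congr 1; push_cast; ring
      have h2 : Complex.exp (-((((t - s) * r : ℝ) : ℂ)) * Complex.I) * e s = A' * (e s * e s) := by
        rw [he, hA', ← Complex.exp_add, ← Complex.exp_add, ← Complex.exp_add]; congr 1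
        push_cast; ring
      rw [Complex.ofReal_sin, Complex.sin, ← h1, ← h2]
      rw [div_eq_mul_inv _ (2 * Complex.I), mul_inv, Complex.inv_I]
      ring
    rw [greenFourier, Set.indicator_of_mem (Set.mem_Icc.2 ⟨hs.1, hs.2.trans hat⟩), waveKernelFourier,
      probe, ← hr, ← hX]
    push_cast [Complex.ofReal_div]
    have h3 : ∀ w : ℂ, X * (((Real.sin ((t - s) * r) : ℝ) : ℂ) / r) * (e s * w) =
        X * ((((Real.sin ((t - s) * r) : ℝ) : ℂ) * e s) / r * w) := fun w => by ring
    have h4 := h3 ((windowDeriv a s : ℂ) + 2 * Complex.I * (r : ℂ) * (window a s : ℂ))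
    rw [hsin] at h4
    simp only [he] at h4 ⊢
    push_cast at h4 ⊢
    rw [h4]
    field_simp
    ring
  rw [setIntegral_congr_fun measurableSet_Icc hint, integral_Icc_eq_integral_Ioc,
    ← intervalIntegral.integral_of_le ha.le, intervalIntegral.integral_add,
    intervalIntegral.integral_eq_sub_of_hasDerivAt (fun s _ => hderiv s),
    intervalIntegral.integral_const_mul, intervalIntegral.integral_ofReal]
  · have hGa : G a = 0 := by simp [hG, window]
    have hG0 : G 0 = 0 := by simp [hG, window]
    rw [hGa, hG0, sub_zero, zero_add, windowMass, hX, hA, ← Complex.exp_add, mul_comm]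
    congr 2
    push_cast
    ring
  all_goals
    refine Continuous.intervalIntegrable ?_ _ _
    try simp only [he]
    unfold window
    try unfold windowDeriv
    fun_prop

end Probe

section SpatialFourier

open scoped ContDiff Convolution

variable {N : ℕ}

theorem spatialFourier_eq_fourier (a : EuclideanSpace ℝ (Fin N) → ℂ) (ξ : EuclideanSpace ℝ (Fin N)) :
    spatialFourier a ξ = 𝓕 a ((2 * Real.pi)⁻¹ • ξ) := by
  rw [spatialFourier, Real.fourier_eq']
  refine integral_congr_ae (ae_of_all _ fun x => ?_)
  simp only [smul_eq_mul]
  congr 2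
  rw [inner_smul_right]
  push_cast
  have : (Real.pi : ℂ) ≠ 0 := by exact_mod_cast Real.pi_ne_zero
  field_simp

theorem spatialFourier_neg_conj (b : EuclideanSpace ℝ (Fin N) → ℝ) (ξ : EuclideanSpace ℝ (Fin N)) :
    spatialFourier (fun x => (b (-x) : ℂ)) ξ =
      (starRingEnd ℂ) (spatialFourier (fun x => (b x : ℂ)) ξ) := by
  rw [spatialFourier, spatialFourier, ← integral_conj, ← integral_neg_eq_self]
  refine integral_congr_ae (ae_of_all _ fun x => ?_)
  simp [← Complex.exp_conj]

theorem norm_spatialFourier_le (a : EuclideanSpace ℝ (Fin N) → ℂ) (ξ : EuclideanSpace ℝ (Fin N)) :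
    ‖spatialFourier a ξ‖ ≤ ∫ x, ‖a x‖ := by
  rw [spatialFourier]
  refine (norm_integral_le_integral_norm _).trans_eq ?_
  refine integral_congr_ae (ae_of_all _ fun x => ?_)
  simp only [norm_mul]
  rw [show -Complex.I * ((inner ℝ x ξ : ℝ) : ℂ) = ((-inner ℝ x ξ : ℝ) : ℂ) * Complex.I by
    push_cast; ring, Complex.norm_exp_ofReal_mul_I, one_mul]

/-- Plancherel's identity in the angular frequency normalization. -/
theorem integral_norm_sq_spatialFourier (a : 𝓢(EuclideanSpace ℝ (Fin N), ℂ)) :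
    Integrable (fun ξ => ‖spatialFourier (fun x => a x) ξ‖ ^ 2) ∧
    ∫ ξ, ‖spatialFourier (fun x => a x) ξ‖ ^ 2 = (2 * Real.pi) ^ N * ∫ x, ‖a x‖ ^ 2 := by
  have hpi : (2 * Real.pi)⁻¹ ≠ 0 := by positivity
  have h1 : ∀ ξ, ‖spatialFourier (fun x => a x) ξ‖ ^ 2 =
      (fun η => ‖(𝓕 a) η‖ ^ 2) ((2 * Real.pi)⁻¹ • ξ) := fun ξ => by
    rw [spatialFourier_eq_fourier]
    rfl
  have h2 : Integrable fun η => ‖(𝓕 a) η‖ ^ 2 := by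
    have := (𝓕 a).memLp 2 (μ := volume)
    exact this.integrable_norm_pow two_ne_zero
  simp_rw [h1]
  refine ⟨h2.comp_smul hpi, ?_⟩
  have h3 := Measure.integral_comp_smul volume
    (fun η : EuclideanSpace ℝ (Fin N) => ‖(𝓕 a : 𝓢(EuclideanSpace ℝ (Fin N), ℂ)) η‖ ^ 2)
    (2 * Real.pi)⁻¹
  refine h3.trans ?_
  rw [SchwartzMap.integral_norm_sq_fourier, finrank_euclideanSpace, Fintype.card_fin, smul_eq_mul]
  congr 1
  rw [inv_pow, inv_inv, abs_of_pos (by positivity)]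

/-- The spatial covariance in spectral form. -/
theorem IsSpatialCovariance.integral_integral_eq {β : ℝ} {f h : EuclideanSpace ℝ (Fin N) → ℝ}
    (hf : IsSpatialCovariance β f h) {a b : EuclideanSpace ℝ (Fin N) → ℝ} (ha : ContDiff ℝ ∞ a)
    (has : HasCompactSupport a) (hb : ContDiff ℝ ∞ b) (hbs : HasCompactSupport b) :
    ((∫ x, ∫ y, a x * f (x - y) * b y : ℝ) : ℂ) =
      ∫ ξ, (h ξ : ℂ) * (spatialFourier (fun x => (a x : ℂ)) ξ *
        (starRingEnd ℂ) (spatialFourier (fun x => (b x : ℂ)) ξ)) := by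
  have hac : ContDiff ℝ ∞ fun x => (a x : ℂ) := Complex.ofRealCLM.contDiff.comp ha
  have hbc : ContDiff ℝ ∞ fun x => (b (-x) : ℂ) := Complex.ofRealCLM.contDiff.comp (hb.comp contDiff_neg)
  have hacs : HasCompactSupport fun x => (a x : ℂ) := has.comp_left (g := fun r : ℝ => (r : ℂ)) (by simp)
  have hbn : HasCompactSupport fun x => b (-x) := hbs.comp_homeomorph (Homeomorph.neg _)
  have hbcs : HasCompactSupport fun x => (b (-x) : ℂ) :=
    hbn.comp_left (g := fun r : ℝ => (r : ℂ)) (by simp)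
  set A : 𝓢(EuclideanSpace ℝ (Fin N), ℂ) := hacs.toSchwartzMap hac with hA
  set B : 𝓢(EuclideanSpace ℝ (Fin N), ℂ) := hbcs.toSchwartzMap hbc with hB
  have hAx : ∀ x, A x = (a x : ℂ) := fun _ => rfl
  have hBx : ∀ x, B x = (b (-x) : ℂ) := fun _ => rfl
  set Θ := SchwartzMap.convolution (ContinuousLinearMap.mul ℂ ℂ) A B with hΘ
  have hΘx : ∀ y, Θ y = ∫ x, (a x : ℂ) * (b (x - y) : ℂ) := by
    intro y
    rw [hΘ, SchwartzMap.convolution_apply, convolution]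
    simp only [ContinuousLinearMap.mul_apply', hAx, hBx, neg_sub]
  have hΘf : ∀ ξ, spatialFourier (fun x => Θ x) ξ = spatialFourier (fun x => (a x : ℂ)) ξ *
        (starRingEnd ℂ) (spatialFourier (fun x => (b x : ℂ)) ξ) := by
    intro ξ
    rw [← spatialFourier_neg_conj, spatialFourier_eq_fourier, spatialFourier_eq_fourier,
      spatialFourier_eq_fourier]
    have h1 := SchwartzMap.fourier_convolution_apply (ContinuousLinearMap.mul ℂ ℂ) A B
      ((2 * Real.pi)⁻¹ • ξ)
    rw [Real.fourier_mul_convolution_eq A.integrable B.integrable] at h1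
    exact h1
  have hmain := hf.integral_mul Θ
  simp_rw [hΘf] at hmain
  have hcast : ((∫ x, ∫ y, a x * f (x - y) * b y : ℝ) : ℂ) =
      ∫ x, ∫ y, (a x : ℂ) * (f y : ℂ) * (b (x - y) : ℂ) := by
    rw [← integral_complex_ofReal]
    refine integral_congr_ae (ae_of_all _ fun x => ?_)
    simp only
    rw [← integral_complex_ofReal, ← integral_sub_left_eq_self _ volume x]
    refine integral_congr_ae (ae_of_all _ fun y => ?_)
    simp
  rw [hcast]
  -- a cut-off that makes `f` integrable
  obtain ⟨r₁, hr₁⟩ := has.isCompact.isBounded.subset_closedBall 0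
  obtain ⟨r₂, hr₂⟩ := hbs.isCompact.isBounded.subset_closedBall 0
  set R : ℝ := |r₁| + |r₂| + 1 with hR
  have hR0 : 0 < R := by positivity
  set η : ContDiffBump (0 : EuclideanSpace ℝ (Fin N)) := ⟨R, R + 1, hR0, by linarith⟩ with hη
  have hηc : ContDiff ℝ ∞ fun x => ((η x : ℝ) : ℂ) := Complex.ofRealCLM.contDiff.comp η.contDiff
  have hηs : HasCompactSupport fun x => ((η x : ℝ) : ℂ) :=
    η.hasCompactSupport.comp_left (g := fun r : ℝ => (r : ℂ)) (by simp)
  have hfη : Integrable fun y => (f y : ℂ) * ((η y : ℝ) : ℂ) :=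
    hf.integrable_mul (hηs.toSchwartzMap hηc)
  have hcut : ∀ x y, (a x : ℂ) * (f y : ℂ) * (b (x - y) : ℂ) =
      (a x : ℂ) * ((f y : ℂ) * ((η y : ℝ) : ℂ)) * (b (x - y) : ℂ) := by
    intro x y
    by_cases hax : a x = 0
    · simp [hax]
    by_cases hbx : b (x - y) = 0
    · simp [hbx]
    have h1 : ‖x‖ ≤ |r₁| := by
      have := hr₁ (subset_tsupport a hax)
      rw [mem_closedBall_zero_iff] at this
      exact this.trans (le_abs_self _)
    have h2 : ‖x - y‖ ≤ |r₂| := by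
      have := hr₂ (subset_tsupport b hbx)
      rw [mem_closedBall_zero_iff] at this
      exact this.trans (le_abs_self _)
    have h3 : η y = 1 := by
      refine η.one_of_mem_closedBall ?_
      rw [mem_closedBall_zero_iff]
      have : ‖y‖ ≤ ‖x‖ + ‖x - y‖ := by
        calc ‖y‖ = ‖x - (x - y)‖ := by rw [sub_sub_cancel]
          _ ≤ _ := norm_sub_le _ _
      change ‖y‖ ≤ R
      linarith
    rw [h3]
    simp
  obtain ⟨Cb, hCb⟩ := hbs.exists_bound_of_continuous hb.continuous
  have hint : Integrable (Function.uncurry fun x y : EuclideanSpace ℝ (Fin N) =>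
      (a x : ℂ) * (f y : ℂ) * (b (x - y) : ℂ)) (volume.prod volume) := by
    simp_rw [hcut]
    have h1 := (A.integrable (μ := volume)).mul_prod hfη
    refine h1.mul_bdd (c := Cb) ?_ (ae_of_all _ fun p => ?_)
    · have : Continuous fun p : EuclideanSpace ℝ (Fin N) × EuclideanSpace ℝ (Fin N) =>
          ((b (p.1 - p.2) : ℝ) : ℂ) := by
        have := hb.continuous
        fun_prop
      exact this.aestronglyMeasurable
    · rw [Complex.norm_real]
      exact hCb _
  rw [integral_integral_swap hint]
  calc ∫ y, ∫ x, (a x : ℂ) * (f y : ℂ) * (b (x - y) : ℂ) = ∫ y, (f y : ℂ) * Θ y := by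
        refine integral_congr_ae (ae_of_all _ fun y => ?_)
        simp only
        rw [hΘx, ← integral_const_mul]
        refine integral_congr_ae (ae_of_all _ fun x => ?_)
        ring
    _ = _ := by
        rw [hmain]
        refine integral_congr_ae (ae_of_all _ fun ξ => ?_)
        ring

theorem integrableOn_norm_rpow_neg {β : ℝ} (hN : 0 < N) (hβN : β < N) :
    Integrable ((Metric.ball (0 : EuclideanSpace ℝ (Fin N)) 1).indicator fun ξ => ‖ξ‖ ^ (-β)) := by
  have : Nontrivial (EuclideanSpace ℝ (Fin N)) := by
    have : Nonempty (Fin N) := ⟨⟨0, hN⟩⟩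
    infer_instance
  set F : ℝ → ℝ := (Set.Iio 1).indicator fun ρ => ρ ^ (-β) with hF
  have hrw : ((Metric.ball (0 : EuclideanSpace ℝ (Fin N)) 1).indicator fun ξ => ‖ξ‖ ^ (-β)) =
      fun ξ => F ‖ξ‖ := by
    ext ξ
    by_cases h : ‖ξ‖ < 1
    · rw [Set.indicator_of_mem (by simpa using h), hF, Set.indicator_of_mem (by simpa using h)]
    · rw [Set.indicator_of_notMem (by simpa using h), hF, Set.indicator_of_notMem (by simpa using h)]
  rw [hrw, integrable_fun_norm_addHaar, finrank_euclideanSpace, Fintype.card_fin]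
  have h1 : IntegrableOn (fun ρ : ℝ => ρ ^ ((N : ℝ) - 1 - β)) (Set.Ioc 0 1) := by
    have := intervalIntegral.intervalIntegrable_rpow' (a := 0) (b := 1) (r := (N : ℝ) - 1 - β)
      (by linarith)
    rwa [intervalIntegrable_iff_integrableOn_Ioc_of_le zero_le_one] at this
  have h2 : Integrable ((Set.Ioo 0 1).indicator fun ρ : ℝ => ρ ^ ((N : ℝ) - 1 - β)) :=
    (integrable_indicator_iff measurableSet_Ioo).2 (h1.mono_set Set.Ioo_subset_Ioc_self)
  refine (h2.integrableOn (s := Set.Ioi 0)).congr_fun (fun ρ hρ => ?_) measurableSet_Ioi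
  have hρ' : (0 : ℝ) < ρ := hρ
  by_cases h : ρ < 1
  · rw [hF, Set.indicator_of_mem (Set.mem_Ioo.2 ⟨hρ', h⟩)]
    simp only [Set.indicator_of_mem (Set.mem_Iio.2 h), smul_eq_mul]
    rw [← Real.rpow_natCast, ← Real.rpow_add hρ', Nat.cast_sub hN]
    congr 1
    push_cast
    ring
  · rw [hF, Set.indicator_of_notMem fun h' => h h'.2]
    simp [Set.indicator_of_notMem (show ρ ∉ Set.Iio 1 from h)]

end SpatialFourier

section SpectralCovariance

open scoped ContDiff

variable {N : ℕ}

theorem exists_test_bounds (φ : Test N) : ∃ C M : ℝ, 0 ≤ C ∧ 0 ≤ M ∧ (∀ p, |φ p| ≤ C) ∧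
    ∀ p, φ p ≠ 0 → p.1 ∈ Set.Icc (-M) M ∧ p.2 ∈ Metric.closedBall 0 M := by
  obtain ⟨C, hC⟩ := φ.hasCompactSupport.exists_bound_of_continuous φ.continuous
  obtain ⟨M, hM⟩ := φ.hasCompactSupport.isCompact.isBounded.subset_closedBall 0
  refine ⟨C, |M|, (norm_nonneg _).trans (hC 0), abs_nonneg _, hC, fun p hp => ?_⟩
  have h1 := hM (subset_tsupport φ hp)
  rw [mem_closedBall_zero_iff] at h1
  have h2 : ‖p.1‖ ≤ |M| := (norm_fst_le p).trans (h1.trans (le_abs_self _))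
  have h3 : ‖p.2‖ ≤ |M| := (norm_snd_le p).trans (h1.trans (le_abs_self _))
  exact ⟨abs_le.1 h2, mem_closedBall_zero_iff.2 h3⟩

theorem contDiff_slice (φ : Test N) (t : ℝ) : ContDiff ℝ ∞ fun x => φ (t, x) :=
  φ.contDiff.comp (contDiff_prodMk_right t)

theorem hasCompactSupport_slice (φ : Test N) (t : ℝ) : HasCompactSupport fun x => φ (t, x) := by
  obtain ⟨C, M, -, -, -, hM⟩ := exists_test_bounds φ
  refine HasCompactSupport.intro (isCompact_closedBall 0 M) fun x hx => ?_
  by_contra hcon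
  exact hx (hM (t, x) hcon).2

/-- The time slice of a test function, as a complex Schwartz function. -/
def slice (φ : Test N) (t : ℝ) : 𝓢(EuclideanSpace ℝ (Fin N), ℂ) :=
  HasCompactSupport.toSchwartzMap (f := fun x => (φ (t, x) : ℂ))
    ((hasCompactSupport_slice φ t).comp_left (g := fun r : ℝ => (r : ℂ)) (by simp))
    (Complex.ofRealCLM.contDiff.comp (contDiff_slice φ t))

theorem measurable_testFourier (φ : Test N) :
    Measurable fun q : ℝ × EuclideanSpace ℝ (Fin N) => testFourier φ q.1 q.2 := by
  have hφ := φ.continuous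
  have h : Continuous fun q : (ℝ × EuclideanSpace ℝ (Fin N)) × EuclideanSpace ℝ (Fin N) =>
      Complex.exp (-Complex.I * ((inner ℝ q.2 q.1.2 : ℝ) : ℂ)) * ((φ (q.1.1, q.2) : ℝ) : ℂ) := by
    have : Continuous fun q : (ℝ × EuclideanSpace ℝ (Fin N)) × EuclideanSpace ℝ (Fin N) =>
        inner ℝ q.2 q.1.2 := continuous_snd.inner (by fun_prop)
    fun_prop
  have h2 : StronglyMeasurable _ := h.stronglyMeasurable
  exact (h2.integral_prod_right' (ν := volume)).measurable

/-- Uniform bounds on the spatial Fourier transform of a test function. -/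
theorem exists_testFourier_bounds (φ : Test N) : ∃ K M : ℝ, 0 ≤ K ∧ 0 ≤ M ∧
    (∀ t ξ, ‖testFourier φ t ξ‖ ≤ K) ∧ (∀ t ξ, t ∉ Set.Icc (-M) M → testFourier φ t ξ = 0) ∧
    ∀ t, Integrable (fun ξ => ‖testFourier φ t ξ‖ ^ 2) ∧ ∫ ξ, ‖testFourier φ t ξ‖ ^ 2 ≤ K := by
  obtain ⟨C, M, hC0, hM0, hC, hM⟩ := exists_test_bounds φ
  set V := volume.real (Metric.closedBall (0 : EuclideanSpace ℝ (Fin N)) M) with hV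
  have hVfin : volume (Metric.closedBall (0 : EuclideanSpace ℝ (Fin N)) M) ≠ ⊤ :=
    measure_closedBall_lt_top.ne
  have hpow : ∀ (n : ℕ), n ≠ 0 → ∀ t, ∫ x, ‖(φ (t, x) : ℂ)‖ ^ n ≤ C ^ n * V := by
    intro n hn t
    have h0 : ∀ x, x ∉ Metric.closedBall (0 : EuclideanSpace ℝ (Fin N)) M →
        ‖(φ (t, x) : ℂ)‖ ^ n = 0 := by
      intro x hx
      have : φ (t, x) = 0 := by
        by_contra hcon
        exact hx (hM (t, x) hcon).2
      simp [this, hn]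
    rw [← setIntegral_eq_integral_of_forall_compl_eq_zero (fun x hx => h0 x hx)]
    refine (le_abs_self _).trans ?_
    rw [← Real.norm_eq_abs]
    refine norm_setIntegral_le_of_norm_le_const hVfin.lt_top fun x _ => ?_
    rw [norm_pow, norm_norm, Complex.norm_real]
    exact pow_le_pow_left₀ (norm_nonneg _) (hC _) n
  set K := C * V + (2 * Real.pi) ^ N * (C ^ 2 * V) with hK
  have hV0 : 0 ≤ V := measureReal_nonneg
  refine ⟨K, M, by positivity, hM0, fun t ξ => ?_, fun t ξ ht => ?_, fun t => ?_⟩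
  · refine (norm_spatialFourier_le _ _).trans ?_
    have h1 := hpow 1 one_ne_zero t
    simp only [pow_one] at h1
    have : 0 ≤ (2 * Real.pi) ^ N * (C ^ 2 * V) := by positivity
    linarith
  · rw [testFourier, spatialFourier]
    refine integral_eq_zero_of_ae (ae_of_all _ fun x => ?_)
    have : φ (t, x) = 0 := by
      by_contra hcon
      exact ht (hM (t, x) hcon).1
    simp [this]
  · have h := integral_norm_sq_spatialFourier (slice φ t)
    refine ⟨h.1, ?_⟩
    have h2 : ∫ ξ, ‖testFourier φ t ξ‖ ^ 2 = (2 * Real.pi) ^ N * ∫ x, ‖(φ (t, x) : ℂ)‖ ^ 2 := h.2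
    rw [h2]
    have h3 := mul_le_mul_of_nonneg_left (hpow 2 two_ne_zero t)
      (by positivity : 0 ≤ (2 * Real.pi) ^ N)
    have : 0 ≤ C * V := by positivity
    linarith

theorem isBoundedSupported_testFourier (φ : Test N) (ξ : EuclideanSpace ℝ (Fin N)) :
    IsBoundedSupported fun t => testFourier φ t ξ := by
  obtain ⟨K, M, -, -, hK, hM, -⟩ := exists_testFourier_bounds φ
  refine ⟨?_, ⟨K, fun t => hK t ξ⟩, ⟨M, fun t ht => hM t ξ ht⟩⟩
  have h := (measurable_testFourier φ).comp (measurable_prodMk_right (y := ξ))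
  simpa only [Function.comp_def] using h

theorem IsSpatialCovariance.density_nonneg {β : ℝ} {f h : EuclideanSpace ℝ (Fin N) → ℝ}
    (hf : IsSpatialCovariance β f h) : ∀ᵐ ξ, 0 ≤ h ξ := by
  obtain ⟨C₁, C₂, h1, -, hae⟩ := hf.comparable
  filter_upwards [hae] with ξ hξ
  exact le_trans (by positivity) hξ.1

/-- Absolute convergence of the spectral integral of two test functions. -/
theorem IsSpatialCovariance.integrable_spectral {β : ℝ} {f h : EuclideanSpace ℝ (Fin N) → ℝ}
    (hf : IsSpatialCovariance β f h) (hβ0 : 0 < β) (hβN : β < N) {H : ℝ} (hH : 1 / 2 ≤ H)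
    (φ ψ : Test N) :
    Integrable (fun q : (ℝ × ℝ) × EuclideanSpace ℝ (Fin N) =>
      (h q.2 : ℂ) * (testFourier φ q.1.1 q.2 * (starRingEnd ℂ) (testFourier ψ q.1.2 q.2)))
      ((timeMeasure H).prod volume) := by
  have hN : 0 < N := by
    have : (0 : ℝ) < N := hβ0.trans hβN
    exact_mod_cast this
  obtain ⟨K, M, hK0, hM0, hKb, hMs, hK2⟩ := exists_testFourier_bounds φ
  obtain ⟨K', M', hK'0, hM'0, hKb', hMs', hK2'⟩ := exists_testFourier_bounds ψ
  obtain ⟨C₁, C₂, hC1, hC2, hae⟩ := hf.comparable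
  set D : ℝ := max M M' with hD
  set J : ℝ := ∫ ξ : EuclideanSpace ℝ (Fin N),
    (Metric.ball (0 : EuclideanSpace ℝ (Fin N)) 1).indicator (fun ξ => ‖ξ‖ ^ (-β)) ξ with hJ
  have hJi := integrableOn_norm_rpow_neg hN hβN
  have hmeas : Measurable fun q : (ℝ × ℝ) × EuclideanSpace ℝ (Fin N) =>
      (h q.2 : ℂ) * (testFourier φ q.1.1 q.2 * (starRingEnd ℂ) (testFourier ψ q.1.2 q.2)) := by
    have e1 := (measurable_testFourier φ).comp
      (by fun_prop : Measurable fun q : (ℝ × ℝ) × EuclideanSpace ℝ (Fin N) => (q.1.1, q.2))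
    have e2 := (measurable_testFourier ψ).comp
      (by fun_prop : Measurable fun q : (ℝ × ℝ) × EuclideanSpace ℝ (Fin N) => (q.1.2, q.2))
    have e3 := Complex.measurable_ofReal.comp (hf.measurable_density.comp
      (measurable_snd : Measurable fun q : (ℝ × ℝ) × EuclideanSpace ℝ (Fin N) => q.2))
    have e4 := e3.mul (e1.mul (Complex.continuous_conj.measurable.comp e2))
    exact e4
  refine ⟨hmeas.aestronglyMeasurable, ?_⟩
  rw [hasFiniteIntegral_iff_enorm, lintegral_prod _ hmeas.enorm.aemeasurable]
  set L : ℝ := C₂ * (J * (K * K') + (K + K')) with hL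
  have hbox : MeasurableSet (Set.Icc (-D) D ×ˢ Set.Icc (-D) D) :=
    measurableSet_Icc.prod measurableSet_Icc
  calc _ ≤ ∫⁻ p, (Set.Icc (-D) D ×ˢ Set.Icc (-D) D).indicator (fun _ => ENNReal.ofReal L) p
        ∂(timeMeasure H) := by
        refine lintegral_mono fun p => ?_
        by_cases hp : p ∈ Set.Icc (-D) D ×ˢ Set.Icc (-D) D
        · rw [Set.indicator_of_mem hp]
          set Q : EuclideanSpace ℝ (Fin N) → ℝ := fun ξ =>
            C₂ * ((Metric.ball (0 : EuclideanSpace ℝ (Fin N)) 1).indicator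
              (fun ξ => ‖ξ‖ ^ (-β)) ξ * (K * K') +
              (‖testFourier φ p.1 ξ‖ ^ 2 + ‖testFourier ψ p.2 ξ‖ ^ 2)) with hQ
          have hQi : Integrable Q :=
            ((hJi.mul_const _).add ((hK2 p.1).1.add (hK2' p.2).1)).const_mul _
          have hQ0 : ∀ ξ, 0 ≤ Q ξ := by
            intro ξ
            have : 0 ≤ (Metric.ball (0 : EuclideanSpace ℝ (Fin N)) 1).indicator
              (fun ξ => ‖ξ‖ ^ (-β)) ξ := Set.indicator_nonneg (fun _ _ => by positivity) _
            simp only [hQ]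
            positivity
          have hQle : ∫ ξ, Q ξ ≤ L := by
            have hval : ∫ ξ, Q ξ = C₂ * (J * (K * K') +
                ((∫ ξ, ‖testFourier φ p.1 ξ‖ ^ 2) + ∫ ξ, ‖testFourier ψ p.2 ξ‖ ^ 2)) := by
              have hs : Integrable fun ξ =>
                  ‖testFourier φ p.1 ξ‖ ^ 2 + ‖testFourier ψ p.2 ξ‖ ^ 2 :=
                (hK2 p.1).1.add (hK2' p.2).1
              simp only [hQ]
              rw [integral_const_mul, integral_add (hJi.mul_const _) hs,
                integral_mul_const, integral_add (hK2 p.1).1 (hK2' p.2).1]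
            rw [hval, hL]
            gcongr
            · exact (hK2 p.1).2
            · exact (hK2' p.2).2
          calc _ ≤ ∫⁻ ξ, ENNReal.ofReal (Q ξ) := by
                refine lintegral_mono_ae ?_
                filter_upwards [hae, hf.density_nonneg] with ξ hξ hξ0
                rw [← ofReal_norm]
                refine ENNReal.ofReal_le_ofReal ?_
                rw [norm_mul, norm_mul, RCLike.norm_conj, Complex.norm_real, Real.norm_of_nonneg hξ0]
                set x := ‖testFourier φ p.1 ξ‖ with hx
                set y := ‖testFourier ψ p.2 ξ‖ with hy
                have hx0 : 0 ≤ x := norm_nonneg _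
                have hy0 : 0 ≤ y := norm_nonneg _
                have hxK : x ≤ K := hKb _ _
                have hyK : y ≤ K' := hKb' _ _
                by_cases hb : ξ ∈ Metric.ball (0 : EuclideanSpace ℝ (Fin N)) 1
                · simp only [hQ, Set.indicator_of_mem hb]
                  have h1 : h ξ * (x * y) ≤ C₂ * ‖ξ‖ ^ (-β) * (K * K') := by
                    gcongr
                    exact hξ.2
                  have h2 : 0 ≤ C₂ * (x ^ 2 + y ^ 2) := by positivity
                  linarith
                · simp only [hQ, Set.indicator_of_notMem hb, zero_mul, zero_add]
                  have h3 : ‖ξ‖ ^ (-β) ≤ 1 := by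
                    refine Real.rpow_le_one_of_one_le_of_nonpos ?_ (by linarith)
                    simpa using hb
                  have h4 : h ξ ≤ C₂ := hξ.2.trans (mul_le_of_le_one_right hC2.le h3)
                  have h5 : x * y ≤ x ^ 2 + y ^ 2 := by nlinarith [sq_nonneg (x - y)]
                  exact mul_le_mul h4 h5 (by positivity) hC2.le
            _ = ENNReal.ofReal (∫ ξ, Q ξ) :=
                (ofReal_integral_eq_lintegral_ofReal hQi (ae_of_all _ hQ0)).symm
            _ ≤ ENNReal.ofReal L := ENNReal.ofReal_le_ofReal hQle
        · rw [Set.indicator_of_notMem hp]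
          refine (lintegral_eq_zero_of_ae_eq_zero (ae_of_all _ fun ξ => ?_)).le
          simp only [Set.mem_prod, not_and_or] at hp
          rcases hp with hp | hp
          · have : p.1 ∉ Set.Icc (-M) M := fun h' => hp
              ⟨by linarith [h'.1, le_max_left M M'], by linarith [h'.2, le_max_left M M']⟩
            simp [hMs _ ξ this]
          · have : p.2 ∉ Set.Icc (-M') M' := fun h' => hp
              ⟨by linarith [h'.1, le_max_right M M'], by linarith [h'.2, le_max_right M M']⟩
            simp [hMs' _ ξ this]
    _ = ENNReal.ofReal L * timeMeasure H (Set.Icc (-D) D ×ˢ Set.Icc (-D) D) := by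
        rw [lintegral_indicator hbox, setLIntegral_const]
    _ < ⊤ := ENNReal.mul_lt_top ENNReal.ofReal_lt_top (timeMeasure_box_lt_top hH D)

/-- The covariance of the noise in spectral form. -/
theorem noiseCovariance_eq_spectral {β : ℝ} {f h : EuclideanSpace ℝ (Fin N) → ℝ}
    (hf : IsSpatialCovariance β f h) (hβ0 : 0 < β) (hβN : β < N) {H : ℝ} (hH : 1 / 2 ≤ H)
    (φ ψ : Test N) :
    Integrable (fun ξ => (h ξ : ℂ) * timePairing H fun t s =>
      testFourier φ t ξ * (starRingEnd ℂ) (testFourier ψ s ξ)) ∧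
    ((noiseCovariance H f φ ψ : ℝ) : ℂ) = ∫ ξ, (h ξ : ℂ) * timePairing H fun t s =>
      testFourier φ t ξ * (starRingEnd ℂ) (testFourier ψ s ξ) := by
  have hint := hf.integrable_spectral hβ0 hβN hH φ ψ
  have hpair : ∀ ξ, (h ξ : ℂ) * timePairing H (fun t s =>
      testFourier φ t ξ * (starRingEnd ℂ) (testFourier ψ s ξ)) =
      ∫ p, (h ξ : ℂ) * (testFourier φ p.1 ξ * (starRingEnd ℂ) (testFourier ψ p.2 ξ))
        ∂(timeMeasure H) := by
    intro ξ
    rw [timePairing_eq_integral ((isBoundedSupported_testFourier φ ξ).integrable_timeMeasure hH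
      (isBoundedSupported_testFourier ψ ξ)), integral_const_mul]
  have hk : ∀ p : ℝ × ℝ, ((∫ x, ∫ y, φ (p.1, x) * f (x - y) * ψ (p.2, y) : ℝ) : ℂ) =
      ∫ ξ, (h ξ : ℂ) * (testFourier φ p.1 ξ * (starRingEnd ℂ) (testFourier ψ p.2 ξ)) := fun p =>
    hf.integral_integral_eq (contDiff_slice φ p.1) (hasCompactSupport_slice φ p.1)
      (contDiff_slice ψ p.2) (hasCompactSupport_slice ψ p.2)
  have hki : Integrable (fun p : ℝ × ℝ =>
      ((∫ x, ∫ y, φ (p.1, x) * f (x - y) * ψ (p.2, y) : ℝ) : ℂ)) (timeMeasure H) := by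
    simp_rw [hk]
    exact hint.integral_prod_left
  have hki' : Integrable (fun p : ℝ × ℝ =>
      ∫ x, ∫ y, φ (p.1, x) * f (x - y) * ψ (p.2, y)) (timeMeasure H) := by
    refine hki.re.congr (ae_of_all _ fun p => ?_)
    exact Complex.ofReal_re _
  constructor
  · simp_rw [hpair]
    exact hint.integral_prod_right
  · rw [noiseCovariance, timePairing_eq_integral hki', ← integral_complex_ofReal]
    simp_rw [hpair, hk]
    exact integral_integral_swap hint

end SpectralCovariance

section GaussianNoise

variable {N d : ℕ} {Ω : Type*} [MeasurableSpace Ω]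

/-- The variance of `∑ j, c j * W(φ j)`. -/
def noiseVariance {n : ℕ} (H : ℝ) (f : EuclideanSpace ℝ (Fin N) → ℝ) (φ : Fin n → Test N)
    (c : Fin n → ℝ) : ℝ :=
  ∑ j, ∑ l, c j * c l * noiseCovariance H f (φ j) (φ l)

theorem IsFractionalColoredNoise.memLp {P : Measure Ω} {H : ℝ} {f : EuclideanSpace ℝ (Fin N) → ℝ}
    {W : Fin d → Test N → Ω → ℝ} (hW : IsFractionalColoredNoise P H f W) (k : Fin d) (φ : Test N) :
    MemLp (W k φ) 2 P := ((hW.gaussian k).hasGaussianLaw_eval φ).memLp_two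

theorem IsFractionalColoredNoise.integral_exp_sum {P : Measure Ω} [IsProbabilityMeasure P] {H : ℝ}
    {f : EuclideanSpace ℝ (Fin N) → ℝ} {W : Fin d → Test N → Ω → ℝ}
    (hW : IsFractionalColoredNoise P H f W) (k : Fin d) {n : ℕ} (φ : Fin n → Test N)
    (c : Fin n → ℝ) :
    ∫ ω, Complex.exp (((∑ j, c j * W k (φ j) ω : ℝ) : ℂ) * Complex.I) ∂P =
      ((Real.exp (-(noiseVariance H f φ c / 2)) : ℝ) : ℂ) := by
  set Y : Ω → ℝ := fun ω => ∑ j, c j * W k (φ j) ω with hY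
  have hgp : IsGaussianProcess (fun (j : Fin n) ω => c j • W k (φ j) ω) P :=
    ((hW.gaussian k).comp_right φ).smul c
  have hYg : HasGaussianLaw Y P := hgp.hasGaussianLaw_fun_sum (I := Finset.univ)
  have hYm : Measurable Y := Finset.measurable_fun_sum _ fun j _ => (hW.measurable k (φ j)).const_mul _
  have hmean : ∫ ω, Y ω ∂P = 0 := by
    rw [hY, integral_finsetSum]
    · simp_rw [integral_const_mul, hW.mean_zero, mul_zero, Finset.sum_const_zero]
    · exact fun j _ => ((hW.memLp k (φ j)).integrable one_le_two).const_mul _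
  have hvar : Var[Y; P] = noiseVariance H f φ c := by
    rw [variance_of_integral_eq_zero hYm.aemeasurable hmean]
    have h1 : ∀ ω, Y ω ^ 2 = ∑ j, ∑ l, c j * c l * (W k (φ j) ω * W k (φ l) ω) := by
      intro ω
      rw [hY, sq, Finset.sum_mul_sum]
      refine Finset.sum_congr rfl fun j _ => Finset.sum_congr rfl fun l _ => by ring
    have h2 : ∀ j l, Integrable (fun ω => c j * c l * (W k (φ j) ω * W k (φ l) ω)) P :=
      fun j l => ((hW.memLp k (φ j)).integrable_mul (hW.memLp k (φ l))).const_mul _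
    simp_rw [h1]
    rw [integral_finsetSum _ fun j _ => integrable_finsetSum _ fun l _ => h2 j l, noiseVariance]
    refine Finset.sum_congr rfl fun j _ => ?_
    rw [integral_finsetSum _ fun l _ => h2 j l]
    refine Finset.sum_congr rfl fun l _ => ?_
    rw [integral_const_mul, hW.covariance]
  have hchar := hYg.charFun_map_eq 1
  have hin : (fun ω => inner ℝ (1 : ℝ) (Y ω)) = Y := by
    ext ω; simp
  simp only [hin, hmean, hvar] at hchar
  rw [charFun_apply, integral_map hYm.aemeasurable (by fun_prop)] at hchar
  have h3 : ∀ ω, (inner ℝ (Y ω) (1 : ℝ) : ℝ) = Y ω := fun ω => by simp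
  simp only [h3] at hchar
  rw [hchar]
  push_cast
  congr 1
  ring

theorem IsFractionalColoredNoise.integral_exp_sum_sum {P : Measure Ω} [IsProbabilityMeasure P]
    {H : ℝ} {f : EuclideanSpace ℝ (Fin N) → ℝ} {W : Fin d → Test N → Ω → ℝ}
    (hW : IsFractionalColoredNoise P H f W) {n : ℕ} (φ : Fin d → Fin n → Test N)
    (y : Fin n → Fin d → ℝ) :
    ∫ ω, Complex.exp (((∑ j, ∑ k, y j k * W k (φ k j) ω : ℝ) : ℂ) * Complex.I) ∂P =
      ((Real.exp (-(∑ k, noiseVariance H f (φ k) fun j => y j k) / 2) : ℝ) : ℂ) := by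
  set g : Fin d → (Test N → ℝ) → ℂ := fun k w =>
    Complex.exp (((∑ j, y j k * w (φ k j) : ℝ) : ℂ) * Complex.I) with hg
  have hgm : ∀ k, Measurable (g k) := by
    intro k
    have : Measurable fun w : Test N → ℝ => ∑ j, y j k * w (φ k j) :=
      Finset.measurable_fun_sum _ fun j _ => (measurable_pi_apply _).const_mul _
    exact Complex.measurable_exp.comp ((Complex.measurable_ofReal.comp this).mul_const _)
  have h1 := hW.independent.integral_fun_prod_comp (f := g)
    (fun k => (measurable_pi_lambda _ fun φ => hW.measurable k φ).aemeasurable)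
    (fun k => (hgm k).aestronglyMeasurable)
  calc _ = ∫ ω, ∏ k, g k (fun φ => W k φ ω) ∂P := by
        refine integral_congr_ae (ae_of_all _ fun ω => ?_)
        simp only [hg]
        rw [← Complex.exp_sum, ← Finset.sum_mul, ← Complex.ofReal_sum, Finset.sum_comm]
    _ = ∏ k, ((Real.exp (-(noiseVariance H f (φ k) (fun j => y j k) / 2)) : ℝ) : ℂ) := by
        rw [h1]
        refine Finset.prod_congr rfl fun k _ => ?_
        exact hW.integral_exp_sum k (φ k) fun j => y j k
    _ = _ := by
        rw [← Complex.ofReal_prod, ← Real.exp_sum]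
        congr 3
        rw [Finset.sum_neg_distrib, ← Finset.sum_div, neg_div]

theorem norm_exp_mul_I_sub_le (x y : ℝ) :
    ‖Complex.exp ((x : ℂ) * Complex.I) - Complex.exp ((y : ℂ) * Complex.I)‖ ≤ |x - y| := by
  have h1 : Complex.exp ((x : ℂ) * Complex.I) - Complex.exp ((y : ℂ) * Complex.I) =
      Complex.exp ((y : ℂ) * Complex.I) * (Complex.exp (Complex.I * ((x - y : ℝ) : ℂ)) - 1) := by
    rw [mul_sub, ← Complex.exp_add, mul_one]
    congr 2
    push_cast
    ring
  rw [h1, norm_mul, Complex.norm_exp_ofReal_mul_I, one_mul]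
  exact Real.norm_exp_I_mul_ofReal_sub_one_le

/-- Characteristic functions of linear combinations are continuous in `L²`. -/
theorem tendsto_integral_exp_sum {P : Measure Ω} [IsProbabilityMeasure P] {ι : Type*} [Fintype ι]
    {Z : ℕ → ι → Ω → ℝ} {X : ι → Ω → ℝ} (hZ : ∀ m i, AEStronglyMeasurable (Z m i) P)
    (hX : ∀ i, AEStronglyMeasurable (X i) P)
    (hlim : ∀ i, Tendsto (fun m => eLpNorm (fun ω => Z m i ω - X i ω) 2 P) atTop (𝓝 0))
    (y : ι → ℝ) :
    Tendsto (fun m => ∫ ω, Complex.exp (((∑ i, y i * Z m i ω : ℝ) : ℂ) * Complex.I) ∂P) atTop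
      (𝓝 (∫ ω, Complex.exp (((∑ i, y i * X i ω : ℝ) : ℂ) * Complex.I) ∂P)) := by
  have hmeas : ∀ V : ι → Ω → ℝ, (∀ i, AEStronglyMeasurable (V i) P) →
      Integrable (fun ω => Complex.exp (((∑ i, y i * V i ω : ℝ) : ℂ) * Complex.I)) P := by
    intro V hV
    refine Integrable.of_bound (C := 1) ?_ (ae_of_all _ fun ω => ?_)
    · have h1 : AEStronglyMeasurable (fun ω => ∑ i, y i * V i ω) P :=
        Finset.aestronglyMeasurable_fun_sum _ fun i _ => (hV i).const_mul _
      have h2 : Continuous fun x : ℝ => Complex.exp ((x : ℂ) * Complex.I) := by fun_prop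
      exact h2.comp_aestronglyMeasurable h1
    · rw [Complex.norm_exp_ofReal_mul_I]
  rw [tendsto_iff_edist_tendsto_0]
  have hbound : ∀ m, edist (∫ ω, Complex.exp (((∑ i, y i * Z m i ω : ℝ) : ℂ) * Complex.I) ∂P)
      (∫ ω, Complex.exp (((∑ i, y i * X i ω : ℝ) : ℂ) * Complex.I) ∂P) ≤
      ∑ i, ‖y i‖ₑ * eLpNorm (fun ω => Z m i ω - X i ω) 2 P := by
    intro m
    rw [edist_eq_enorm_sub, ← integral_sub (hmeas _ (hZ m)) (hmeas _ hX)]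
    refine (enorm_integral_le_lintegral_enorm _).trans ?_
    calc _ ≤ ∫⁻ ω, ∑ i, ‖y i‖ₑ * ‖Z m i ω - X i ω‖ₑ ∂P := by
          refine lintegral_mono fun ω => ?_
          have h1 := norm_exp_mul_I_sub_le (∑ i, y i * Z m i ω) (∑ i, y i * X i ω)
          rw [← Real.norm_eq_abs] at h1
          have h2 := enorm_le_iff_norm_le.2 h1
          refine h2.trans ?_
          rw [← Finset.sum_sub_distrib]
          refine (enorm_sum_le _ _).trans (Finset.sum_le_sum fun i _ => ?_)
          rw [← mul_sub, enorm_mul]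
      _ = ∑ i, ‖y i‖ₑ * eLpNorm (fun ω => Z m i ω - X i ω) 1 P := by
          rw [lintegral_finsetSum']
          · refine Finset.sum_congr rfl fun i _ => ?_
            rw [lintegral_const_mul' _ _ (by simp), eLpNorm_one_eq_lintegral_enorm]
          · exact fun i _ => (((hZ m i).sub (hX i)).enorm.const_mul _)
      _ ≤ _ := by
          refine Finset.sum_le_sum fun i _ => mul_le_mul' le_rfl ?_
          exact eLpNorm_le_eLpNorm_of_exponent_le one_le_two ((hZ m i).sub (hX i))
  refine tendsto_of_tendsto_of_tendsto_of_le_of_le tendsto_const_nhds ?_ (fun _ => zero_le) hbound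
  have h3 : Tendsto (fun m => ∑ i, ‖y i‖ₑ * eLpNorm (fun ω => Z m i ω - X i ω) 2 P) atTop
      (𝓝 (∑ i, ‖y i‖ₑ * 0)) :=
    tendsto_finsetSum _ fun i _ => ENNReal.Tendsto.const_mul (hlim i) (Or.inr (by simp))
  simpa using h3

end GaussianNoise

section WaveForm

variable {N : ℕ}

/-- The spectral weight `|ξ|^{-β} (1 + |ξ|)^{-1-2H}`. -/
def waveWeight (β H : ℝ) (ξ : EuclideanSpace ℝ (Fin N)) : ℝ≥0∞ :=
  ENNReal.ofReal (‖ξ‖ ^ (-β) * (1 + ‖ξ‖) ^ (-(1 + 2 * H)))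

theorem measurable_waveWeight (β H : ℝ) :
    Measurable fun ξ : EuclideanSpace ℝ (Fin N) => waveWeight β H ξ := by
  unfold waveWeight; fun_prop

/-- The wave functional: spatial frequency by spatial frequency, integrate against the probe. -/
def probeFunctional (a : ℝ) (S : ℝ → EuclideanSpace ℝ (Fin N) → ℂ) (ξ : EuclideanSpace ℝ (Fin N)) :
    ℂ := ∫ s in Set.Icc 0 a, S s ξ * probe a ‖ξ‖ s

/-- The weighted square norm of a superposition of plane waves `e^{i(|ξ| t_j - x_j·ξ)}`. -/
def waveForm {n : ℕ} (β H : ℝ) (t : Fin n → ℝ) (x : Fin n → EuclideanSpace ℝ (Fin N))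
    (c : Fin n → ℝ) : ℝ≥0∞ :=
  ∫⁻ ξ, waveWeight β H ξ *
    ‖∑ j, (c j : ℂ) * Complex.exp (((‖ξ‖ * t j - inner ℝ (x j) ξ : ℝ) : ℂ) * Complex.I)‖ₑ ^ 2

theorem exists_lintegral_probeFunctional_le {β : ℝ} {f h : EuclideanSpace ℝ (Fin N) → ℝ}
    (hf : IsSpatialCovariance β f h) {H a : ℝ} (hH : 1 / 2 ≤ H) (hH1 : H < 1) (ha : 0 < a) :
    ∃ C, 0 < C ∧ ∀ S : ℝ → EuclideanSpace ℝ (Fin N) → ℂ,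
      (∀ ξ, IsBoundedSupported fun t => S t ξ) →
      ∫⁻ ξ, waveWeight β H ξ * ‖probeFunctional a S ξ‖ₑ ^ 2 ≤
        ENNReal.ofReal C * spectralNormSq H h S := by
  obtain ⟨C, hC, hCb⟩ := exists_enorm_integral_probe_sq_le hH hH1 ha
  obtain ⟨C₁, C₂, hC1, hC2, hae⟩ := hf.comparable
  refine ⟨C / C₁, by positivity, fun S hS => ?_⟩
  rw [spectralNormSq, ← lintegral_const_mul' _ _ ENNReal.ofReal_ne_top]
  refine lintegral_mono_ae ?_
  filter_upwards [hae] with ξ hξ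
  obtain ⟨hnn, hle⟩ := hCb ‖ξ‖ (norm_nonneg _) _ (hS ξ)
  refine (mul_le_mul' le_rfl hle).trans ?_
  have hpos : 0 < 1 + ‖ξ‖ := by positivity
  rw [waveWeight, ← mul_assoc, ← ENNReal.ofReal_mul (by positivity), ← ENNReal.ofReal_mul (by positivity),
    ← ENNReal.ofReal_mul (by positivity)]
  refine ENNReal.ofReal_le_ofReal ?_
  rw [← mul_assoc (C / C₁)]
  refine mul_le_mul_of_nonneg_right ?_ hnn
  have h1 : (1 + ‖ξ‖) ^ (-(1 + 2 * H)) * (1 + ‖ξ‖) ^ (1 + 2 * H) = 1 := by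
    rw [← Real.rpow_add hpos, neg_add_cancel, Real.rpow_zero]
  calc ‖ξ‖ ^ (-β) * (1 + ‖ξ‖) ^ (-(1 + 2 * H)) * (C * (1 + ‖ξ‖) ^ (1 + 2 * H))
      = C / C₁ * (C₁ * ‖ξ‖ ^ (-β)) * ((1 + ‖ξ‖) ^ (-(1 + 2 * H)) * (1 + ‖ξ‖) ^ (1 + 2 * H)) := by
        field_simp
    _ = C / C₁ * (C₁ * ‖ξ‖ ^ (-β)) := by rw [h1, mul_one]
    _ ≤ C / C₁ * h ξ := by gcongr; exact hξ.1

theorem IsBoundedSupported.sub {F G : ℝ → ℂ} (hF : IsBoundedSupported F)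
    (hG : IsBoundedSupported G) : IsBoundedSupported fun t => F t - G t := by
  obtain ⟨C, hC⟩ := hF.bounded
  obtain ⟨D, hD⟩ := hG.bounded
  obtain ⟨M, hM⟩ := hF.supported
  obtain ⟨M', hM'⟩ := hG.supported
  refine ⟨hF.measurable.sub hG.measurable, ⟨C + D, fun t => (norm_sub_le _ _).trans
    (add_le_add (hC t) (hD t))⟩, ⟨max M M', fun t ht => ?_⟩⟩
  rw [hM t fun h' => ht
      ⟨by linarith [h'.1, le_max_left M M'], by linarith [h'.2, le_max_left M M']⟩,
    hM' t fun h' => ht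
      ⟨by linarith [h'.1, le_max_right M M'], by linarith [h'.2, le_max_right M M']⟩, sub_zero]

theorem IsBoundedSupported.sum {ι : Type*} [Fintype ι] {F : ι → ℝ → ℂ}
    (hF : ∀ i, IsBoundedSupported (F i)) (c : ι → ℂ) :
    IsBoundedSupported fun t => ∑ i, c i * F i t := by
  choose C hC using fun i => (hF i).bounded
  choose M hM using fun i => (hF i).supported
  refine ⟨Finset.measurable_fun_sum _ fun i _ => (hF i).measurable.const_mul _,
    ⟨∑ i, ‖c i‖ * C i, fun t => ?_⟩, ⟨∑ i, |M i|, fun t ht => ?_⟩⟩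
  · refine (norm_sum_le _ _).trans (Finset.sum_le_sum fun i _ => ?_)
    rw [norm_mul]
    exact mul_le_mul_of_nonneg_left (hC i t) (norm_nonneg _)
  · refine Finset.sum_eq_zero fun i _ => ?_
    rw [hM i t fun h' => ht ?_, mul_zero]
    have h1 : M i ≤ ∑ i, |M i| := (le_abs_self _).trans
      (Finset.single_le_sum (f := fun i => |M i|) (fun j _ => abs_nonneg _) (Finset.mem_univ i))
    exact ⟨by linarith [h'.1], by linarith [h'.2]⟩

theorem IsBoundedSupported.integrableOn_mul_probe {F : ℝ → ℂ} (hF : IsBoundedSupported F) (a r : ℝ) :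
    IntegrableOn (fun s => F s * probe a r s) (Set.Icc 0 a) := by
  obtain ⟨C, hC⟩ := hF.bounded
  have h1 : IntegrableOn (probe a r) (Set.Icc 0 a) :=
    (continuous_probe a r).continuousOn.integrableOn_compact isCompact_Icc
  exact h1.bdd_mul hF.measurable.aestronglyMeasurable (ae_of_all _ hC)

theorem isBoundedSupported_greenFourier (t : ℝ) (x ξ : EuclideanSpace ℝ (Fin N)) :
    IsBoundedSupported fun s => greenFourier t x s ξ := by
  refine ⟨?_, ⟨‖ξ‖⁻¹, fun s => ?_⟩, ⟨t, fun s hs => ?_⟩⟩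
  · unfold greenFourier waveKernelFourier
    refine Measurable.indicator ?_ measurableSet_Icc
    fun_prop
  · unfold greenFourier
    by_cases hs : s ∈ Set.Icc 0 t
    · rw [Set.indicator_of_mem hs, norm_mul,
        show -Complex.I * ((inner ℝ x ξ : ℝ) : ℂ) = ((-inner ℝ x ξ : ℝ) : ℂ) * Complex.I by
          push_cast; ring, Complex.norm_exp_ofReal_mul_I, one_mul, Complex.norm_real,
        waveKernelFourier, norm_div, norm_norm, Real.norm_eq_abs, div_eq_mul_inv]
      exact mul_le_of_le_one_left (by positivity) (Real.abs_sin_le_one _)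
    · rw [Set.indicator_of_notMem hs, norm_zero]
      positivity
  · unfold greenFourier
    refine Set.indicator_of_notMem (fun h => hs ⟨?_, h.2⟩) _
    linarith [h.1, h.1.trans h.2]

theorem measurable_greenFourier (t : ℝ) (x : EuclideanSpace ℝ (Fin N)) :
    Measurable fun q : ℝ × EuclideanSpace ℝ (Fin N) => greenFourier t x q.1 q.2 := by
  have h1 : Measurable fun q : ℝ × EuclideanSpace ℝ (Fin N) =>
      Complex.exp (-Complex.I * ((inner ℝ x q.2 : ℝ) : ℂ)) *
        (waveKernelFourier (t - q.1) q.2 : ℂ) := by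
    unfold waveKernelFourier
    fun_prop
  have h2 : (fun q : ℝ × EuclideanSpace ℝ (Fin N) => greenFourier t x q.1 q.2) =
      (Set.Icc 0 t ×ˢ Set.univ).indicator fun q : ℝ × EuclideanSpace ℝ (Fin N) =>
        Complex.exp (-Complex.I * ((inner ℝ x q.2 : ℝ) : ℂ)) *
        (waveKernelFourier (t - q.1) q.2 : ℂ) := by
    ext q
    unfold greenFourier
    by_cases hs : q.1 ∈ Set.Icc 0 t
    · rw [Set.indicator_of_mem hs, Set.indicator_of_mem (Set.mk_mem_prod hs (Set.mem_univ _))]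
    · rw [Set.indicator_of_notMem hs, Set.indicator_of_notMem fun h => hs h.1]
  rw [h2]
  exact h1.indicator (measurableSet_Icc.prod MeasurableSet.univ)

theorem measurable_probeFunctional (a : ℝ) {S : ℝ → EuclideanSpace ℝ (Fin N) → ℂ}
    (hS : Measurable fun q : ℝ × EuclideanSpace ℝ (Fin N) => S q.1 q.2) :
    Measurable (probeFunctional a S) := by
  have hp : Continuous fun q : EuclideanSpace ℝ (Fin N) × ℝ => probe a ‖q.1‖ q.2 := by
    unfold probe window windowDeriv; fun_prop
  have h1 : Measurable fun q : EuclideanSpace ℝ (Fin N) × ℝ => S q.2 q.1 * probe a ‖q.1‖ q.2 := by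
    have h2 := (hS.comp measurable_swap).mul hp.measurable
    exact h2
  exact (h1.stronglyMeasurable.integral_prod_right' (ν := volume.restrict (Set.Icc 0 a))).measurable

theorem timePairing_sum_mul_conj {H : ℝ} (hH : 1 / 2 ≤ H) {n : ℕ} {F : Fin n → ℝ → ℂ}
    (hF : ∀ j, IsBoundedSupported (F j)) (c : Fin n → ℝ) :
    (timePairing H fun t s => (∑ j, (c j : ℂ) * F j t) * (starRingEnd ℂ) (∑ j, (c j : ℂ) * F j s)) =
      ∑ j, ∑ l, (c j * c l : ℂ) * timePairing H fun t s => F j t * (starRingEnd ℂ) (F l s) := by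
  have hs := IsBoundedSupported.sum hF fun j => (c j : ℂ)
  have hi : ∀ j l, Integrable (fun p : ℝ × ℝ => (c j * c l : ℂ) *
      (F j p.1 * (starRingEnd ℂ) (F l p.2))) (timeMeasure H) :=
    fun j l => ((hF j).integrable_timeMeasure hH (hF l)).const_mul _
  rw [timePairing_eq_integral (hs.integrable_timeMeasure hH hs)]
  have h1 : ∀ p : ℝ × ℝ, (∑ j, (c j : ℂ) * F j p.1) * (starRingEnd ℂ) (∑ j, (c j : ℂ) * F j p.2) =
      ∑ j, ∑ l, (c j * c l : ℂ) * (F j p.1 * (starRingEnd ℂ) (F l p.2)) := by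
    intro p
    rw [map_sum, Finset.sum_mul_sum]
    refine Finset.sum_congr rfl fun j _ => Finset.sum_congr rfl fun l _ => ?_
    rw [map_mul, Complex.conj_ofReal]
    ring
  simp_rw [h1]
  rw [integral_finsetSum _ fun j _ => integrable_finsetSum _ fun l _ => hi j l]
  refine Finset.sum_congr rfl fun j _ => ?_
  rw [integral_finsetSum _ fun l _ => hi j l]
  refine Finset.sum_congr rfl fun l _ => ?_
  rw [integral_const_mul, timePairing_eq_integral ((hF j).integrable_timeMeasure hH (hF l))]

theorem spectralNormSq_sum_testFourier {β : ℝ} {f h : EuclideanSpace ℝ (Fin N) → ℝ}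
    (hf : IsSpatialCovariance β f h) (hβ0 : 0 < β) (hβN : β < N) {H : ℝ} (hH : 1 / 2 ≤ H)
    (hH1 : H < 1) {n : ℕ} (φ : Fin n → Test N) (c : Fin n → ℝ) :
    0 ≤ noiseVariance H f φ c ∧
    spectralNormSq H h (fun s ξ => ∑ j, (c j : ℂ) * testFourier (φ j) s ξ) =
      ENNReal.ofReal (noiseVariance H f φ c) := by
  set T : EuclideanSpace ℝ (Fin N) → ℂ := fun ξ => timePairing H fun t s =>
    (∑ j, (c j : ℂ) * testFourier (φ j) t ξ) *
      (starRingEnd ℂ) (∑ j, (c j : ℂ) * testFourier (φ j) s ξ) with hT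
  have hTsum : ∀ ξ, (h ξ : ℂ) * T ξ = ∑ j, ∑ l, (c j * c l : ℂ) * ((h ξ : ℂ) * timePairing H fun t s =>
      testFourier (φ j) t ξ * (starRingEnd ℂ) (testFourier (φ l) s ξ)) := by
    intro ξ
    simp only [hT]
    rw [timePairing_sum_mul_conj hH (fun j => isBoundedSupported_testFourier (φ j) ξ) c,
      Finset.mul_sum]
    refine Finset.sum_congr rfl fun j _ => ?_
    rw [Finset.mul_sum]
    refine Finset.sum_congr rfl fun l _ => by ring
  have hi : ∀ j l, Integrable fun ξ => (c j * c l : ℂ) * ((h ξ : ℂ) * timePairing H fun t s =>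
      testFourier (φ j) t ξ * (starRingEnd ℂ) (testFourier (φ l) s ξ)) := fun j l =>
    (noiseCovariance_eq_spectral hf hβ0 hβN hH (φ j) (φ l)).1.const_mul _
  have hTi : Integrable fun ξ => (h ξ : ℂ) * T ξ := by
    simp_rw [hTsum]
    exact integrable_finsetSum _ fun j _ => integrable_finsetSum _ fun l _ => hi j l
  have hval : ∫ ξ, (h ξ : ℂ) * T ξ = ((noiseVariance H f φ c : ℝ) : ℂ) := by
    simp_rw [hTsum]
    rw [integral_finsetSum _ fun j _ => integrable_finsetSum _ fun l _ => hi j l, noiseVariance]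
    push_cast
    refine Finset.sum_congr rfl fun j _ => ?_
    rw [integral_finsetSum _ fun l _ => hi j l]
    refine Finset.sum_congr rfl fun l _ => ?_
    rw [integral_const_mul, (noiseCovariance_eq_spectral hf hβ0 hβN hH (φ j) (φ l)).2]
  have hre : ∀ ξ, ((h ξ : ℂ) * T ξ).re = h ξ * (T ξ).re := fun ξ => Complex.re_ofReal_mul _ _
  have hTi' : Integrable fun ξ => h ξ * (T ξ).re := by
    refine hTi.re.congr (ae_of_all _ fun ξ => ?_)
    exact hre ξ
  have hval' : ∫ ξ, h ξ * (T ξ).re = noiseVariance H f φ c := by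
    simp_rw [← hre]
    have := integral_re hTi
    rw [hval] at this
    exact this.trans (Complex.ofReal_re _)
  have hnn : ∀ᵐ ξ, 0 ≤ h ξ * (T ξ).re := by
    obtain ⟨C, -, hC⟩ := exists_enorm_integral_probe_sq_le hH hH1 one_pos
    filter_upwards [hf.density_nonneg] with ξ hξ
    exact mul_nonneg hξ (hC 0 le_rfl _ (IsBoundedSupported.sum
      (fun j => isBoundedSupported_testFourier (φ j) ξ) fun j => (c j : ℂ))).1
  refine ⟨hval' ▸ integral_nonneg_of_ae hnn, ?_⟩
  rw [spectralNormSq, ← hval', ofReal_integral_eq_lintegral_ofReal hTi' hnn]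

theorem norm_sum_mul_sq_le {n : ℕ} (c : Fin n → ℝ) (A : ℂ) (G E : Fin n → ℂ)
    (hA : A = ∑ j, (c j : ℂ) * (E j + G j)) :
    ‖∑ j, (c j : ℂ) * G j‖ ^ 2 ≤ 2 * ‖A‖ ^ 2 + 2 * (n * ∑ j, c j ^ 2 * ‖E j‖ ^ 2) := by
  have h1 : ∑ j, (c j : ℂ) * G j = A - ∑ j, (c j : ℂ) * E j := by
    rw [hA, ← Finset.sum_sub_distrib]
    refine Finset.sum_congr rfl fun j _ => by ring
  have h2 : ‖∑ j, (c j : ℂ) * E j‖ ^ 2 ≤ n * ∑ j, c j ^ 2 * ‖E j‖ ^ 2 := by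
    calc ‖∑ j, (c j : ℂ) * E j‖ ^ 2 ≤ (∑ j, |c j| * ‖E j‖) ^ 2 := by
          gcongr
          refine (norm_sum_le _ _).trans_eq (Finset.sum_congr rfl fun j _ => ?_)
          rw [norm_mul, Complex.norm_real, Real.norm_eq_abs]
      _ ≤ (Finset.univ : Finset (Fin n)).card * ∑ j, (|c j| * ‖E j‖) ^ 2 :=
          sq_sum_le_card_mul_sum_sq
      _ = _ := by
          rw [Finset.card_univ, Fintype.card_fin]
          congr 1
          refine Finset.sum_congr rfl fun j _ => ?_
          rw [mul_pow, sq_abs]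
  rw [h1]
  have h3 := norm_sub_le A (∑ j, (c j : ℂ) * E j)
  have h4 : ‖A - ∑ j, (c j : ℂ) * E j‖ ^ 2 ≤ (‖A‖ + ‖∑ j, (c j : ℂ) * E j‖) ^ 2 := by gcongr
  nlinarith [sq_nonneg (‖A‖ - ‖∑ j, (c j : ℂ) * E j‖)]

/-- The form of the plane waves is controlled by the variance of the approximating test functions
and the approximation error. -/
theorem exists_waveForm_le {β : ℝ} {f h : EuclideanSpace ℝ (Fin N) → ℝ}
    (hf : IsSpatialCovariance β f h) (hβ0 : 0 < β) (hβN : β < N) {H a : ℝ} (hH : 1 / 2 ≤ H)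
    (hH1 : H < 1) (ha : 0 < a) :
    ∃ C, 0 < C ∧ ∀ (n : ℕ) (t : Fin n → ℝ) (x : Fin n → EuclideanSpace ℝ (Fin N)) (c : Fin n → ℝ),
      (∀ j, a ≤ t j) → ∀ φ : Fin n → Test N,
      waveForm β H t x c ≤ ENNReal.ofReal C * (ENNReal.ofReal (noiseVariance H f φ c) +
        n * ∑ j, ENNReal.ofReal (c j ^ 2) *
          spectralNormSq H h fun s ξ => testFourier (φ j) s ξ - greenFourier (t j) (x j) s ξ) := by
  obtain ⟨C, hC, hCS⟩ := exists_lintegral_probeFunctional_le hf hH hH1 ha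
  have hN : 0 < N := by
    have : (0 : ℝ) < N := hβ0.trans hβN
    exact_mod_cast this
  have : Nontrivial (EuclideanSpace ℝ (Fin N)) := by
    have : Nonempty (Fin N) := ⟨⟨0, hN⟩⟩
    infer_instance
  have hm := windowMass_pos ha
  set m := windowMass a with hmdef
  refine ⟨2 * C / m ^ 2, by positivity, fun n t x c ht φ => ?_⟩
  set Φ : ℝ → EuclideanSpace ℝ (Fin N) → ℂ := fun s ξ => ∑ j, (c j : ℂ) * testFourier (φ j) s ξ with hΦ
  set Δ : Fin n → ℝ → EuclideanSpace ℝ (Fin N) → ℂ := fun j s ξ =>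
    testFourier (φ j) s ξ - greenFourier (t j) (x j) s ξ with hΔ
  have hΦb : ∀ ξ, IsBoundedSupported fun s => Φ s ξ := fun ξ =>
    IsBoundedSupported.sum (fun j => isBoundedSupported_testFourier (φ j) ξ) fun j => (c j : ℂ)
  have hΔb : ∀ j ξ, IsBoundedSupported fun s => Δ j s ξ := fun j ξ =>
    (isBoundedSupported_testFourier (φ j) ξ).sub (isBoundedSupported_greenFourier (t j) (x j) ξ)
  have hΔm : ∀ j, Measurable (probeFunctional a (Δ j)) := fun j =>
    measurable_probeFunctional a ((measurable_testFourier (φ j)).sub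
      (measurable_greenFourier (t j) (x j)))
  have hΦm : Measurable (probeFunctional a Φ) :=
    measurable_probeFunctional a (Finset.measurable_fun_sum _ fun j _ =>
      (measurable_testFourier (φ j)).const_mul _)
  have hpt : ∀ᵐ ξ : EuclideanSpace ℝ (Fin N), waveWeight β H ξ *
      ‖∑ j, (c j : ℂ) * Complex.exp (((‖ξ‖ * t j - inner ℝ (x j) ξ : ℝ) : ℂ) * Complex.I)‖ₑ ^ 2 ≤
      ENNReal.ofReal (2 / m ^ 2) * (waveWeight β H ξ * ‖probeFunctional a Φ ξ‖ₑ ^ 2 +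
        n * ∑ j, ENNReal.ofReal (c j ^ 2) *
          (waveWeight β H ξ * ‖probeFunctional a (Δ j) ξ‖ₑ ^ 2)) := by
    filter_upwards [Measure.ae_ne volume (0 : EuclideanSpace ℝ (Fin N))] with ξ hξ
    set e : Fin n → ℂ := fun j =>
      Complex.exp (((‖ξ‖ * t j - inner ℝ (x j) ξ : ℝ) : ℂ) * Complex.I) with he
    have hG : ∀ j, probeFunctional a (greenFourier (t j) (x j)) ξ = (m : ℂ) * e j := fun j =>
      integral_greenFourier_mul_probe ha (ht j) (x j) hξ
    have hsub : ∀ j, probeFunctional a (Δ j) ξ + probeFunctional a (greenFourier (t j) (x j)) ξ =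
        probeFunctional a (testFourier (φ j)) ξ := by
      intro j
      unfold probeFunctional
      rw [← integral_add ((hΔb j ξ).integrableOn_mul_probe a ‖ξ‖)
        ((isBoundedSupported_greenFourier (t j) (x j) ξ).integrableOn_mul_probe a ‖ξ‖)]
      refine integral_congr_ae (ae_of_all _ fun s => ?_)
      simp only [hΔ]
      ring
    have hlin : probeFunctional a Φ ξ = ∑ j, (c j : ℂ) * (probeFunctional a (Δ j) ξ +
        probeFunctional a (greenFourier (t j) (x j)) ξ) := by
      simp_rw [hsub]
      unfold probeFunctional
      simp_rw [← integral_const_mul]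
      rw [← integral_finsetSum]
      · refine integral_congr_ae (ae_of_all _ fun s => ?_)
        simp only [hΦ]
        rw [Finset.sum_mul]
        refine Finset.sum_congr rfl fun j _ => by ring
      · exact fun j _ => ((isBoundedSupported_testFourier (φ j) ξ).integrableOn_mul_probe a ‖ξ‖).const_mul _
    have hineq := norm_sum_mul_sq_le c _ (fun j => probeFunctional a (greenFourier (t j) (x j)) ξ)
      (fun j => probeFunctional a (Δ j) ξ) hlin
    have hsum : ∑ j, (c j : ℂ) * probeFunctional a (greenFourier (t j) (x j)) ξ =
        (m : ℂ) * ∑ j, (c j : ℂ) * e j := by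
      rw [Finset.mul_sum]
      refine Finset.sum_congr rfl fun j _ => ?_
      rw [hG]; ring
    rw [hsum, norm_mul, Complex.norm_real, Real.norm_of_nonneg hm.le, mul_pow] at hineq
    have hineq' : ‖∑ j, (c j : ℂ) * e j‖ ^ 2 ≤ 2 / m ^ 2 * (‖probeFunctional a Φ ξ‖ ^ 2 +
        n * ∑ j, c j ^ 2 * ‖probeFunctional a (Δ j) ξ‖ ^ 2) := by
      rw [div_mul_eq_mul_div, le_div_iff₀ (by positivity), mul_comm]
      linarith
    have hen : ∀ z : ℂ, ‖z‖ₑ ^ 2 = ENNReal.ofReal (‖z‖ ^ 2) := fun z => by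
      rw [ENNReal.ofReal_pow (norm_nonneg _), ofReal_norm]
    have h5 := ENNReal.ofReal_le_ofReal hineq'
    rw [ENNReal.ofReal_mul (by positivity), ENNReal.ofReal_add (by positivity) (by positivity),
      ENNReal.ofReal_mul (by positivity), ENNReal.ofReal_natCast,
      ENNReal.ofReal_sum_of_nonneg (fun j _ => by positivity)] at h5
    simp_rw [ENNReal.ofReal_mul (sq_nonneg _), ← hen] at h5
    refine (mul_le_mul' le_rfl h5).trans_eq ?_
    rw [mul_left_comm, mul_add]
    congr 2
    rw [mul_left_comm]
    congr 1
    rw [Finset.mul_sum]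
    refine Finset.sum_congr rfl fun j _ => ?_
    ring
  have hmw := measurable_waveWeight (N := N) β H
  have hm1 : ∀ j, Measurable fun ξ => ENNReal.ofReal (c j ^ 2) *
      (waveWeight β H ξ * ‖probeFunctional a (Δ j) ξ‖ₑ ^ 2) := fun j =>
    (hmw.mul ((hΔm j).enorm.pow_const 2)).const_mul _
  have hm0 : Measurable fun ξ => waveWeight β H ξ * ‖probeFunctional a Φ ξ‖ₑ ^ 2 :=
    hmw.mul (hΦm.enorm.pow_const 2)
  calc waveForm β H t x c ≤ ∫⁻ ξ, ENNReal.ofReal (2 / m ^ 2) *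
        (waveWeight β H ξ * ‖probeFunctional a Φ ξ‖ₑ ^ 2 +
        n * ∑ j, ENNReal.ofReal (c j ^ 2) *
          (waveWeight β H ξ * ‖probeFunctional a (Δ j) ξ‖ₑ ^ 2)) := lintegral_mono_ae hpt
    _ = ENNReal.ofReal (2 / m ^ 2) * ((∫⁻ ξ, waveWeight β H ξ * ‖probeFunctional a Φ ξ‖ₑ ^ 2) +
        n * ∑ j, ENNReal.ofReal (c j ^ 2) *
          ∫⁻ ξ, waveWeight β H ξ * ‖probeFunctional a (Δ j) ξ‖ₑ ^ 2) := by
        rw [lintegral_const_mul' _ _ ENNReal.ofReal_ne_top,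
          lintegral_add_left hm0,
          lintegral_const_mul' _ _ (ENNReal.natCast_ne_top n),
          lintegral_finsetSum _ fun j _ => hm1 j]
        simp_rw [lintegral_const_mul' _ _ ENNReal.ofReal_ne_top]
    _ ≤ ENNReal.ofReal (2 / m ^ 2) * (ENNReal.ofReal C * spectralNormSq H h Φ +
        n * ∑ j, ENNReal.ofReal (c j ^ 2) * (ENNReal.ofReal C * spectralNormSq H h (Δ j))) := by
        refine mul_le_mul' le_rfl (add_le_add (hCS Φ hΦb) (mul_le_mul' le_rfl
          (Finset.sum_le_sum fun j _ => mul_le_mul' le_rfl (hCS (Δ j) (hΔb j)))))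
    _ = _ := by
        have hpull : ∑ j, ENNReal.ofReal (c j ^ 2) * (ENNReal.ofReal C * spectralNormSq H h (Δ j)) =
            ENNReal.ofReal C * ∑ j, ENNReal.ofReal (c j ^ 2) * spectralNormSq H h (Δ j) := by
          rw [Finset.mul_sum]
          exact Finset.sum_congr rfl fun j _ => mul_left_comm _ _ _
        rw [hpull, hΦ, (spectralNormSq_sum_testFourier hf hβ0 hβN hH hH1 φ c).2,
          show 2 * C / m ^ 2 = 2 / m ^ 2 * C by ring, ENNReal.ofReal_mul (by positivity)]
        ring

end WaveForm

section CharFunBound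

variable {N d : ℕ} {Ω : Type*} [MeasurableSpace Ω]

theorem exists_norm_charFun_waveSolution_le {P : Measure Ω} [IsProbabilityMeasure P] {H β : ℝ}
    (hH : 1 / 2 ≤ H) (hH1 : H < 1) (hβ0 : 0 < β) (hβN : β < N)
    {f h : EuclideanSpace ℝ (Fin N) → ℝ} (hf : IsSpatialCovariance β f h)
    {W : Fin d → Test N → Ω → ℝ} (hW : IsFractionalColoredNoise P H f W)
    {u : ℝ → EuclideanSpace ℝ (Fin N) → Ω → EuclideanSpace ℝ (Fin d)}
    (hu : IsWaveSolution P H h W u) {a : ℝ} (ha : 0 < a) :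
    ∃ C, 0 < C ∧ ∀ (n : ℕ) (t : Fin n → ℝ) (x : Fin n → EuclideanSpace ℝ (Fin N))
      (y : Fin n → Fin d → ℝ) (q : Fin d → ℝ), (∀ j, a ≤ t j) → (∀ k, 0 ≤ q k) →
      (∀ k, ENNReal.ofReal (q k) ≤ waveForm β H t x fun j => y j k) →
      ‖∫ ω, Complex.exp (((∑ j, ∑ k, y j k * u (t j) (x j) ω k : ℝ) : ℂ) * Complex.I) ∂P‖ ≤
        Real.exp (-(C * ∑ k, q k)) := by
  obtain ⟨C, hC, hCb⟩ := exists_waveForm_le hf hβ0 hβN hH hH1 ha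
  refine ⟨1 / (2 * C), by positivity, fun n t x y q ht hq hqw => ?_⟩
  choose φ hφ hφX using fun j k => hu.mild (t j) (ha.le.trans (ht j)) (x j) k
  set S : Fin n → Fin d → ℕ → ℝ≥0∞ := fun j k m =>
    spectralNormSq H h fun s ξ => testFourier (φ j k m) s ξ - greenFourier (t j) (x j) s ξ with hS
  set V : Fin d → ℕ → ℝ := fun k m => noiseVariance H f (fun j => φ j k m) fun j => y j k with hV
  set E : ℕ → ℝ≥0∞ := fun m => ∑ k, ENNReal.ofReal C *
    (n * ∑ j, ENNReal.ofReal (y j k ^ 2) * S j k m) with hE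
  have hE0 : Tendsto E atTop (𝓝 0) := by
    have h1 : ∀ k, Tendsto (fun m => ENNReal.ofReal C *
        (n * ∑ j, ENNReal.ofReal (y j k ^ 2) * S j k m)) atTop (𝓝 0) := by
      intro k
      have h2 : Tendsto (fun m => ∑ j, ENNReal.ofReal (y j k ^ 2) * S j k m) atTop (𝓝 0) := by
        have := tendsto_finsetSum (Finset.univ : Finset (Fin n)) fun j _ =>
          ENNReal.Tendsto.const_mul (hφ j k) (Or.inr (ENNReal.ofReal_ne_top (r := y j k ^ 2)))
        simpa using this
      have h3 := ENNReal.Tendsto.const_mul (ENNReal.Tendsto.const_mul h2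
        (Or.inr (ENNReal.natCast_ne_top n))) (Or.inr (ENNReal.ofReal_ne_top (r := C)))
      simpa using h3
    have := tendsto_finsetSum (Finset.univ : Finset (Fin d)) fun k _ => h1 k
    simpa using this
  have hVn : ∀ k m, 0 ≤ V k m := fun k m =>
    (spectralNormSq_sum_testFourier hf hβ0 hβN hH hH1 (fun j => φ j k m) fun j => y j k).1
  have hbound : ∀ m, ENNReal.ofReal (∑ k, q k) ≤ ENNReal.ofReal (C * ∑ k, V k m) + E m := by
    intro m
    rw [ENNReal.ofReal_sum_of_nonneg fun k _ => hq k, ENNReal.ofReal_mul hC.le,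
      ENNReal.ofReal_sum_of_nonneg fun k _ => hVn k m, Finset.mul_sum, ← Finset.sum_add_distrib]
    refine Finset.sum_le_sum fun k _ => ?_
    rw [← mul_add]
    exact (hqw k).trans (hCb n t x (fun j => y j k) ht fun j => φ j k m)
  have hlim : Tendsto (fun m => ‖∫ ω, Complex.exp (((∑ j, ∑ k, y j k * W k (φ j k m) ω : ℝ) : ℂ) *
      Complex.I) ∂P‖) atTop (𝓝 ‖∫ ω, Complex.exp (((∑ j, ∑ k, y j k * u (t j) (x j) ω k : ℝ) : ℂ) *
      Complex.I) ∂P‖) := by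
    have hum : ∀ p : Fin n × Fin d, Measurable fun ω => u (t p.1) (x p.1) ω p.2 := by
      intro p
      have h1 : Measurable fun ω => u (t p.1) (x p.1) ω :=
        hu.measurable.comp ((measurable_const (a := (t p.1, x p.1))).prodMk measurable_id)
      exact (EuclideanSpace.proj (𝕜 := ℝ) p.2).measurable.comp h1
    have h1 := tendsto_integral_exp_sum (P := P) (ι := Fin n × Fin d)
      (Z := fun m p => W p.2 (φ p.1 p.2 m)) (X := fun p ω => u (t p.1) (x p.1) ω p.2)
      (fun m p => (hW.measurable _ _).aestronglyMeasurable)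
      (fun p => (hum p).aestronglyMeasurable) (fun p => hφX p.1 p.2) fun p => y p.1 p.2
    simp_rw [Fintype.sum_prod_type] at h1
    exact h1.norm
  have hval : ∀ m, ‖∫ ω, Complex.exp (((∑ j, ∑ k, y j k * W k (φ j k m) ω : ℝ) : ℂ) *
      Complex.I) ∂P‖ = Real.exp (-(∑ k, V k m) / 2) := by
    intro m
    rw [hW.integral_exp_sum_sum (fun k j => φ j k m) y, Complex.norm_real,
      Real.norm_of_nonneg (Real.exp_pos _).le]
  have heps : ∀ ε : ℝ, 0 < ε → ‖∫ ω, Complex.exp (((∑ j, ∑ k, y j k * u (t j) (x j) ω k : ℝ) : ℂ) *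
      Complex.I) ∂P‖ ≤ Real.exp (-(1 / (2 * C) * (∑ k, q k - ε))) := by
    intro ε hε
    refine le_of_tendsto hlim ?_
    filter_upwards [hE0.eventually_lt_const (ENNReal.ofReal_pos.2 hε)] with m hm
    rw [hval]
    refine Real.exp_le_exp.2 ?_
    have h1 := (hbound m).trans (add_le_add_right hm.le _)
    have hs : 0 ≤ ∑ k, V k m := Finset.sum_nonneg fun k _ => hVn k m
    rw [← ENNReal.ofReal_add (by positivity) hε.le, ENNReal.ofReal_le_ofReal_iff (by positivity)] at h1
    have h2 : 1 / (2 * C) * (∑ k, q k - ε) ≤ 1 / (2 * C) * (C * ∑ k, V k m) := by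
      gcongr; linarith
    have h3 : 1 / (2 * C) * (C * ∑ k, V k m) = (∑ k, V k m) / 2 := by field_simp
    linarith
  have hcont : Tendsto (fun ε : ℝ => Real.exp (-(1 / (2 * C) * (∑ k, q k - ε)))) (𝓝[>] 0)
      (𝓝 (Real.exp (-(1 / (2 * C) * (∑ k, q k - 0))))) :=
    ((by fun_prop : Continuous fun ε : ℝ =>
      Real.exp (-(1 / (2 * C) * (∑ k, q k - ε)))).tendsto 0).mono_left nhdsWithin_le_nhds
  rw [sub_zero] at hcont
  exact ge_of_tendsto hcont (eventually_nhdsWithin_of_forall fun ε hε => heps ε hε)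

end CharFunBound

section RadialReduction

variable {N : ℕ}

theorem lintegral_smul_euclidean {F : EuclideanSpace ℝ (Fin N) → ℝ≥0∞} (hF : Measurable F) {ρ : ℝ}
    (hρ : 0 < ρ) : ∫⁻ v, F (ρ • v) = ENNReal.ofReal (ρ ^ (-(N : ℝ))) * ∫⁻ ξ, F ξ := by
  have h1 := Measure.map_addHaar_smul (volume : Measure (EuclideanSpace ℝ (Fin N))) hρ.ne'
  have h2 := lintegral_map (μ := (volume : Measure (EuclideanSpace ℝ (Fin N)))) hF
    (measurable_const_smul ρ)
  rw [h1, lintegral_smul_measure, smul_eq_mul, finrank_euclideanSpace_fin,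
    abs_of_pos (by positivity)] at h2
  rw [← h2, Real.rpow_neg hρ.le, Real.rpow_natCast]

theorem lintegral_annulus_weight_le {β B : ℝ} (hβ : 0 ≤ β) (hB : 0 ≤ B) {r : ℝ} (hr : 0 ≤ r) :
    ∫⁻ ρ in Set.Ioi (0 : ℝ), {ρ : ℝ | ρ ≤ 2 * r ∧ r ≤ 2 * ρ}.indicator
      (fun ρ => ENNReal.ofReal (ρ ^ (-1 - β) * (1 + ρ) ^ (-B))) ρ ≤
      ENNReal.ofReal (2 ^ (1 + β) * 2 ^ B * 2) * ENNReal.ofReal (r ^ (-β) * (1 + r) ^ (-B)) := by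
  rcases hr.eq_or_lt with rfl | hr
  · rw [setLIntegral_congr_fun (g := fun _ => 0) measurableSet_Ioi]
    · simp
    · intro ρ hρ
      refine Set.indicator_of_notMem (fun h => ?_) _
      have : (0 : ℝ) < ρ := hρ
      linarith [h.1]
  have hS : {ρ : ℝ | ρ ≤ 2 * r ∧ r ≤ 2 * ρ} = Set.Icc (r / 2) (2 * r) := by
    ext ρ
    simp only [Set.mem_ofPred_eq, Set.mem_Icc]
    constructor <;> rintro ⟨h1, h2⟩ <;> constructor <;> linarith
  rw [hS]
  refine (setLIntegral_le_lintegral _ _).trans ?_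
  rw [lintegral_indicator measurableSet_Icc]
  have hb : ∀ ρ ∈ Set.Icc (r / 2) (2 * r), ENNReal.ofReal (ρ ^ (-1 - β) * (1 + ρ) ^ (-B)) ≤
      ENNReal.ofReal ((r / 2) ^ (-1 - β) * ((1 + r) / 2) ^ (-B)) := by
    intro ρ hρ
    refine ENNReal.ofReal_le_ofReal (mul_le_mul ?_ ?_ ?_ ?_)
    · exact Real.rpow_le_rpow_of_nonpos (by positivity) hρ.1 (by linarith)
    · exact Real.rpow_le_rpow_of_nonpos (by positivity) (by linarith [hρ.1]) (by linarith)
    · exact Real.rpow_nonneg (by linarith [hρ.1]) _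
    · positivity
  refine (setLIntegral_mono' measurableSet_Icc hb).trans ?_
  rw [lintegral_const, Measure.restrict_apply_univ, Real.volume_Icc,
    ← ENNReal.ofReal_mul (by positivity), ← ENNReal.ofReal_mul (by positivity)]
  refine ENNReal.ofReal_le_ofReal ?_
  have e1 : (r / 2) ^ (-1 - β) = 2 ^ (1 + β) * (r ^ (-β) * r⁻¹) := by
    rw [Real.div_rpow hr.le (by norm_num), show -1 - β = -(1 + β) by ring,
      Real.rpow_neg (by norm_num : (0 : ℝ) ≤ 2), div_inv_eq_mul, mul_comm,
      show -(1 + β) = -β + -1 by ring, Real.rpow_add hr, Real.rpow_neg_one]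
  have e2 : ((1 + r) / 2) ^ (-B) = 2 ^ B * (1 + r) ^ (-B) := by
    rw [Real.div_rpow (by positivity) (by norm_num), Real.rpow_neg (by norm_num : (0 : ℝ) ≤ 2),
      div_inv_eq_mul, mul_comm]
  rw [e1, e2]
  have e3 : 2 ^ (1 + β) * (r ^ (-β) * r⁻¹) * (2 ^ B * (1 + r) ^ (-B)) * (2 * r - r / 2) =
      2 ^ (1 + β) * 2 ^ B * (3 / 2) * (r ^ (-β) * (1 + r) ^ (-B)) := by
    field_simp
    ring
  rw [e3]
  gcongr
  norm_num

/-- Averages of one-dimensional trigonometric forms over an annulus of directions are controlled by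
the form of a superposition of plane waves. -/
theorem exists_lintegral_trigForm_le_waveForm {H β : ℝ} (hH : 1 / 2 ≤ H) (hβ0 : 0 < β)
    (hβN : β < N) (hβlow : (N : ℝ) - 2 * H - 1 < β) :
    ∃ C, 0 < C ∧ ∀ (n : ℕ) (t : Fin n → ℝ) (x : Fin n → EuclideanSpace ℝ (Fin N)) (c : Fin n → ℝ)
      (b : Set (EuclideanSpace ℝ (Fin N))), MeasurableSet b → (∀ v ∈ b, 1 / 2 ≤ ‖v‖ ∧ ‖v‖ ≤ 2) →
      ∫⁻ v in b, ENNReal.ofReal (trigForm (radialMeasure (N - 1 - β) (1 + 2 * H))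
        (fun j => ‖v‖ * t j - inner ℝ (x j) v) c) ≤ ENNReal.ofReal C * waveForm β H t x c := by
  set A : ℝ := N - 1 - β with hA
  set B : ℝ := 1 + 2 * H with hB
  have hA1 : -1 < A := by rw [hA]; linarith
  have hAB : A + 1 < B := by rw [hA, hB]; linarith
  have hB0 : 0 ≤ B := by rw [hB]; linarith
  refine ⟨2 ^ (1 + β) * 2 ^ B * 2, by positivity, fun n t x c b hb hbv => ?_⟩
  set g : EuclideanSpace ℝ (Fin N) → ℂ := fun ξ => ∑ j, (c j : ℂ) *
    Complex.exp (((‖ξ‖ * t j - inner ℝ (x j) ξ : ℝ) : ℂ) * Complex.I) with hg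
  have hgc : Continuous g := by simp only [hg]; fun_prop
  set D : Set (ℝ × EuclideanSpace ℝ (Fin N)) :=
    {q | q.1 ≤ 2 * ‖q.2‖} ∩ {q | ‖q.2‖ ≤ 2 * q.1} with hD
  have hDm : MeasurableSet D :=
    (measurableSet_le measurable_fst (by fun_prop)).inter (measurableSet_le (by fun_prop) (by fun_prop))
  set k : ℝ → ℝ≥0∞ := fun ρ => ENNReal.ofReal (ρ ^ A * (1 + ρ) ^ (-B)) with hk
  have hkm : Measurable k := by simp only [hk]; fun_prop
  have hgm : Measurable fun ξ => ‖g ξ‖ₑ ^ 2 := hgc.measurable.enorm.pow_const 2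
  set G : ℝ × EuclideanSpace ℝ (Fin N) → ℝ≥0∞ := D.indicator fun q => ‖g q.2‖ₑ ^ 2 with hG
  have hGm : Measurable G := (hgm.comp measurable_snd).indicator hDm
  calc ∫⁻ v in b, ENNReal.ofReal (trigForm (radialMeasure A B)
        (fun j => ‖v‖ * t j - inner ℝ (x j) v) c)
      = ∫⁻ v in b, ∫⁻ ρ in Set.Ioi 0, k ρ * ‖g (ρ • v)‖ₑ ^ 2 := by
        refine lintegral_congr fun v => ?_
        rw [ofReal_trigForm_radialMeasure hA1 hAB]
        refine setLIntegral_congr_fun measurableSet_Ioi fun ρ hρ => ?_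
        have hρ0 : (0 : ℝ) < ρ := hρ
        have e1 : trigSum (fun j => ‖v‖ * t j - inner ℝ (x j) v) c ρ = g (ρ • v) := by
          simp only [trigSum, hg, norm_smul, Real.norm_of_nonneg hρ0.le, inner_smul_right]
          refine Finset.sum_congr rfl fun j _ => ?_
          rw [show ρ * (‖v‖ * t j - inner ℝ (x j) v) = ρ * ‖v‖ * t j - ρ * inner ℝ (x j) v by ring]
        simp only [hk]
        rw [e1, ENNReal.ofReal_mul (by positivity), ENNReal.ofReal_pow (norm_nonneg _), ofReal_norm]
    _ = ∫⁻ ρ in Set.Ioi 0, ∫⁻ v in b, k ρ * ‖g (ρ • v)‖ₑ ^ 2 := by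
        refine lintegral_lintegral_swap (Measurable.aemeasurable ?_)
        have h1 : Continuous fun q : EuclideanSpace ℝ (Fin N) × ℝ => g (q.2 • q.1) :=
          hgc.comp (by fun_prop)
        exact (hkm.comp measurable_snd).mul (h1.measurable.enorm.pow_const 2)
    _ ≤ ∫⁻ ρ in Set.Ioi 0, ∫⁻ ξ, ENNReal.ofReal (ρ ^ (-1 - β) * (1 + ρ) ^ (-B)) * G (ρ, ξ) := by
        refine setLIntegral_mono' measurableSet_Ioi fun ρ hρ => ?_
        have hρ0 : (0 : ℝ) < ρ := hρ
        have h1 : ∀ v ∈ b, k ρ * ‖g (ρ • v)‖ₑ ^ 2 ≤ k ρ * G (ρ, ρ • v) := by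
          intro v hv
          have hmem : (ρ, ρ • v) ∈ D := by
            simp only [hD, Set.mem_inter_iff, Set.mem_ofPred_eq, norm_smul, Real.norm_of_nonneg hρ0.le]
            constructor <;> nlinarith [hbv v hv]
          simp only [hG]
          rw [Set.indicator_of_mem hmem]
        refine (setLIntegral_mono' hb h1).trans ((setLIntegral_le_lintegral _ _).trans ?_)
        have hGρ : Measurable fun ξ => G (ρ, ξ) := hGm.comp (measurable_prodMk_left (x := ρ))
        rw [lintegral_const_mul' _ _ ENNReal.ofReal_ne_top, lintegral_smul_euclidean hGρ hρ0,
          lintegral_const_mul' _ _ ENNReal.ofReal_ne_top, ← mul_assoc,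
          ← ENNReal.ofReal_mul (by positivity)]
        refine le_of_eq ?_
        congr 2
        rw [mul_right_comm, ← Real.rpow_add hρ0]
        congr 2
        rw [hA]; ring
    _ = ∫⁻ ξ, ∫⁻ ρ in Set.Ioi 0, ENNReal.ofReal (ρ ^ (-1 - β) * (1 + ρ) ^ (-B)) * G (ρ, ξ) := by
        refine lintegral_lintegral_swap (Measurable.aemeasurable ?_)
        exact (by fun_prop : Measurable fun q : ℝ × EuclideanSpace ℝ (Fin N) =>
          ENNReal.ofReal (q.1 ^ (-1 - β) * (1 + q.1) ^ (-B))).mul hGm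
    _ ≤ ∫⁻ ξ, ENNReal.ofReal (2 ^ (1 + β) * 2 ^ B * 2) * (waveWeight β H ξ * ‖g ξ‖ₑ ^ 2) := by
        refine lintegral_mono fun ξ => ?_
        have h1 : ∀ ρ, ENNReal.ofReal (ρ ^ (-1 - β) * (1 + ρ) ^ (-B)) * G (ρ, ξ) =
            {ρ : ℝ | ρ ≤ 2 * ‖ξ‖ ∧ ‖ξ‖ ≤ 2 * ρ}.indicator
              (fun ρ => ENNReal.ofReal (ρ ^ (-1 - β) * (1 + ρ) ^ (-B))) ρ * ‖g ξ‖ₑ ^ 2 := by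
          intro ρ
          simp only [hG]
          by_cases h : ρ ≤ 2 * ‖ξ‖ ∧ ‖ξ‖ ≤ 2 * ρ
          · rw [Set.indicator_of_mem (show (ρ, ξ) ∈ D from h), Set.indicator_of_mem (by exact h)]
          · rw [Set.indicator_of_notMem (show (ρ, ξ) ∉ D from h),
              Set.indicator_of_notMem (by exact h), mul_zero, zero_mul]
        simp_rw [h1]
        rw [lintegral_mul_const' _ _ (by finiteness), ← mul_assoc]
        exact mul_le_mul' (lintegral_annulus_weight_le hβ0.le hB0 (norm_nonneg _)) le_rfl
    _ = _ := by
        rw [lintegral_const_mul' _ _ ENNReal.ofReal_ne_top]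
        rfl

end RadialReduction

section Averaging

theorem trigForm_le {n : ℕ} (μ : Measure ℝ) [IsFiniteMeasure μ] (p c : Fin n → ℝ) :
    trigForm μ p c ≤ (∑ j, |c j|) ^ 2 * μ.real Set.univ := by
  have h : ∀ ρ, ‖trigSum p c ρ‖ ^ 2 ≤ (∑ j, |c j|) ^ 2 := fun ρ =>
    pow_le_pow_left₀ (norm_nonneg _) (norm_trigSum_le p c ρ) 2
  refine (integral_mono (integrable_norm_trigSum_sq μ p c) (integrable_const _) h).trans_eq ?_
  rw [integral_const, smul_eq_mul, mul_comm]

theorem ofReal_exp_neg_integral_le {S : Type*} [MeasurableSpace S] {σ : Measure S}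
    [IsProbabilityMeasure σ] {F : S → ℝ} (hF : Measurable F) {C : ℝ} (h0 : ∀ s, 0 ≤ F s)
    (hC : ∀ s, F s ≤ C) :
    ENNReal.ofReal (Real.exp (-∫ s, F s ∂σ)) ≤ ∫⁻ s, ENNReal.ofReal (Real.exp (-F s)) ∂σ := by
  have hFi : Integrable F σ := Integrable.of_bound hF.aestronglyMeasurable C
    (ae_of_all _ fun s => by rw [Real.norm_of_nonneg (h0 s)]; exact hC s)
  have hei : Integrable (fun s => Real.exp (-F s)) σ := by
    refine Integrable.of_bound (C := 1) (by fun_prop) (ae_of_all _ fun s => ?_)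
    rw [Real.norm_of_nonneg (Real.exp_pos _).le]
    exact Real.exp_le_one_iff.2 (neg_nonpos.2 (h0 s))
  have h := convexOn_exp.map_integral_le (μ := σ) (f := fun s => -F s)
    Real.continuous_exp.continuousOn isClosed_univ (ae_of_all _ fun _ => Set.mem_univ _) hFi.neg hei
  rw [integral_neg] at h
  rw [← ofReal_integral_eq_lintegral_ofReal hei (ae_of_all _ fun s => (Real.exp_pos _).le)]
  exact ENNReal.ofReal_le_ofReal h

theorem lintegral_exp_neg_sum_trigForm_le {μ : Measure ℝ} [IsFiniteMeasure μ] {n d k : ℕ}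
    (hk : 0 < k) (γ l : ℝ) (q : Fin k → Fin n → ℝ) :
    ∫⁻ y : Fin n → Fin d → ℝ, (∏ j, ∏ i, ENNReal.ofReal ((1 + |y j i|) ^ γ)) *
      ENNReal.ofReal (Real.exp (-∑ i, ∑ κ, l * trigForm μ (q κ) fun j => y j i)) ≤
      ∏ κ, gaussMoment μ γ (l * k) (q κ) ^ ((d : ℝ) / k) := by
  have hk' : (0 : ℝ) < k := by exact_mod_cast hk
  have hQ : ∀ κ, Measurable (trigForm μ (q κ)) := fun κ => measurable_trigForm_right μ (q κ)
  set G : (Fin n → ℝ) → ℝ≥0∞ := fun c => (∏ j, ENNReal.ofReal ((1 + |c j|) ^ γ)) *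
    ENNReal.ofReal (Real.exp (-∑ κ, l * trigForm μ (q κ) c)) with hG
  have hGm : Measurable G := by simp only [hG]; fun_prop
  have h1 : ∀ y : Fin n → Fin d → ℝ, (∏ j, ∏ i, ENNReal.ofReal ((1 + |y j i|) ^ γ)) *
      ENNReal.ofReal (Real.exp (-∑ i, ∑ κ, l * trigForm μ (q κ) fun j => y j i)) =
      ∏ i, G fun j => y j i := by
    intro y
    simp only [hG]
    rw [Finset.prod_mul_distrib, Finset.prod_comm, ← Finset.sum_neg_distrib, Real.exp_sum,
      ENNReal.ofReal_prod_of_nonneg fun i _ => (Real.exp_pos _).le]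
  have h2 : ∫⁻ c, G c ≤ ∏ κ, gaussMoment μ γ (l * k) (q κ) ^ ((1 : ℝ) / k) := by
    set f : Fin k → (Fin n → ℝ) → ℝ≥0∞ := fun κ c => (∏ j, ENNReal.ofReal ((1 + |c j|) ^ γ)) *
      ENNReal.ofReal (Real.exp (-(l * k * trigForm μ (q κ) c))) with hf
    have hfm : ∀ κ, Measurable (f κ) := fun κ => by
      have := hQ κ
      simp only [hf]; fun_prop
    have h3 := ENNReal.lintegral_prod_norm_pow_le (μ := volume) Finset.univ (f := f)
      (p := fun _ => (1 : ℝ) / k) (fun κ _ => (hfm κ).aemeasurable)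
      (by rw [Finset.sum_const, Finset.card_univ, Fintype.card_fin, nsmul_eq_mul]; field_simp)
      (fun κ _ => by positivity)
    refine le_trans (le_of_eq (lintegral_congr fun c => ?_)) h3
    simp only [hG, hf]
    simp_rw [ENNReal.mul_rpow_of_nonneg _ _ (show (0 : ℝ) ≤ 1 / k by positivity)]
    rw [Finset.prod_mul_distrib, Finset.prod_const, Finset.card_univ, Fintype.card_fin,
      ← ENNReal.rpow_natCast, ← ENNReal.rpow_mul, one_div_mul_cancel hk'.ne', ENNReal.rpow_one,
      ← Finset.sum_neg_distrib, Real.exp_sum,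
      ENNReal.ofReal_prod_of_nonneg fun i _ => (Real.exp_pos _).le]
    congr 1
    refine Finset.prod_congr rfl fun κ _ => ?_
    rw [ENNReal.ofReal_rpow_of_pos (Real.exp_pos _), ← Real.exp_mul]
    congr 2
    field_simp
  simp_rw [h1]
  rw [lintegral_swap_prod fun _ => hGm, Finset.prod_const, Finset.card_univ, Fintype.card_fin]
  refine (pow_le_pow_left' h2 d).trans_eq ?_
  rw [← Finset.prod_pow]
  refine Finset.prod_congr rfl fun κ _ => ?_
  rw [← ENNReal.rpow_natCast, ← ENNReal.rpow_mul, one_div_mul_eq_div]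

theorem pi_smul_volume {n k : ℕ} (c : ℝ≥0∞) (hc : c ≠ ⊤) :
    Measure.pi (fun _ : Fin n => c • (volume : Measure (Fin k → ℝ))) = c ^ n • volume := by
  have : SigmaFinite (c • (volume : Measure (Fin k → ℝ))) := by
    lift c to ℝ≥0 using hc
    exact inferInstanceAs (SigmaFinite (c • (volume : Measure (Fin k → ℝ))))
  refine Measure.pi_eq fun s hs => ?_
  rw [Measure.smul_apply, volume_pi_pi, smul_eq_mul]
  simp_rw [Measure.smul_apply, smul_eq_mul]
  rw [Finset.prod_mul_distrib, Finset.prod_const, Finset.card_univ, Fintype.card_fin]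

theorem lintegral_prod_affine_le {n k : ℕ} {M : Matrix (Fin k) (Fin k) ℝ} {o a b : Fin k → ℝ}
    {δ R : ℝ} (hδ : 0 < δ) (hdet : δ ≤ |M.det|)
    (hR : ∀ w ∈ Set.Icc a b, ∀ κ, (M.mulVec w + o) κ ∈ Set.Icc (-R) R)
    {Φ : (Fin n → ℝ) → ℝ≥0∞} (hΦ : Measurable Φ) :
    ∫⁻ w : Fin n → Fin k → ℝ, ∏ κ, Φ (fun j => (M.mulVec (w j) + o) κ)
      ∂(Measure.pi fun _ => (volume : Measure (Fin k → ℝ)).restrict (Set.Icc a b)) ≤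
      ENNReal.ofReal δ⁻¹ ^ n *
        (∫⁻ p, Φ p ∂(Measure.pi fun _ : Fin n => volume.restrict (Set.Icc (-R) R))) ^ k := by
  have hdet0 : M.det ≠ 0 := abs_pos.1 (hδ.trans_le hdet)
  set D : Set (Fin n → ℝ) := Set.univ.pi fun _ => Set.Icc (-R) R with hD
  have hDm : MeasurableSet D := MeasurableSet.univ_pi fun _ => measurableSet_Icc
  set c : ℝ≥0∞ := ENNReal.ofReal |M.det⁻¹| with hc
  have hcδ : c ≤ ENNReal.ofReal δ⁻¹ := by
    refine ENNReal.ofReal_le_ofReal ?_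
    rw [abs_inv]
    exact inv_anti₀ hδ hdet
  have hmp : MeasurePreserving (fun w : Fin k → ℝ => M.mulVec w + o) volume (c • volume) := by
    have h1 : MeasurePreserving (Matrix.toLin' M) volume (c • volume) :=
      ⟨(Matrix.toLin' M).continuous_of_finiteDimensional.measurable,
        Real.map_matrix_volume_pi_eq_smul_volume_pi hdet0⟩
    have h2 : MeasurePreserving (fun z : Fin k → ℝ => z + o) (c • volume) (c • volume) :=
      (measurePreserving_add_right volume o).smul_measure c
    exact h2.comp h1
  have hsf : SigmaFinite (c • (volume : Measure (Fin k → ℝ))) := by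
    have : c • (volume : Measure (Fin k → ℝ)) = (Real.toNNReal |M.det⁻¹|) • volume := rfl
    rw [this]; infer_instance
  have hmpn : MeasurePreserving (fun (w : Fin n → Fin k → ℝ) j => M.mulVec (w j) + o)
      volume (c ^ n • volume) := by
    have := measurePreserving_pi (fun _ : Fin n => (volume : Measure (Fin k → ℝ)))
      (fun _ : Fin n => c • (volume : Measure (Fin k → ℝ))) (fun _ => hmp)
    rwa [pi_smul_volume c ENNReal.ofReal_ne_top] at this
  have hfm : Measurable (D.indicator Φ) := hΦ.indicator hDm
  have hprodm : Measurable fun z : Fin n → Fin k → ℝ => ∏ κ, D.indicator Φ fun j => z j κ :=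
    Finset.measurable_fun_prod _ fun κ _ => hfm.comp
      (measurable_pi_lambda _ fun j => (measurable_pi_apply κ).comp (measurable_pi_apply j))
  rw [← Measure.restrict_pi_pi, ← volume_pi]
  calc ∫⁻ w : Fin n → Fin k → ℝ in Set.univ.pi fun _ => Set.Icc a b,
        ∏ κ, Φ (fun j => (M.mulVec (w j) + o) κ)
      ≤ ∫⁻ w : Fin n → Fin k → ℝ in Set.univ.pi fun _ => Set.Icc a b,
        ∏ κ, D.indicator Φ (fun j => (M.mulVec (w j) + o) κ) := by
        refine setLIntegral_mono' (MeasurableSet.univ_pi fun _ => measurableSet_Icc) fun w hw => ?_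
        refine Finset.prod_le_prod' fun κ _ => ?_
        rw [Set.indicator_of_mem]
        exact fun j _ => hR (w j) (hw j (Set.mem_univ j)) κ
    _ ≤ ∫⁻ w : Fin n → Fin k → ℝ, ∏ κ, D.indicator Φ (fun j => (M.mulVec (w j) + o) κ) :=
        setLIntegral_le_lintegral _ _
    _ = c ^ n * (∫⁻ p in D, Φ p) ^ k := by
        rw [hmpn.lintegral_comp hprodm, lintegral_smul_measure, smul_eq_mul,
          lintegral_swap_prod fun _ => hfm, Finset.prod_const, Finset.card_univ, Fintype.card_fin,
          lintegral_indicator hDm]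
    _ ≤ _ := by
        rw [← Measure.restrict_pi_pi, ← volume_pi]
        exact mul_le_mul' (pow_le_pow_left' hcδ n) le_rfl

end Averaging

section Combination

theorem lintegral_lintegral_exp_neg_average_le {S V Y : Type*} [MeasurableSpace S]
    [MeasurableSpace V] [MeasurableSpace Y] {σ : Measure S} [IsProbabilityMeasure σ]
    {ν : Measure V} [SFinite ν] {η : Measure Y} [SFinite η] {p : Y → ℝ≥0∞} (hp : Measurable p)
    (hptop : ∀ y, p y ≠ ⊤) {F : S → V → Y → ℝ}
    (hF : Measurable fun x : (S × V) × Y => F x.1.1 x.1.2 x.2) (h0 : ∀ s w y, 0 ≤ F s w y)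
    {C : Y → ℝ} (hC : ∀ s w y, F s w y ≤ C y) :
    ∫⁻ w, ∫⁻ y, p y * ENNReal.ofReal (Real.exp (-∫ s, F s w y ∂σ)) ∂η ∂ν ≤
      ∫⁻ s, ∫⁻ w, ∫⁻ y, p y * ENNReal.ofReal (Real.exp (-F s w y)) ∂η ∂ν ∂σ := by
  set Ψ : (S × V) × Y → ℝ≥0∞ := fun x =>
    p x.2 * ENNReal.ofReal (Real.exp (-F x.1.1 x.1.2 x.2)) with hΨ
  have hΨm : Measurable Ψ := (hp.comp measurable_snd).mul
    (Real.measurable_exp.comp hF.neg).ennreal_ofReal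
  calc ∫⁻ w, ∫⁻ y, p y * ENNReal.ofReal (Real.exp (-∫ s, F s w y ∂σ)) ∂η ∂ν
      ≤ ∫⁻ w, ∫⁻ s, (∫⁻ y, Ψ ((s, w), y) ∂η) ∂σ ∂ν := by
        refine lintegral_mono fun w => ?_
        have h1 : Measurable fun x : S × Y => Ψ ((x.1, w), x.2) := by
          have h2 : Measurable fun x : S × Y => ((x.1, w), x.2) := by fun_prop
          exact hΨm.comp h2
        rw [lintegral_lintegral_swap h1.aemeasurable]
        refine lintegral_mono fun y => ?_
        simp only [hΨ]
        rw [lintegral_const_mul' _ _ (hptop y)]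
        have h3 : Measurable fun s => F s w y := by
          have h2 : Measurable fun s : S => ((s, w), y) := by fun_prop
          exact hF.comp h2
        exact mul_le_mul' le_rfl
          (ofReal_exp_neg_integral_le h3 (fun s => h0 s w y) fun s => hC s w y)
    _ = ∫⁻ s, ∫⁻ w, (∫⁻ y, Ψ ((s, w), y) ∂η) ∂ν ∂σ := by
        refine lintegral_lintegral_swap (Measurable.aemeasurable ?_)
        exact hΨm.lintegral_prod_right'.comp measurable_swap

theorem measurable_sum_sum_trigForm {S : Type*} [MeasurableSpace S] {μ : Measure ℝ}
    [IsFiniteMeasure μ] (l : ℝ) {d k n : ℕ} {q : S → (Fin k → ℝ) → Fin k → ℝ}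
    (hq : ∀ κ, Measurable fun x : S × (Fin k → ℝ) => q x.1 x.2 κ) :
    Measurable fun x : (S × (Fin n → Fin k → ℝ)) × (Fin n → Fin d → ℝ) =>
      ∑ i, ∑ κ, l * trigForm μ (fun j => q x.1.1 (x.1.2 j) κ) (fun j => x.2 j i) := by
  refine Finset.measurable_fun_sum _ fun i _ => Finset.measurable_fun_sum _ fun κ _ => ?_
  have h1 : Measurable fun x : (S × (Fin n → Fin k → ℝ)) × (Fin n → Fin d → ℝ) =>
      ((fun j => q x.1.1 (x.1.2 j) κ, fun j => x.2 j i) : (Fin n → ℝ) × (Fin n → ℝ)) := by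
    refine Measurable.prodMk (measurable_pi_lambda _ fun j => ?_)
      (measurable_pi_lambda _ fun j => by fun_prop)
    have h2 : Measurable fun x : (S × (Fin n → Fin k → ℝ)) × (Fin n → Fin d → ℝ) =>
      (x.1.1, x.1.2 j) := by fun_prop
    have h3 := (hq κ).comp h2
    simpa only [Function.comp_def] using h3
  have h2 := ((measurable_trigForm (n := n) μ).comp h1).const_mul l
  simpa only [Function.comp_def] using h2

theorem lintegral_exp_neg_average_lt_top {S : Type*} [MeasurableSpace S] {σ : Measure S}
    [IsProbabilityMeasure σ] {μ : Measure ℝ} [IsFiniteMeasure μ] {κ₀ θ : ℝ} (hκ : 0 < κ₀)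
    (hθ : 0 < θ)
    (hlnd : ∀ (n : ℕ) (p c : Fin n → ℝ) (j : Fin n) (δ : ℝ), 0 < δ → δ ≤ 1 →
      (∀ i, i ≠ j → c i = 0 ∨ δ ≤ |p i - p j|) → κ₀ * c j ^ 2 * δ ^ θ ≤ trigForm μ p c)
    {γ l : ℝ} (hγ : 0 < γ) (hγ1 : γ ≤ 1) (hl : 0 < l) {d k : ℕ} (hk : 0 < k)
    (hlt : θ / 2 * (1 + 2 * γ) * ((d : ℝ) / k) < 1)
    {M : S → Matrix (Fin k) (Fin k) ℝ} {o : S → Fin k → ℝ} {a b : Fin k → ℝ}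
    (hM : ∀ κ, Measurable fun x : S × (Fin k → ℝ) => ((M x.1).mulVec x.2 + o x.1) κ)
    {δ R : ℝ} (hδ : 0 < δ) (hdet : ∀ᵐ s ∂σ, δ ≤ |(M s).det|)
    (hR : ∀ᵐ s ∂σ, ∀ w ∈ Set.Icc a b, ∀ κ, ((M s).mulVec w + o s) κ ∈ Set.Icc (-R) R) (n : ℕ) :
    ∫⁻ w : Fin (n + 1) → Fin k → ℝ, (∫⁻ y : Fin (n + 1) → Fin d → ℝ,
      (∏ j, ∏ i, ENNReal.ofReal ((1 + |y j i|) ^ γ)) *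
        ENNReal.ofReal (Real.exp (-∫ s, ∑ i, ∑ κ, l * trigForm μ
          (fun j => ((M s).mulVec (w j) + o s) κ) (fun j => y j i) ∂σ)))
      ∂(Measure.pi fun _ => (volume : Measure (Fin k → ℝ)).restrict (Set.Icc a b)) < ⊤ := by
  have hk' : (0 : ℝ) < k := by exact_mod_cast hk
  have hJtop := lintegral_gaussMoment_rpow_lt_top hκ hθ hlnd hγ hγ1
    (mul_pos hl hk') (by positivity) hlt R n
  have hmain := lintegral_lintegral_exp_neg_average_le (σ := σ)
    (ν := Measure.pi fun _ : Fin (n + 1) => (volume : Measure (Fin k → ℝ)).restrict (Set.Icc a b))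
    (η := (volume : Measure (Fin (n + 1) → Fin d → ℝ)))
    (p := fun y => ∏ j, ∏ i, ENNReal.ofReal ((1 + |y j i|) ^ γ)) (by fun_prop)
    (fun y => ENNReal.prod_ne_top fun j _ => ENNReal.prod_ne_top fun i _ => ENNReal.ofReal_ne_top)
    (F := fun s w y => ∑ i, ∑ κ, l * trigForm μ
      (fun j => ((M s).mulVec (w j) + o s) κ) (fun j => y j i))
    (measurable_sum_sum_trigForm (μ := μ) l (d := d) (n := n + 1)
      (q := fun s w => (M s).mulVec w + o s) hM)
    (fun s w y => Finset.sum_nonneg fun i _ => Finset.sum_nonneg fun κ _ =>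
        mul_nonneg hl.le (trigForm_nonneg μ _ _))
    (C := fun y => ∑ i, ∑ _κ : Fin k, l * ((∑ j, |y j i|) ^ 2 * μ.real Set.univ))
    (fun s w y => Finset.sum_le_sum fun i _ => Finset.sum_le_sum fun κ _ =>
        mul_le_mul_of_nonneg_left (trigForm_le μ _ _) hl.le)
  refine hmain.trans_lt ?_
  refine lt_of_le_of_lt (lintegral_mono_ae (g := fun _ => ENNReal.ofReal δ⁻¹ ^ (n + 1) *
    (∫⁻ q, gaussMoment μ γ (l * k) q ^ ((d : ℝ) / k)
      ∂(Measure.pi fun _ : Fin (n + 1) => volume.restrict (Set.Icc (-R) R))) ^ k) ?_) ?_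
  · filter_upwards [hdet, hR] with s hs hs'
    refine le_trans (lintegral_mono fun w => ?_) (lintegral_prod_affine_le hδ hs hs'
      ((measurable_gaussMoment μ γ (l * k)).pow_const ((d : ℝ) / k)))
    exact lintegral_exp_neg_sum_trigForm_le hk γ l fun κ j => ((M s).mulVec (w j) + o s) κ
  · rw [lintegral_const, measure_univ, mul_one]
    exact ENNReal.mul_lt_top (ENNReal.pow_lt_top ENNReal.ofReal_lt_top) (ENNReal.pow_lt_top hJtop)

end Combination

section WaveLocalTime

variable {N d : ℕ} {Ω : Type*} [MeasurableSpace Ω]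

theorem lintegral_cond_ball_add (v : EuclideanSpace ℝ (Fin N)) (η : ℝ)
    {σ : Measure (EuclideanSpace ℝ (Fin N))}
    (hσ : σ = ProbabilityTheory.cond volume (Metric.ball 0 η))
    (F : EuclideanSpace ℝ (Fin N) → ℝ≥0∞) :
    ∫⁻ s, F (v + s) ∂σ =
      (volume (Metric.ball (0 : EuclideanSpace ℝ (Fin N)) η))⁻¹ * ∫⁻ z in Metric.ball v η, F z := by
  have h1 := (measurePreserving_add_left (volume : Measure (EuclideanSpace ℝ (Fin N))) v)
    |>.setLIntegral_comp_preimage_emb (measurableEmbedding_addLeft v) F (Metric.ball v η)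
  have h2 : (fun s => v + s) ⁻¹' Metric.ball v η = Metric.ball 0 η := by
    ext s; simp
  rw [h2] at h1
  rw [hσ, ProbabilityTheory.cond, lintegral_smul_measure, smul_eq_mul, h1]

/-- The occupation measure of a reparametrized solution has a jointly continuous density as soon as
suitable plane-wave phases form an affine coordinate system. -/
theorem hasJointlyContinuousLocalTime_waveSolution {P : Measure Ω} [IsProbabilityMeasure P]
    {H β : ℝ} (hH : 1 / 2 ≤ H) (hH1 : H < 1) (hβ0 : 0 < β) (hβN : β < N)
    (hβlow : (N : ℝ) - 2 * H - 1 < β) {f h : EuclideanSpace ℝ (Fin N) → ℝ}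
    (hf : IsSpatialCovariance β f h) {W : Fin d → Test N → Ω → ℝ}
    (hW : IsFractionalColoredNoise P H f W)
    {u : ℝ → EuclideanSpace ℝ (Fin N) → Ω → EuclideanSpace ℝ (Fin d)}
    (hu : IsWaveSolution P H h W u) {k : ℕ} (hk : 0 < k) (hαd : holderIndex N H β * d < k)
    {τ : (Fin k → ℝ) → ℝ} (hτ : Measurable τ) {χ : (Fin k → ℝ) → EuclideanSpace ℝ (Fin N)}
    (hχ : Measurable χ) {v : Fin k → EuclideanSpace ℝ (Fin N)} (hv : ∀ κ, ‖v κ‖ = 1)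
    {M : EuclideanSpace ℝ (Fin N) → Matrix (Fin k) (Fin k) ℝ} (hM : Continuous M)
    (hM0 : (M 0).det ≠ 0) {o : EuclideanSpace ℝ (Fin N) → Fin k → ℝ} (ho : Continuous o)
    (hphase : ∀ s w κ, ‖v κ + s‖ * τ w - inner ℝ (χ w) (v κ + s) = ((M s).mulVec w + o s) κ)
    {a b : Fin k → ℝ} {t₀ : ℝ} (ht₀ : 0 < t₀) (ht : ∀ w ∈ Set.Icc a b, t₀ ≤ τ w) :
    HasJointlyContinuousLocalTime P (fun w ω => u (τ w) (χ w) ω) a b := by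
  have hk' : (0 : ℝ) < k := by exact_mod_cast hk
  set A : ℝ := N - 1 - β with hA
  set B : ℝ := 1 + 2 * H with hB
  have hA1 : -1 < A := by rw [hA]; linarith
  have hA2 : A < 2 := by rw [hA]; linarith
  have hAB : A + 1 < B := by rw [hA, hB]; linarith
  have hfin := isFiniteMeasure_radialMeasure hA1 hAB
  obtain ⟨κ₀, hκ₀, hlnd⟩ := exists_trigForm_ge hA1 hA2 hAB
  set μ := radialMeasure A B with hμ
  obtain ⟨C, hC, hCb⟩ := exists_norm_charFun_waveSolution_le hH hH1 hβ0 hβN hf hW hu ht₀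
  obtain ⟨C', hC', hCb'⟩ := exists_lintegral_trigForm_le_waveForm hH hβ0 hβN hβlow
  set q : EuclideanSpace ℝ (Fin N) → (Fin k → ℝ) → Fin k → ℝ := fun s w =>
    (M s).mulVec w + o s with hq
  have hqc : Continuous fun x : EuclideanSpace ℝ (Fin N) × (Fin k → ℝ) => q x.1 x.2 :=
    ((hM.comp continuous_fst).matrix_mulVec continuous_snd).add (ho.comp continuous_fst)
  have hqm : ∀ κ, Measurable fun x : EuclideanSpace ℝ (Fin N) × (Fin k → ℝ) => q x.1 x.2 κ :=
    fun κ => ((continuous_apply κ).comp hqc).measurable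
  obtain ⟨η, hη, hη2, hηdet⟩ : ∃ η : ℝ, 0 < η ∧ η ≤ 1 / 2 ∧
      ∀ s ∈ Metric.ball (0 : EuclideanSpace ℝ (Fin N)) η, |(M 0).det| / 2 ≤ |(M s).det| := by
    have h1 : Continuous fun s => |(M s).det| := hM.matrix_det.abs
    have h2 : ∀ᶠ s in 𝓝 (0 : EuclideanSpace ℝ (Fin N)), |(M 0).det| / 2 < |(M s).det| :=
      h1.continuousAt.eventually_const_lt (half_lt_self (abs_pos.2 hM0))
    obtain ⟨ε, hε, hεs⟩ := Metric.eventually_nhds_iff_ball.1 h2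
    exact ⟨min ε (1 / 2), by positivity, min_le_right _ _, fun s hs =>
      (hεs s (Metric.ball_subset_ball (min_le_left _ _) hs)).le⟩
  obtain ⟨R, hR⟩ : ∃ R : ℝ, ∀ x ∈ Metric.closedBall (0 : EuclideanSpace ℝ (Fin N)) (1 / 2) ×ˢ
      Set.Icc a b, ‖q x.1 x.2‖ ≤ R :=
    ((isCompact_closedBall _ _).prod isCompact_Icc).exists_bound_of_continuousOn hqc.continuousOn
  set ball : Set (EuclideanSpace ℝ (Fin N)) := Metric.ball 0 η with hball
  have hm0 : volume ball ≠ 0 := (Metric.measure_ball_pos volume _ hη).ne'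
  have hmtop : volume ball ≠ ⊤ := measure_ball_lt_top.ne
  set m : ℝ := (volume ball).toReal with hm
  have hmpos : 0 < m := ENNReal.toReal_pos hm0 hmtop
  set σ : Measure (EuclideanSpace ℝ (Fin N)) := ProbabilityTheory.cond volume ball with hσ
  have hprob : IsProbabilityMeasure σ := ProbabilityTheory.cond_isProbabilityMeasure_of_finite hm0 hmtop
  have hσmem : ∀ᵐ s ∂σ, s ∈ ball := ProbabilityTheory.ae_cond_mem Metric.isOpen_ball.measurableSet
  have hint : ∀ {n : ℕ} (w : Fin n → Fin k → ℝ) (c : Fin n → ℝ) (κ : Fin k),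
      Integrable (fun s => trigForm μ (fun j => q s (w j) κ) c) σ := by
    intro n w c κ
    have h1 : Measurable fun s => ((fun j => q s (w j) κ, c) : (Fin n → ℝ) × (Fin n → ℝ)) := by
      refine Measurable.prodMk (measurable_pi_lambda _ fun j => ?_) measurable_const
      have h2 : Measurable fun s : EuclideanSpace ℝ (Fin N) => (s, w j) := by fun_prop
      exact (hqm κ).comp h2
    have h2 := (measurable_trigForm (n := n) μ).comp h1
    simp only [Function.comp_def] at h2
    refine Integrable.of_bound h2.aestronglyMeasurable ((∑ j, |c j|) ^ 2 * μ.real Set.univ)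
      (ae_of_all _ fun s => ?_)
    rw [Real.norm_of_nonneg (trigForm_nonneg μ _ _)]
    exact trigForm_le μ _ _
  have hform : ∀ {n : ℕ} (w : Fin n → Fin k → ℝ) (c : Fin n → ℝ) (κ : Fin k),
      ENNReal.ofReal (m / C' * ∫ s, trigForm μ (fun j => q s (w j) κ) c ∂σ) ≤
        waveForm β H (fun j => τ (w j)) (fun j => χ (w j)) c := by
    intro n w c κ
    rw [ENNReal.ofReal_mul (by positivity), ofReal_integral_eq_lintegral_ofReal (hint w c κ)
      (ae_of_all _ fun s => trigForm_nonneg μ _ _)]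
    have h1 : ∀ s, ENNReal.ofReal (trigForm μ (fun j => q s (w j) κ) c) =
        (fun z : EuclideanSpace ℝ (Fin N) => ENNReal.ofReal (trigForm μ
          (fun j => ‖z‖ * τ (w j) - inner ℝ (χ (w j)) z) c)) (v κ + s) := by
      intro s
      simp only [hq, hphase]
    have h5 : ∫⁻ s, ENNReal.ofReal (trigForm μ (fun j => q s (w j) κ) c) ∂σ =
        (volume ball)⁻¹ * ∫⁻ z in Metric.ball (v κ) η, ENNReal.ofReal (trigForm μ
          (fun j => ‖z‖ * τ (w j) - inner ℝ (χ (w j)) z) c) :=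
      (lintegral_congr h1).trans (lintegral_cond_ball_add (v κ) η hσ
        fun z => ENNReal.ofReal (trigForm μ (fun j => ‖z‖ * τ (w j) - inner ℝ (χ (w j)) z) c))
    rw [h5]
    have h2 := hCb' n (fun j => τ (w j)) (fun j => χ (w j)) c (Metric.ball (v κ) η)
      Metric.isOpen_ball.measurableSet (fun z hz => by
        have h3 : ‖z - v κ‖ < η := by rwa [← dist_eq_norm]
        have h4 := abs_le.1 (abs_norm_sub_norm_le z (v κ))
        rw [hv κ] at h4
        constructor <;> linarith [h4.1, h4.2])
    refine (mul_le_mul' le_rfl (mul_le_mul' le_rfl h2)).trans_eq ?_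
    rw [← ENNReal.ofReal_toReal hmtop, ← hm, ← ENNReal.ofReal_inv_of_pos hmpos, ← mul_assoc,
      ← mul_assoc, ← ENNReal.ofReal_mul (by positivity), ← ENNReal.ofReal_mul (by positivity),
      show m / C' * m⁻¹ * C' = 1 by field_simp, ENNReal.ofReal_one, one_mul]
  set l : ℝ := C * (m / C') / k with hl
  have hlpos : 0 < l := by positivity
  have hbound : ∀ (n : ℕ) (w : Fin n → Fin k → ℝ) (y : Fin n → Fin d → ℝ),
      (∀ j, w j ∈ Set.Icc a b) →
      ‖∫ ω, Complex.exp (((∑ j, ∑ i, y j i * u (τ (w j)) (χ (w j)) ω i : ℝ) : ℂ) *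
        Complex.I) ∂P‖ₑ ≤ ENNReal.ofReal (Real.exp (-∫ s, ∑ i, ∑ κ, l * trigForm μ
          (fun j => q s (w j) κ) (fun j => y j i) ∂σ)) := by
    intro n w y hw
    rw [← ofReal_norm]
    refine ENNReal.ofReal_le_ofReal ?_
    set I : Fin d → Fin k → ℝ := fun i κ =>
      ∫ s, trigForm μ (fun j => q s (w j) κ) (fun j => y j i) ∂σ with hI
    have hI0 : ∀ i κ, 0 ≤ I i κ := fun i κ => integral_nonneg fun s => trigForm_nonneg μ _ _
    have h1 := hCb n (fun j => τ (w j)) (fun j => χ (w j)) y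
      (fun i => (∑ κ, m / C' * I i κ) / k) (fun j => ht _ (hw j))
      (fun i => div_nonneg (Finset.sum_nonneg fun κ _ => mul_nonneg (by positivity) (hI0 i κ))
        hk'.le) (fun i => by
        rw [div_eq_inv_mul, ENNReal.ofReal_mul (by positivity),
          ENNReal.ofReal_sum_of_nonneg fun κ _ => mul_nonneg (by positivity) (hI0 i κ)]
        refine (mul_le_mul' le_rfl (Finset.sum_le_sum fun κ _ =>
          hform w (fun j => y j i) κ)).trans_eq ?_
        rw [Finset.sum_const, Finset.card_univ, Fintype.card_fin, nsmul_eq_mul, ← mul_assoc,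
          ← ENNReal.ofReal_natCast, ← ENNReal.ofReal_mul (by positivity),
          inv_mul_cancel₀ hk'.ne', ENNReal.ofReal_one, one_mul])
    refine h1.trans_eq ?_
    congr 2
    rw [integral_finsetSum _ fun i _ => integrable_finsetSum _ fun κ _ =>
      (hint w (fun j => y j i) κ).const_mul l, Finset.mul_sum]
    refine Finset.sum_congr rfl fun i _ => ?_
    rw [integral_finsetSum _ fun κ _ => (hint w (fun j => y j i) κ).const_mul l,
      mul_div_assoc', Finset.mul_sum, Finset.sum_div]
    refine Finset.sum_congr rfl fun κ _ => ?_
    rw [integral_const_mul, hl]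
    ring
  set θ : ℝ := B - A - 1 with hθ
  have hθα : θ / 2 = holderIndex N H β := by rw [hθ, hA, hB, holderIndex]; ring
  have hθ0 : 0 < θ := by rw [hθ]; linarith
  set e : ℝ := θ / 2 * (d / k) with he
  have he0 : 0 ≤ e := by positivity
  have he1 : e < 1 := by
    rw [he, hθα, mul_div_assoc', div_lt_one hk']
    exact hαd
  have hγlt : θ / 2 * (1 + 2 * ((1 - e) / 4)) * ((d : ℝ) / k) < 1 := by
    rw [mul_right_comm, ← he]
    nlinarith
  refine hasJointlyContinuousLocalTime_of_charMoment (γ := (1 - e) / 4) ?_ (by linarith)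
    (by linarith) fun n => ?_
  · have h1 : Measurable fun p : (Fin k → ℝ) × Ω => ((τ p.1, χ p.1), p.2) := by fun_prop
    exact hu.measurable.comp h1
  · refine lt_of_le_of_lt ?_ (lintegral_exp_neg_average_lt_top (σ := σ) hκ₀ hθ0 hlnd
      (γ := (1 - e) / 4) (by linarith) (by linarith) hlpos hk hγlt (M := M) (o := o) hqm
      (half_pos (abs_pos.2 hM0)) (hσmem.mono hηdet) (R := R) (a := a) (b := b)
      (hσmem.mono fun s hs w hw κ => ?_) n)
    · rw [charMoment, ← Measure.restrict_pi_pi]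
      refine setLIntegral_mono' (MeasurableSet.univ_pi fun _ => measurableSet_Icc) fun w hw => ?_
      refine lintegral_mono fun y => mul_le_mul' le_rfl ?_
      exact hbound _ w y fun j => hw j (Set.mem_univ j)
    · have h1 := hR (s, w) (Set.mk_mem_prod (Metric.closedBall_subset_closedBall hη2
        (Metric.ball_subset_closedBall hs)) hw)
      have h2 := (norm_le_pi_norm (q s w) κ).trans h1
      exact abs_le.1 h2

end WaveLocalTime

section Coordinates

theorem HasJointlyContinuousLocalTime.of_measurableEquiv {Z Z' Ω V : Type*} [MeasureSpace Z]
    [TopologicalSpace Z] [Preorder Z] [MeasureSpace Z'] [TopologicalSpace Z'] [Preorder Z']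
    [MeasurableSpace Ω] [MeasureSpace V] [TopologicalSpace V] {P : Measure Ω} {X : Z → Ω → V}
    {a b : Z} (e : Z ≃ᵐ Z') (hle : ∀ z w, e z ≤ e w ↔ z ≤ w) (hcont : Continuous e)
    (hvol : MeasurePreserving e volume volume)
    (h : HasJointlyContinuousLocalTime P (fun z => X (e.symm z)) (e a) (e b)) :
    HasJointlyContinuousLocalTime P X a b := by
  obtain ⟨L, ⟨hm, hd⟩, hc⟩ := h
  have hmem : ∀ z, e z ∈ Set.Icc (e a) (e b) ↔ z ∈ Set.Icc a b := fun z =>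
    and_congr (hle a z) (hle z b)
  refine ⟨fun v z ω => L v (e z) ω, ⟨fun z hz => hm (e z) ((hmem z).2 hz), ?_⟩, ?_⟩
  · filter_upwards [hd] with ω hω z hz B hB
    rw [← hω (e z) ((hmem z).2 hz) B hB, ← hvol.measure_preimage_equiv]
    congr 1
    ext w
    change (w ≤ z ∧ w ∈ Set.Icc a b) ∧ X w ω ∈ B ↔
      (e w ≤ e z ∧ e w ∈ Set.Icc (e a) (e b)) ∧ X (e.symm (e w)) ω ∈ B
    rw [hle, hmem, e.symm_apply_apply]
  · filter_upwards [hc] with ω hω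
    refine hω.comp (f := fun p : V × Z => (p.1, e p.2)) (by fun_prop) fun p hp => ?_
    exact ⟨Set.mem_univ _, (hmem p.2).2 hp.2⟩

variable {N d : ℕ} {Ω : Type*} [MeasurableSpace Ω] {P : Measure Ω} [IsProbabilityMeasure P]
  {H β : ℝ} {f h : EuclideanSpace ℝ (Fin N) → ℝ} {W : Fin d → Test N → Ω → ℝ}
  {u : ℝ → EuclideanSpace ℝ (Fin N) → Ω → EuclideanSpace ℝ (Fin d)}

theorem hasJointlyContinuousLocalTime_time (hH : 1 / 2 ≤ H) (hH1 : H < 1) (hβ0 : 0 < β)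
    (hβN : β < N) (hβlow : (N : ℝ) - 2 * H - 1 < β) (hf : IsSpatialCovariance β f h)
    (hW : IsFractionalColoredNoise P H f W) (hu : IsWaveSolution P H h W u)
    (hαd : holderIndex N H β * d < 1) (x₀ : EuclideanSpace ℝ (Fin N)) {a b : ℝ} (ha : 0 < a) :
    HasJointlyContinuousLocalTime P (fun (t : ℝ) ω => u t x₀ ω) a b := by
  have hN : 0 < N := by
    have : (0 : ℝ) < N := hβ0.trans hβN
    exact_mod_cast this
  refine HasJointlyContinuousLocalTime.of_measurableEquiv (MeasurableEquiv.funUnique (Fin 1) ℝ).symm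
    (fun z w => ?_) ?_ ((volume_preserving_funUnique (Fin 1) ℝ).symm _) ?_
  · exact ⟨fun h' => h' 0, fun h' _ => h'⟩
  · exact continuous_pi fun _ => continuous_id
  · refine hasJointlyContinuousLocalTime_waveSolution hH hH1 hβ0 hβN hβlow hf hW hu one_pos
      (by simpa using hαd) (τ := fun w => w 0) (χ := fun _ => x₀) (by fun_prop) (by fun_prop)
      (v := fun _ => EuclideanSpace.single ⟨0, hN⟩ 1) (fun _ => by simp)
      (M := fun s => Matrix.of fun _ _ => ‖EuclideanSpace.single ⟨0, hN⟩ (1 : ℝ) + s‖)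
      (o := fun s _ => -inner ℝ x₀ (EuclideanSpace.single ⟨0, hN⟩ (1 : ℝ) + s))
      ?_ ?_ ?_ ?_ ha ?_
    · exact continuous_matrix fun _ _ => by simp only [Matrix.of_apply]; fun_prop
    · simp
    · fun_prop
    · intro s w κ
      simp [Matrix.mulVec, dotProduct, sub_eq_add_neg]
    · exact fun w hw => hw.1 0

theorem hasJointlyContinuousLocalTime_space (hH : 1 / 2 ≤ H) (hH1 : H < 1) (hβ0 : 0 < β)
    (hβN : β < N) (hβlow : (N : ℝ) - 2 * H - 1 < β) (hf : IsSpatialCovariance β f h)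
    (hW : IsFractionalColoredNoise P H f W) (hu : IsWaveSolution P H h W u)
    (hαd : holderIndex N H β * d < N) {t₀ : ℝ} (ht₀ : 0 < t₀) (a b : Fin N → ℝ) :
    HasJointlyContinuousLocalTime P (fun (x : Fin N → ℝ) ω => u t₀ (WithLp.toLp 2 x) ω) a b := by
  have hN : 0 < N := by
    have : (0 : ℝ) < N := hβ0.trans hβN
    exact_mod_cast this
  refine hasJointlyContinuousLocalTime_waveSolution hH hH1 hβ0 hβN hβlow hf hW hu hN
    hαd (τ := fun _ => t₀) (χ := fun w => WithLp.toLp 2 w) (by fun_prop) (by fun_prop)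
    (v := fun κ => EuclideanSpace.single κ 1) (fun _ => by simp)
    (M := fun s => Matrix.of fun κ j => -(EuclideanSpace.single κ (1 : ℝ) + s) j)
    (o := fun s κ => ‖EuclideanSpace.single κ (1 : ℝ) + s‖ * t₀)
    ?_ ?_ ?_ ?_ ht₀ fun _ _ => le_rfl
  · exact continuous_matrix fun _ _ => by simp only [Matrix.of_apply]; fun_prop
  · have : (Matrix.of fun κ j => -(EuclideanSpace.single κ (1 : ℝ) + (0 : EuclideanSpace ℝ (Fin N))) j)
        = -(1 : Matrix (Fin N) (Fin N) ℝ) := by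
      ext i j
      simp [Matrix.one_apply, eq_comm]
    rw [this, Matrix.det_neg, Matrix.det_one, mul_one]
    exact pow_ne_zero _ (by norm_num)
  · fun_prop
  · intro s w κ
    rw [Pi.add_apply, sub_eq_add_neg, add_comm]
    congr 1
    simp only [PiLp.inner_apply, Matrix.mulVec, dotProduct, Matrix.of_apply]
    rw [← Finset.sum_neg_distrib]
    refine Finset.sum_congr rfl fun j _ => ?_
    rw [RCLike.inner_apply, conj_trivial, neg_mul]

theorem hasJointlyContinuousLocalTime_space_time (hH : 1 / 2 ≤ H) (hH1 : H < 1) (hβ0 : 0 < β)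
    (hβN : β < N) (hβlow : (N : ℝ) - 2 * H - 1 < β) (hf : IsSpatialCovariance β f h)
    (hW : IsFractionalColoredNoise P H f W) (hu : IsWaveSolution P H h W u)
    (hαd : holderIndex N H β * d < 1 + N) {a b : ℝ × (Fin N → ℝ)} (ha : 0 < a.1) :
    HasJointlyContinuousLocalTime P
      (fun (z : ℝ × (Fin N → ℝ)) ω => u z.1 (WithLp.toLp 2 z.2) ω) a b := by
  have hN : 0 < N := by
    have : (0 : ℝ) < N := hβ0.trans hβN
    exact_mod_cast this
  set v : Fin (N + 1) → EuclideanSpace ℝ (Fin N) := Fin.cons (-EuclideanSpace.single ⟨0, hN⟩ 1)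
    fun κ => EuclideanSpace.single κ 1 with hv
  set M : EuclideanSpace ℝ (Fin N) → Matrix (Fin (N + 1)) (Fin (N + 1)) ℝ := fun s =>
    Matrix.of fun κ => Fin.cons ‖v κ + s‖ fun j => -(v κ + s) j with hM
  have hMv : ∀ s w κ, (M s).mulVec w κ =
      ‖v κ + s‖ * w 0 - ∑ j : Fin N, (v κ + s) j * w j.succ := by
    intro s w κ
    simp only [hM, Matrix.mulVec, dotProduct, Matrix.of_apply, Fin.sum_univ_succ, Fin.cons_zero,
      Fin.cons_succ, neg_mul, Finset.sum_neg_distrib]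
    ring
  have hv1 : ∀ κ, ‖v κ‖ = 1 := fun κ => by
    refine Fin.cases ?_ (fun κ => ?_) κ <;> simp [hv]
  refine HasJointlyContinuousLocalTime.of_measurableEquiv
    (MeasurableEquiv.piFinSuccAbove (fun _ : Fin (N + 1) => ℝ) 0).symm
    (fun z w => ?_) ?_ ((volume_preserving_piFinSuccAbove (fun _ : Fin (N + 1) => ℝ) 0).symm _) ?_
  · constructor
    · intro h'
      exact ⟨by simpa using h' 0, fun j => by simpa using h' j.succ⟩
    · intro h' i
      refine Fin.cases ?_ (fun j => ?_) i
      · simpa using h'.1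
      · simpa using h'.2 j
  · refine continuous_pi fun i => Fin.cases ?_ (fun j => ?_) i
    · simpa using continuous_fst
    · have h1 : Continuous fun z : ℝ × (Fin N → ℝ) => z.2 j := by fun_prop
      simpa using h1
  · refine hasJointlyContinuousLocalTime_waveSolution hH hH1 hβ0 hβN hβlow hf hW hu
      (Nat.succ_pos N) (by push_cast; linarith) (τ := fun w => w 0)
      (χ := fun w => WithLp.toLp 2 fun j => w (Fin.succ j)) (by fun_prop) (by fun_prop) hv1
      (M := M) (o := fun _ => 0) ?_ ?_ continuous_const ?_ ha ?_
    · refine continuous_matrix fun κ j => ?_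
      refine Fin.cases ?_ (fun j => ?_) j
      · simp only [hM, Matrix.of_apply, Fin.cons_zero]; fun_prop
      · simp only [hM, Matrix.of_apply, Fin.cons_succ]; fun_prop
    · intro hdet
      obtain ⟨w, hw0, hw⟩ := Matrix.exists_mulVec_eq_zero_iff.2 hdet
      have h1 : ∀ κ, w 0 - ∑ j : Fin N, v κ j * w j.succ = 0 := fun κ => by
        have := congrFun hw κ
        rw [hMv, add_zero, hv1, one_mul] at this
        exact this
      have h2 : ∀ j : Fin N, w 0 = w j.succ := fun j => by
        have := h1 j.succ
        simp only [hv, Fin.cons_succ, PiLp.single_apply, ite_mul, one_mul, zero_mul,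
          Finset.sum_ite_eq', Finset.mem_univ, if_true] at this
        linarith
      have h3 : w 0 + w (Fin.succ ⟨0, hN⟩) = 0 := by
        have := h1 0
        simp only [hv, Fin.cons_zero, PiLp.neg_apply, PiLp.single_apply, neg_mul, ite_mul,
          one_mul, zero_mul, Finset.sum_neg_distrib, Finset.sum_ite_eq', Finset.mem_univ,
          if_true] at this
        linarith
      have h4 : w 0 = 0 := by linarith [h2 ⟨0, hN⟩]
      refine hw0 (funext fun i => ?_)
      refine Fin.cases ?_ (fun j => ?_) i
      · exact h4
      · rw [← h2 j, h4]; rfl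
    · intro s w κ
      rw [Pi.add_apply, Pi.zero_apply, add_zero, hMv]
      simp [PiLp.inner_apply]
    · intro w hw
      simpa using hw.1 0

end Coordinates

end

end StochasticWave

open StochasticWave in
theorem theorem4p7 {N d : ℕ} {Ω : Type*} [MeasurableSpace Ω] (P : Measure Ω)
    [IsProbabilityMeasure P] (H β : ℝ) (hH : 1 / 2 ≤ H) (hH1 : H < 1) (hβ0 : 0 < β) (hβN : β < N)
    (hβlow : (N : ℝ) - 2 * H - 1 < β) (hβup : β < (N : ℝ) - 2 * H + 1)
    (f h : EuclideanSpace ℝ (Fin N) → ℝ) (hf : IsSpatialCovariance β f h)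
    (W : Fin d → Test N → Ω → ℝ) (hW : IsFractionalColoredNoise P H f W)
    (u : ℝ → EuclideanSpace ℝ (Fin N) → Ω → EuclideanSpace ℝ (Fin d))
    (hu : IsWaveSolution P H h W u) :
    (holderIndex N H β * d < 1 →
      ∀ (x₀ : EuclideanSpace ℝ (Fin N)) (a b : ℝ), 0 < a →
        HasJointlyContinuousLocalTime P (fun (t : ℝ) ω => u t x₀ ω) a b) ∧
    (holderIndex N H β * d < N →
      ∀ t₀ : ℝ, 0 < t₀ → ∀ a b : Fin N → ℝ,
        HasJointlyContinuousLocalTime P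
          (fun (x : Fin N → ℝ) ω => u t₀ (WithLp.toLp 2 x) ω) a b) ∧
    (holderIndex N H β * d < 1 + N →
      ∀ a b : ℝ × (Fin N → ℝ), 0 < a.1 →
        HasJointlyContinuousLocalTime P
          (fun (z : ℝ × (Fin N → ℝ)) ω => u z.1 (WithLp.toLp 2 z.2) ω) a b) := by
  exact ⟨fun hα x₀ _ _ ha => hasJointlyContinuousLocalTime_time hH hH1 hβ0 hβN hβlow hf hW hu hα x₀ ha,
    fun hα _ ht₀ a b => hasJointlyContinuousLocalTime_space hH hH1 hβ0 hβN hβlow hf hW hu hα ht₀ a b,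
    fun hα _ _ ha => hasJointlyContinuousLocalTime_space_time hH hH1 hβ0 hβN hβlow hf hW hu hα ha⟩
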